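/- Let $K\subset\mathbb C$ be compact, and let $\mathcal M(K)$ be the set of Borel probability measures on $K$. For $\nu\in\mathcal M(K)$ put $$p_\nu(z)=\int_K\log\frac1{|z-\zeta|}\,d\nu(\zeta)\in(-\infty,+\infty],\qquad I(\nu)=\int_K p_\nu\,d\nu .$$ Let $L(\mathbb C)$ be the class of subharmonic functions $v\not\equiv-\infty$ on $\mathbb C$ such that $v(z)-\log|z|$ is bounded above as $|z|\to\infty$. For a continuous $Q:K\to\mathbb R$ put $$V_{K,Q}(z)=\sup\{v(z): v\in L(\mathbb C),\ v\le Q\text{ on }K\},\qquad V^*_{K,Q}(z)=\limsup_{\zeta\to z}V_{K,Q}(\zeta),$$ and $\mu_{K,Q}=dd^cV^*_{K,Q}$ in the sense of distributions, where $dd^c=\frac i\pi\partial\bar\partial=\frac1{2\pi}\Delta$ (so that $dd^c\log|z|=\delta_0$). Let $\mu\in\mathcal M(K)$ satisfy $I(\mu)<+\infty$ (in particular, $K$ is non-polar), and let $u=-p_\mu$. Let $Q_j:K\to\mathbb R$, $j=0,1,2,\dots$, be continuous functions which decrease pointwise on $K$ to $u$. Put $u_j=V^*_{K,Q_j}$ and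 $\mu_j=\mu_{K,Q_j}$. Then each $\mu_j$ is a well-defined element of $\mathcal M(K)$ (that is, $dd^cu_j$ is a probability measure carried by $K$), there are constants $F_j\in\mathbb R$ such that $$p_{\mu_j}(z)+u_j(z)=F_j\quad\text{for all } z\in\mathbb C,$$ and $$\lim_{j\to\infty}F_j=0,\qquad \lim_{j\to\infty}I(\mu_j)=I(\mu),\qquad \lim_{j\to\infty}\int_K u_j\,d\mu_j=\int_K u\,d\mu .$$ -/

import Mathlib

open MeasureTheory Filter Topology
open scoped ENNReal ContDiff

noncomputable section

namespace LogPotential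

/-- The integral `∫ f dμ = ∫ f⁺ dμ - ∫ f⁻ dμ` of an extended-real-valued function. It is meaningful
as soon as one of the two parts is finite, which is the case wherever it is used below. -/
def eintegral {α : Type*} [MeasurableSpace α] (μ : Measure α) (f : α → EReal) : EReal :=
  ((∫⁻ x, (f x).toENNReal ∂μ : ℝ≥0∞) : EReal) - ((∫⁻ x, (-f x).toENNReal ∂μ : ℝ≥0∞) : EReal)

/-- The set `M(K)` of Borel probability measures on `K`, viewed as measures on `ℂ` carried by `K`. -/
structure IsProbOn (K : Set ℂ) (μ : Measure ℂ) : Prop where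
  isProb : IsProbabilityMeasure μ
  compl_eq_zero : μ Kᶜ = 0

/-- The logarithmic potential `p_μ(z) = ∫ log (1 / |z - ζ|) dμ(ζ)`, where the kernel is `+∞`
on the diagonal (`ENNReal.log 0 = ⊥`). -/
def potential (μ : Measure ℂ) (z : ℂ) : EReal :=
  eintegral μ fun ζ => -ENNReal.log (edist z ζ)

/-- The logarithmic energy `I(μ) = ∫ ∫ log (1 / |z - ζ|) dμ(ζ) dμ(z)`. -/
def energy (μ : Measure ℂ) : EReal :=
  eintegral μ (potential μ)

/-- Subharmonic functions on `ℂ`, with values in `[-∞, ∞)` and not identically `-∞`. -/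
structure IsSubharmonic (u : ℂ → EReal) : Prop where
  usc : UpperSemicontinuous u
  lt_top : ∀ z, u z < ⊤
  ne_bot : ∃ z, u z ≠ ⊥
  le_mean : ∀ (z : ℂ) (r : ℝ), 0 < r →
    u z ≤ (((2 * Real.pi)⁻¹ : ℝ) : EReal) *
      eintegral (volume.restrict (Set.Ioc 0 (2 * Real.pi))) fun θ => u (circleMap z r θ)

/-- The Lelong class `L(ℂ)`: subharmonic functions on `ℂ` for which `u(z) - log |z|` is bounded
above as `|z| → ∞`. -/
structure IsLelong (u : ℂ → EReal) : Prop where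
  subharmonic : IsSubharmonic u
  growth : ∃ C : ℝ, ∀ᶠ z in cocompact ℂ, u z ≤ ((Real.log ‖z‖ + C : ℝ) : EReal)

/-- The weighted extremal function `V_{K,Q}(z) = sup {u(z) : u ∈ L(ℂ), u ≤ Q on K}`. -/
def extremal (K : Set ℂ) (Q : ℂ → ℝ) (z : ℂ) : EReal :=
  sSup {t : EReal | ∃ u : ℂ → EReal, IsLelong u ∧ (∀ ζ ∈ K, u ζ ≤ (Q ζ : EReal)) ∧ t = u z}

/-- The weighted Green function `V*_{K,Q}(z) = limsup_{ζ → z} V_{K,Q}(ζ)`. -/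
def extremalStar (K : Set ℂ) (Q : ℂ → ℝ) (z : ℂ) : EReal :=
  limsup (extremal K Q) (𝓝 z)

/-- `dd^c u = μ` in the sense of distributions, for `u` locally integrable and `μ` a positive
Radon measure. With the normalization `dd^c = (i/π) ∂ ∂-bar = (1/(2π)) Δ`, one has
`dd^c log |z| = δ₀`. -/
structure IsDdc (u : ℂ → EReal) (μ : Measure ℂ) : Prop where
  ae_finite : ∀ᵐ z : ℂ, u z ≠ ⊥ ∧ u z ≠ ⊤
  locallyIntegrable : LocallyIntegrable (fun z => (u z).toReal) (volume : Measure ℂ)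
  locallyFinite : IsLocallyFiniteMeasure μ
  integral_eq : ∀ φ : ℂ → ℝ, ContDiff ℝ ∞ φ → HasCompactSupport φ →
    ∫ z : ℂ, (u z).toReal * Laplacian.laplacian φ z = 2 * Real.pi * ∫ z, φ z ∂μ

open Classical in
/-- The measure `dd^c u`: the (unique) positive Radon measure which equals `dd^c u` in the sense of
distributions, and `0` if there is none. -/
def ddc (u : ℂ → EReal) : Measure ℂ :=
  if h : ∃ μ : Measure ℂ, IsDdc u μ then h.choose else 0

/-- The weighted equilibrium measure `μ_{K,Q} = dd^c V*_{K,Q}`. -/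
def equilibriumMeasure (K : Set ℂ) (Q : ℂ → ℝ) : Measure ℂ :=
  ddc (extremalStar K Q)

end LogPotential

end

noncomputable section

namespace LogPotential

/-! ### Integrals of extended-real-valued functions -/

/-! The core is the structure theorem `exists_extremalStar_eq`: the weighted Green function V*
equals F - p_ν for a probability measure ν on K. Let Q be continuous on the plane and let μ_n
minimize the weighted energy I + 2∫Q on the closed 1/(n+1)-neighbourhood of K. Testing minimality
against small circles gives F_n - p_{μ_n} ≤ Q at every point of K, so this function competes in the
supremum V. Testing it against restrictions of μ_n gives Q ≤ F_n - p_{μ_n} almost everywhere for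
μ_n, and the domination principle `IsSubLelong.domination` then puts every competitor below F_n + ε
- p_{μ_n} for large n. Along a weak limit (μ', F'), V lies above F_n - p_{μ_n} and below F' -
p_{μ'}. Integrals of potentials against measures with continuous potential pass to the limit, so V =
F' - p_{μ'} almost everywhere for such measures. Applied to circles this identifies V*; applied to
large pieces of a measure μ₀ of finite energy it gives V* ≤ Q almost everywhere for μ₀. That dd^c (F
- p_ν) = ν follows by smoothing the logarithm: the Laplacian of log(|z|² + ε)/2 is an approximate
identity of mass 2π.

For the convergence, -p_μ is itself a competitor for each Q_j, so u_j ≥ -p_μ. The decreasing limit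
of the u_j is at most -p_μ almost everywhere for μ, hence everywhere by domination. Thus p_{μ_j} -
F_j increases to p_μ. On a circle of radius R enclosing K every such potential has mean -log R,
which forces F_j → 0. Monotone convergence and the symmetry of mutual energies then squeeze I(μ_j)
between quantities tending to I(μ), and the last limit comes from integrating u_j = F_j - p_{μ_j}
against μ_j.

Singular integrals are reached through the kernel -log max(|z - w|, r), which is continuous and
increases to the logarithmic kernel as r decreases to 0. -/

theorem tendsto_coe_sub_const {ι : Type*} {l : Filter ι} {a : ι → ℝ} {x : EReal}
    (h : Tendsto (fun n => (a n : EReal)) l (𝓝 x)) (c : ℝ) :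
    Tendsto (fun n => ((a n - c : ℝ) : EReal)) l (𝓝 (x - c)) := by
  have h1 : ContinuousAt (fun p : EReal × EReal => p.1 + p.2) (x, ((-c : ℝ) : EReal)) :=
    EReal.continuousAt_add (Or.inr (EReal.coe_ne_bot _)) (Or.inr (EReal.coe_ne_top _))
  have h2 := Tendsto.comp h1 (h.prodMk_nhds tendsto_const_nhds)
  simpa [Function.comp_def, sub_eq_add_neg] using h2

theorem tendsto_const_sub_coe {ι : Type*} {l : Filter ι} {a : ι → ℝ} {x : EReal}
    (h : Tendsto (fun n => (a n : EReal)) l (𝓝 x)) (c : ℝ) :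
    Tendsto (fun n => ((c - a n : ℝ) : EReal)) l (𝓝 (c - x)) := by
  have h1 := (tendsto_coe_sub_const h c).neg
  rw [EReal.neg_sub (Or.inr (EReal.coe_ne_bot _)) (Or.inr (EReal.coe_ne_top _)), add_comm,
    ← sub_eq_add_neg] at h1
  refine h1.congr fun n => ?_
  rw [← EReal.coe_neg, neg_sub]

section EIntegral

variable {α : Type*} [MeasurableSpace α] {ν : Measure α}

theorem eintegral_mono {f g : α → EReal} (h : ∀ x, f x ≤ g x) :
    eintegral ν f ≤ eintegral ν g := by
  refine EReal.sub_le_sub ?_ ?_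
  · exact EReal.coe_ennreal_le_coe_ennreal_iff.2
      (lintegral_mono fun x => EReal.toENNReal_le_toENNReal (h x))
  · exact EReal.coe_ennreal_le_coe_ennreal_iff.2
      (lintegral_mono fun x => EReal.toENNReal_le_toENNReal (EReal.neg_le_neg_iff.2 (h x)))

theorem eintegral_congr_ae {f g : α → EReal} (h : f =ᵐ[ν] g) :
    eintegral ν f = eintegral ν g := by
  have h1 : ∫⁻ x, (f x).toENNReal ∂ν = ∫⁻ x, (g x).toENNReal ∂ν :=
    lintegral_congr_ae (h.mono fun x hx => by simp only [hx])
  have h2 : ∫⁻ x, (-f x).toENNReal ∂ν = ∫⁻ x, (-g x).toENNReal ∂ν :=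
    lintegral_congr_ae (h.mono fun x hx => by simp only [hx])
  rw [eintegral, eintegral, h1, h2]

theorem lintegral_ofReal_ne_top {f : α → ℝ} (hf : Integrable f ν) :
    ∫⁻ x, ENNReal.ofReal (f x) ∂ν ≠ ⊤ :=
  hf.lintegral_lt_top.ne

theorem eintegral_coe {f : α → ℝ} (hf : Integrable f ν) :
    eintegral ν (fun x => (f x : EReal)) = ((∫ x, f x ∂ν : ℝ) : EReal) := by
  rw [integral_eq_lintegral_pos_part_sub_lintegral_neg_part hf, eintegral]
  simp only [← EReal.coe_neg, EReal.real_coe_toENNReal]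
  rw [EReal.coe_sub, EReal.coe_ennreal_toReal (lintegral_ofReal_ne_top hf),
    EReal.coe_ennreal_toReal
      (show ∫⁻ x, ENNReal.ofReal (-f x) ∂ν ≠ ⊤ from lintegral_ofReal_ne_top hf.neg)]

/-- An integrable real minorant keeps the integral of the negative part finite, which excludes ∞ -
∞. -/
theorem eintegral_neg_of_bddBelow {f : ℕ → α → ℝ} {g : α → EReal} (hint : ∀ n, Integrable (f n) ν)
    (hle : ∀ x, (f 0 x : EReal) ≤ g x) :
    eintegral ν (fun x => -g x) = -eintegral ν g := by
  have hfin : ∫⁻ x, (-g x).toENNReal ∂ν ≠ ⊤ := by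
    refine ne_top_of_le_ne_top (lintegral_ofReal_ne_top (hint 0).neg) (lintegral_mono fun x => ?_)
    have := EReal.toENNReal_le_toENNReal (EReal.neg_le_neg_iff.2 (hle x))
    rwa [← EReal.coe_neg, EReal.real_coe_toENNReal] at this
  rw [eintegral, eintegral]
  simp only [neg_neg]
  rw [EReal.neg_sub]
  · rw [add_comm, sub_eq_add_neg]
  · left; exact EReal.coe_ennreal_ne_bot _
  · right; simpa using hfin

/-- Monotone convergence without a sign: positive parts increase, negative parts decrease from an
integrable one, and the finite limit of the latter makes the difference continuous. -/
theorem tendsto_eintegral_of_monotone {f : ℕ → α → ℝ} {g : α → EReal}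
    (hint : ∀ n, Integrable (f n) ν) (hmono : ∀ x, Monotone fun n => f n x)
    (hlim : ∀ x, Tendsto (fun n => (f n x : EReal)) atTop (𝓝 (g x))) :
    Tendsto (fun n => ((∫ x, f n x ∂ν : ℝ) : EReal)) atTop (𝓝 (eintegral ν g)) := by
  have hpos : Tendsto (fun n => ∫⁻ x, ENNReal.ofReal (f n x) ∂ν) atTop
      (𝓝 (∫⁻ x, (g x).toENNReal ∂ν)) := by
    refine lintegral_tendsto_of_tendsto_of_monotone
      (fun n => (hint n).aemeasurable.ennreal_ofReal)
      (ae_of_all _ fun x m n hmn => ENNReal.ofReal_le_ofReal (hmono x hmn)) (ae_of_all _ fun x => ?_)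
    exact (EReal.continuous_toENNReal.tendsto _).comp (hlim x)
  have hneg : Tendsto (fun n => ∫⁻ x, ENNReal.ofReal (-f n x) ∂ν) atTop
      (𝓝 (∫⁻ x, (-g x).toENNReal ∂ν)) := by
    refine lintegral_tendsto_of_tendsto_of_antitone
      (fun n => (hint n).aemeasurable.neg.ennreal_ofReal)
      (ae_of_all _ fun x m n hmn => ENNReal.ofReal_le_ofReal (neg_le_neg (hmono x hmn)))
      (lintegral_ofReal_ne_top (hint 0).neg) (ae_of_all _ fun x => ?_)
    exact (EReal.continuous_toENNReal.tendsto _).comp (hlim x).neg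
  have hfin : ∫⁻ x, (-g x).toENNReal ∂ν ≠ ⊤ := by
    refine ne_top_of_le_ne_top (lintegral_ofReal_ne_top (hint 0).neg) (lintegral_mono fun x => ?_)
    have hle : (f 0 x : EReal) ≤ g x :=
      ge_of_tendsto' (hlim x) fun n => EReal.coe_le_coe_iff.2 (hmono x (Nat.zero_le n))
    have := EReal.toENNReal_le_toENNReal (EReal.neg_le_neg_iff.2 hle)
    rwa [← EReal.coe_neg, EReal.real_coe_toENNReal] at this
  have hfun : (fun n => ((∫ x, f n x ∂ν : ℝ) : EReal)) = fun n =>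
      ((∫⁻ x, ENNReal.ofReal (f n x) ∂ν : ℝ≥0∞) : EReal)
        + -((∫⁻ x, ENNReal.ofReal (-f n x) ∂ν : ℝ≥0∞) : EReal) := by
    ext n
    rw [← eintegral_coe (hint n), eintegral, sub_eq_add_neg]
    simp only [← EReal.coe_neg, EReal.real_coe_toENNReal]
  rw [hfun, eintegral, sub_eq_add_neg]
  have hp := (continuous_coe_ennreal_ereal.tendsto _).comp hpos
  have hn := ((continuous_coe_ennreal_ereal.tendsto _).comp hneg).neg
  refine Tendsto.comp (EReal.continuousAt_add (p := (_, _)) ?_ ?_) (hp.prodMk_nhds hn)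
  · right
    simpa using hfin
  · left
    exact EReal.coe_ennreal_ne_bot _

/-- Monotone convergence for the nonnegative functions `f n - f 0`. This is how bounded truncated
energies yield an integrable, almost everywhere finite potential. -/
theorem monotone_limit_integrable {f : ℕ → α → ℝ} {g : α → EReal} {C : ℝ}
    (hint : ∀ n, Integrable (f n) ν) (hmono : ∀ x, Monotone fun n => f n x)
    (hlim : ∀ x, Tendsto (fun n => (f n x : EReal)) atTop (𝓝 (g x)))
    (hC : ∀ n, ∫ x, f n x ∂ν ≤ C) :
    (∀ᵐ x ∂ν, g x = ((g x).toReal : EReal)) ∧ Integrable (fun x => (g x).toReal) ν ∧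
      Tendsto (fun n => ∫ x, f n x ∂ν) atTop (𝓝 (∫ x, (g x).toReal ∂ν)) := by
  have hle : ∀ n x, (f n x : EReal) ≤ g x := fun n x =>
    ge_of_tendsto (hlim x) (eventually_atTop.2 ⟨n, fun m hm => EReal.coe_le_coe_iff.2 (hmono x hm)⟩)
  have hpos : Tendsto (fun n => ∫⁻ x, ENNReal.ofReal (f n x - f 0 x) ∂ν) atTop
      (𝓝 (∫⁻ x, (g x - (f 0 x : EReal)).toENNReal ∂ν)) := by
    refine lintegral_tendsto_of_tendsto_of_monotone
      (fun n => ((hint n).sub (hint 0)).aemeasurable.ennreal_ofReal)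
      (ae_of_all _ fun x m n hmn => ENNReal.ofReal_le_ofReal (sub_le_sub_right (hmono x hmn) _))
      (ae_of_all _ fun x => ?_)
    exact (EReal.continuous_toENNReal.tendsto _).comp (tendsto_coe_sub_const (hlim x) _)
  have hfin : ∫⁻ x, (g x - (f 0 x : EReal)).toENNReal ∂ν ≤ ENNReal.ofReal (C - ∫ x, f 0 x ∂ν) := by
    refine le_of_tendsto' hpos fun n => ?_
    have h1 := ofReal_integral_eq_lintegral_ofReal ((hint n).sub (hint 0))
      (ae_of_all _ fun x => sub_nonneg.2 (hmono x (Nat.zero_le n)))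
    have h2 : ∫ x, (f n - f 0) x ∂ν = ∫ x, f n x ∂ν - ∫ x, f 0 x ∂ν :=
      integral_sub (hint n) (hint 0)
    refine h1.symm.trans_le (ENNReal.ofReal_le_ofReal ?_)
    rw [h2]
    linarith [hC n]
  have hmeas : AEMeasurable (fun x => (g x - (f 0 x : EReal)).toENNReal) ν :=
    aemeasurable_of_tendsto_metrizable_ae atTop
      (fun n => ((hint n).sub (hint 0)).aemeasurable.ennreal_ofReal)
      (ae_of_all _ fun x =>
        (EReal.continuous_toENNReal.tendsto _).comp (tendsto_coe_sub_const (hlim x) _))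
  have hae : ∀ᵐ x ∂ν, (g x - (f 0 x : EReal)).toENNReal < ⊤ :=
    ae_lt_top' hmeas (ne_top_of_le_ne_top ENNReal.ofReal_ne_top hfin)
  have hreal : ∀ᵐ x ∂ν, g x = ((g x).toReal : EReal) := by
    filter_upwards [hae] with x hx
    refine (EReal.coe_toReal ?_ ?_).symm
    · intro h
      rw [h, EReal.top_sub_coe] at hx
      simp at hx
    · intro h
      have := hle 0 x
      rw [h] at this
      simp at this
  have hint' : Integrable (fun x => (g x).toReal) ν := by
    have h1 : Integrable (fun x => ((g x - (f 0 x : EReal)).toENNReal).toReal) ν :=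
      integrable_toReal_of_lintegral_ne_top hmeas (ne_top_of_le_ne_top ENNReal.ofReal_ne_top hfin)
    refine (h1.add (hint 0)).congr ?_
    filter_upwards [hreal] with x hx
    have h0 : f 0 x ≤ (g x).toReal := by
      rw [← EReal.coe_le_coe_iff, ← hx]
      exact hle 0 x
    simp only [Pi.add_apply]
    rw [hx, ← EReal.coe_sub, EReal.real_coe_toENNReal, ENNReal.toReal_ofReal (by linarith),
      EReal.toReal_coe]
    ring
  refine ⟨hreal, hint', integral_tendsto_of_tendsto_of_monotone hint hint' (ae_of_all _ hmono) ?_⟩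
  filter_upwards [hreal] with x hx
  have := hlim x
  rw [hx] at this
  exact EReal.tendsto_coe.1 this

end EIntegral

/-! ### Compactly carried finite measures -/

/-- Finite measures on `ℂ` carried by a compact set. -/
structure CompactlyCarried (μ : Measure ℂ) : Prop where
  finite : IsFiniteMeasure μ
  carrier : ∃ B : Set ℂ, IsCompact B ∧ μ Bᶜ = 0

theorem IsProbOn.compactlyCarried {K : Set ℂ} (hK : IsCompact K) {μ : Measure ℂ}
    (h : IsProbOn K μ) : CompactlyCarried μ :=
  ⟨have := h.isProb; inferInstance, K, hK, h.compl_eq_zero⟩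

theorem IsProbOn.ae_mem {K : Set ℂ} {μ : Measure ℂ} (h : IsProbOn K μ) : ∀ᵐ x ∂μ, x ∈ K :=
  h.compl_eq_zero

theorem IsProbOn.mono {K L : Set ℂ} (hKL : K ⊆ L) {μ : Measure ℂ} (h : IsProbOn K μ) :
    IsProbOn L μ :=
  ⟨h.isProb, measure_mono_null (Set.compl_subset_compl.2 hKL) h.compl_eq_zero⟩

theorem IsProbOn.nonempty {K : Set ℂ} {μ : Measure ℂ} (h : IsProbOn K μ) : K.Nonempty := by
  rw [Set.nonempty_iff_ne_empty]
  rintro rfl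
  have := h.isProb
  have h1 := h.compl_eq_zero
  simp at h1

namespace CompactlyCarried

variable {μ ν : Measure ℂ}

theorem exists_ball (h : CompactlyCarried μ) :
    ∃ R : ℝ, 1 ≤ R ∧ ∀ᵐ x ∂μ, x ∈ Metric.closedBall (0 : ℂ) R := by
  obtain ⟨B, hB, hμ⟩ := h.carrier
  obtain ⟨R, hR⟩ := hB.isBounded.subset_closedBall 0
  refine ⟨max R 1, le_max_right _ _, ?_⟩
  have hμ' : ∀ᵐ x ∂μ, x ∈ B := hμ
  filter_upwards [hμ'] with x hx
  exact Metric.closedBall_subset_closedBall (le_max_left _ _) (hR hx)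

theorem integrable (h : CompactlyCarried μ) {f : ℂ → ℝ} (hf : Continuous f) :
    Integrable f μ := by
  have := h.finite
  obtain ⟨B, hB, hμ⟩ := h.carrier
  obtain ⟨C, hC⟩ := hB.exists_bound_of_continuousOn hf.continuousOn
  have hμ' : ∀ᵐ x ∂μ, x ∈ B := hμ
  exact Integrable.of_bound hf.aestronglyMeasurable C (hμ'.mono hC)

theorem integrable_prod (h : CompactlyCarried μ) (h' : CompactlyCarried ν) {f : ℂ × ℂ → ℝ}
    (hf : Continuous f) : Integrable f (μ.prod ν) := by
  have := h.finite
  have := h'.finite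
  obtain ⟨B, hB, hμ⟩ := h.carrier
  obtain ⟨B', hB', hν⟩ := h'.carrier
  obtain ⟨C, hC⟩ := (hB.prod hB').exists_bound_of_continuousOn hf.continuousOn
  have h1 : ∀ᵐ x ∂(μ.prod ν), x.1 ∈ B :=
    Measure.quasiMeasurePreserving_fst.ae (show ∀ᵐ x ∂μ, x ∈ B from hμ)
  have h2 : ∀ᵐ x ∂(μ.prod ν), x.2 ∈ B' :=
    Measure.quasiMeasurePreserving_snd.ae (show ∀ᵐ x ∂ν, x ∈ B' from hν)
  refine Integrable.of_bound hf.aestronglyMeasurable C ?_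
  filter_upwards [h1, h2] with x hx1 hx2
  exact hC x ⟨hx1, hx2⟩

theorem of_le (h : CompactlyCarried μ) (hle : ν ≤ μ) : CompactlyCarried ν := by
  have := h.finite
  obtain ⟨B, hB, hμ⟩ := h.carrier
  exact ⟨isFiniteMeasure_of_le μ hle, B, hB, le_antisymm ((hle _).trans hμ.le) bot_le⟩

theorem restrict (h : CompactlyCarried μ) (A : Set ℂ) : CompactlyCarried (μ.restrict A) :=
  h.of_le Measure.restrict_le_self

end CompactlyCarried

/-! ### The truncated logarithmic kernel -/

/-- The truncated logarithmic kernel `-log max(|z - w|, r)`, which is the mean of `-log |· - w|`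
over the circle of radius `r` around `z`. -/
def truncKernel (r : ℝ) (z w : ℂ) : ℝ := -Real.log (max ‖z - w‖ r)

theorem truncKernel_comm (r : ℝ) (z w : ℂ) : truncKernel r z w = truncKernel r w z := by
  simp only [truncKernel, norm_sub_rev]

theorem continuous_truncKernel {r : ℝ} (hr : 0 < r) :
    Continuous fun p : ℂ × ℂ => truncKernel r p.1 p.2 := by
  refine (Continuous.log (by fun_prop) fun p => ?_).neg
  exact (lt_max_of_lt_right hr).ne'

theorem continuous_truncKernel_left {r : ℝ} (hr : 0 < r) (w : ℂ) :
    Continuous fun z => truncKernel r z w :=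
  (continuous_truncKernel hr).comp (by fun_prop : Continuous fun z : ℂ => (z, w))

theorem continuous_truncKernel_right {r : ℝ} (hr : 0 < r) (z : ℂ) :
    Continuous fun w => truncKernel r z w :=
  (continuous_truncKernel hr).comp (by fun_prop : Continuous fun w : ℂ => (z, w))

theorem truncKernel_anti {r s : ℝ} (hr : 0 < r) (hrs : r ≤ s) (z w : ℂ) :
    truncKernel s z w ≤ truncKernel r z w :=
  neg_le_neg (Real.log_le_log (lt_max_of_lt_right hr) (max_le_max le_rfl hrs))

theorem truncKernel_of_le {r : ℝ} {z w : ℂ} (h : r ≤ ‖z - w‖) :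
    truncKernel r z w = -Real.log ‖z - w‖ := by
  rw [truncKernel, max_eq_left h]

theorem truncKernel_of_ge {r : ℝ} {z w : ℂ} (h : ‖z - w‖ ≤ r) :
    truncKernel r z w = -Real.log r := by
  rw [truncKernel, max_eq_right h]

theorem truncKernel_ge {r D : ℝ} (hr : 0 < r) {z w : ℂ} (h : ‖z - w‖ ≤ D) (hD : r ≤ D) :
    -Real.log D ≤ truncKernel r z w :=
  neg_le_neg (Real.log_le_log (lt_max_of_lt_right hr) (max_le h hD))

/-- The radii `2⁻ⁿ`. -/
def dyadic (n : ℕ) : ℝ := (1 / 2) ^ n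

theorem dyadic_pos (n : ℕ) : 0 < dyadic n := by unfold dyadic; positivity

theorem dyadic_anti : Antitone dyadic := fun _ _ h =>
  pow_le_pow_of_le_one (by norm_num) (by norm_num) h

theorem dyadic_le_one (n : ℕ) : dyadic n ≤ 1 := pow_le_one₀ (by norm_num) (by norm_num)

theorem tendsto_dyadic : Tendsto dyadic atTop (𝓝 0) :=
  tendsto_pow_atTop_nhds_zero_of_lt_one (by norm_num) (by norm_num)

theorem dyadic_succ (n : ℕ) : 2 * dyadic (n + 1) = dyadic n := by
  simp only [dyadic, pow_succ]; ring

theorem monotone_truncKernel (z w : ℂ) : Monotone fun n => truncKernel (dyadic n) z w :=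
  fun _ _ h => truncKernel_anti (dyadic_pos _) (dyadic_anti h) z w

theorem tendsto_truncKernel_of_ne {z w : ℂ} (h : z ≠ w) :
    Tendsto (fun n => truncKernel (dyadic n) z w) atTop (𝓝 (-Real.log ‖z - w‖)) := by
  have h0 : 0 < ‖z - w‖ := norm_pos_iff.2 (sub_ne_zero.2 h)
  refine tendsto_const_nhds.congr' ?_
  filter_upwards [tendsto_dyadic.eventually (gt_mem_nhds h0)] with n hn
  exact (truncKernel_of_le hn.le).symm

theorem tendsto_truncKernel (z w : ℂ) :
    Tendsto (fun n => (truncKernel (dyadic n) z w : EReal)) atTop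
      (𝓝 (-ENNReal.log (edist z w))) := by
  by_cases h : z = w
  · subst h
    simp only [edist_self, ENNReal.log_zero, EReal.neg_bot, EReal.tendsto_coe_nhds_top_iff]
    have : (fun n => truncKernel (dyadic n) z z) = fun n : ℕ => n * Real.log 2 := by
      ext n
      rw [truncKernel_of_ge (by simpa using (dyadic_pos n).le), dyadic, Real.log_pow]
      simp
    rw [this]
    exact tendsto_natCast_atTop_atTop.atTop_mul_const (Real.log_pos one_lt_two)
  · have h0 : 0 < ‖z - w‖ := norm_pos_iff.2 (sub_ne_zero.2 h)
    rw [edist_dist, ENNReal.log_ofReal, dist_eq_norm, if_neg h0.not_ge, ← EReal.coe_neg]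
    exact (continuous_coe_real_ereal.tendsto _).comp (tendsto_truncKernel_of_ne h)

/-! ### Truncated potentials -/

/-- The potential of `μ` for the truncated kernel. -/
def truncPotential (μ : Measure ℂ) (r : ℝ) (z : ℂ) : ℝ := ∫ w, truncKernel r z w ∂μ

section TruncPotential

variable {μ ν : Measure ℂ}

theorem integrable_truncKernel (hμ : CompactlyCarried μ) {r : ℝ} (hr : 0 < r) (z : ℂ) :
    Integrable (fun w => truncKernel r z w) μ :=
  hμ.integrable (continuous_truncKernel_right hr z)

theorem monotone_truncPotential (hμ : CompactlyCarried μ) (z : ℂ) :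
    Monotone fun n => truncPotential μ (dyadic n) z := fun m n h =>
  integral_mono (integrable_truncKernel hμ (dyadic_pos m) z)
    (integrable_truncKernel hμ (dyadic_pos n) z) fun w => monotone_truncKernel z w h

theorem truncPotential_anti (hμ : CompactlyCarried μ) {r s : ℝ} (hr : 0 < r) (hrs : r ≤ s) (z : ℂ) :
    truncPotential μ s z ≤ truncPotential μ r z :=
  integral_mono (integrable_truncKernel hμ (hr.trans_le hrs) z)
    (integrable_truncKernel hμ hr z) fun w => truncKernel_anti hr hrs z w

theorem tendsto_truncPotential (hμ : CompactlyCarried μ) (z : ℂ) :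
    Tendsto (fun n => (truncPotential μ (dyadic n) z : EReal)) atTop (𝓝 (potential μ z)) :=
  tendsto_eintegral_of_monotone (fun n => integrable_truncKernel hμ (dyadic_pos n) z)
    (fun w => monotone_truncKernel z w) fun w => tendsto_truncKernel z w

theorem truncPotential_le_potential (hμ : CompactlyCarried μ) (n : ℕ) (z : ℂ) :
    (truncPotential μ (dyadic n) z : EReal) ≤ potential μ z :=
  ge_of_tendsto (tendsto_truncPotential hμ z) (eventually_atTop.2
    ⟨n, fun _ hm => EReal.coe_le_coe_iff.2 (monotone_truncPotential hμ z hm)⟩)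

theorem potential_ne_bot (hμ : CompactlyCarried μ) (z : ℂ) : potential μ z ≠ ⊥ := fun h => by
  have := truncPotential_le_potential hμ 0 z
  rw [h] at this
  simp at this

theorem continuous_truncPotential (hμ : CompactlyCarried μ) {r : ℝ} (hr : 0 < r) :
    Continuous (truncPotential μ r) := by
  have := hμ.finite
  obtain ⟨B, hB, hμB⟩ := hμ.carrier
  have hB' : ∀ᵐ w ∂μ, w ∈ B := hμB
  rw [continuous_iff_continuousAt]
  intro z
  obtain ⟨C, hC⟩ := ((isCompact_closedBall z 1).prod hB).exists_bound_of_continuousOn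
    (continuous_truncKernel hr).continuousOn
  refine continuousAt_of_dominated (bound := fun _ => C) ?_ ?_ (integrable_const C) ?_
  · exact Eventually.of_forall fun y =>
      (continuous_truncKernel_right hr y).aestronglyMeasurable
  · filter_upwards [Metric.closedBall_mem_nhds z one_pos] with y hy
    filter_upwards [hB'] with w hw
    exact hC (y, w) ⟨hy, hw⟩
  · exact ae_of_all _ fun w => (continuous_truncKernel_left hr w).continuousAt

/-- The mutual energy of two measures for the truncated kernel. -/
def truncEnergy (r : ℝ) (μ ν : Measure ℂ) : ℝ := ∫ z, truncPotential ν r z ∂μ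

theorem truncEnergy_eq_prod (hμ : CompactlyCarried μ) (hν : CompactlyCarried ν) {r : ℝ}
    (hr : 0 < r) :
    truncEnergy r μ ν = ∫ p : ℂ × ℂ, truncKernel r p.1 p.2 ∂(μ.prod ν) := by
  have := hμ.finite
  have := hν.finite
  rw [integral_prod _ (hμ.integrable_prod hν (continuous_truncKernel hr))]
  rfl

theorem truncEnergy_comm (hμ : CompactlyCarried μ) (hν : CompactlyCarried ν) {r : ℝ}
    (hr : 0 < r) : truncEnergy r μ ν = truncEnergy r ν μ := by
  have := hμ.finite
  have := hν.finite
  have h := integral_integral_swap (f := fun z w => truncKernel r z w) (μ := μ) (ν := ν)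
    (hμ.integrable_prod hν (continuous_truncKernel hr))
  simp only [truncEnergy, truncPotential]
  rw [h]
  simp only [truncKernel_comm]

theorem monotone_truncEnergy (hμ : CompactlyCarried μ) (hν : CompactlyCarried ν) :
    Monotone fun n => truncEnergy (dyadic n) μ ν := fun m n h =>
  integral_mono (hμ.integrable (continuous_truncPotential hν (dyadic_pos m)))
    (hμ.integrable (continuous_truncPotential hν (dyadic_pos n)))
    fun z => monotone_truncPotential hν z h

theorem tendsto_truncEnergy (hμ : CompactlyCarried μ) (hν : CompactlyCarried ν) :
    Tendsto (fun n => (truncEnergy (dyadic n) μ ν : EReal)) atTop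
      (𝓝 (eintegral μ (potential ν))) :=
  tendsto_eintegral_of_monotone
    (fun n => hμ.integrable (continuous_truncPotential hν (dyadic_pos n)))
    (fun z => monotone_truncPotential hν z) fun z => tendsto_truncPotential hν z

/-- If the truncated mutual energies are bounded, the potential of `ν` is `μ`-integrable. -/
theorem potential_integrable (hμ : CompactlyCarried μ) (hν : CompactlyCarried ν) {C : ℝ}
    (hC : ∀ n, truncEnergy (dyadic n) μ ν ≤ C) :
    (∀ᵐ x ∂μ, potential ν x = ((potential ν x).toReal : EReal)) ∧
      Integrable (fun x => (potential ν x).toReal) μ ∧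
      Tendsto (fun n => truncEnergy (dyadic n) μ ν) atTop
        (𝓝 (∫ x, (potential ν x).toReal ∂μ)) :=
  monotone_limit_integrable
    (fun n => hμ.integrable (continuous_truncPotential hν (dyadic_pos n)))
    (fun z => monotone_truncPotential hν z) (fun z => tendsto_truncPotential hν z) hC

end TruncPotential

/-! ### Circle measures and measures with continuous potential -/

open Real in
/-- The uniform probability measure on the circle of center `z` and radius `r`. -/
def circleMeasure (z : ℂ) (r : ℝ) : Measure ℂ :=
  (ENNReal.ofReal (2 * π)⁻¹ • volume.restrict (Set.Ioc 0 (2 * π))).map (circleMap z r)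

open Real in
theorem integral_circleMeasure {f : ℂ → ℝ} (hf : Measurable f) (z : ℂ) (r : ℝ) :
    ∫ w, f w ∂(circleMeasure z r) = circleAverage f z r := by
  rw [circleMeasure, integral_map (continuous_circleMap z r).aemeasurable
    hf.aestronglyMeasurable, integral_smul_measure, circleAverage,
    intervalIntegral.integral_of_le (by positivity), ENNReal.toReal_ofReal (by positivity)]

open Real in
theorem isProbOn_circleMeasure (z : ℂ) {r : ℝ} (hr : 0 < r) :
    IsProbOn (Metric.sphere z r) (circleMeasure z r) := by
  refine ⟨⟨?_⟩, ?_⟩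
  · rw [circleMeasure, Measure.map_apply (continuous_circleMap z r).measurable MeasurableSet.univ]
    simp only [Set.preimage_univ, Measure.smul_apply, Measure.restrict_apply_univ, volume_Ioc,
      sub_zero, smul_eq_mul]
    rw [← ENNReal.ofReal_mul (by positivity), inv_mul_cancel₀ (by positivity), ENNReal.ofReal_one]
  · rw [circleMeasure, Measure.map_apply (continuous_circleMap z r).measurable
      Metric.isClosed_sphere.measurableSet.compl]
    convert measure_empty
    · ext θ
      simp [circleMap, abs_of_pos hr]
    · infer_instance

theorem compactlyCarried_circleMeasure (z : ℂ) {r : ℝ} (hr : 0 < r) :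
    CompactlyCarried (circleMeasure z r) :=
  (isProbOn_circleMeasure z hr).compactlyCarried (isCompact_sphere z r)

theorem ae_ne_circleMeasure (z x : ℂ) {r : ℝ} (hr : 0 < r) :
    ∀ᵐ w ∂(circleMeasure z r), w ≠ x := by
  have h : circleMeasure z r {x} = 0 := by
    rw [circleMeasure, Measure.map_apply (continuous_circleMap z r).measurable
      (measurableSet_singleton x)]
    have hc := (Set.countable_singleton x).preimage_circleMap z hr.ne'
    simp [hc.measure_zero]
  rw [ae_iff]
  simpa using h

open Real in
theorem integrable_log_circleMeasure (z x : ℂ) (r : ℝ) :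
    Integrable (fun w => -log ‖w - x‖) (circleMeasure z r) := by
  have hm : Measurable fun w : ℂ => -log ‖w - x‖ := by fun_prop
  rw [circleMeasure, integrable_map_measure hm.aestronglyMeasurable
    (continuous_circleMap z r).aemeasurable]
  refine Integrable.smul_measure ?_ ENNReal.ofReal_ne_top
  have := (circleIntegrable_log_norm_sub_const (a := x) (c := z) r).neg
  rw [CircleIntegrable, intervalIntegrable_iff_integrableOn_Ioc_of_le (by positivity)] at this
  exact this

open Real in
theorem integral_log_circleMeasure (z x : ℂ) {r : ℝ} (hr : 0 < r) :
    ∫ w, -log ‖w - x‖ ∂(circleMeasure z r) = truncKernel r z x := by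
  have hm : Measurable fun w : ℂ => log ‖w - x‖ := by fun_prop
  rw [integral_neg, integral_circleMeasure hm,
    circleAverage_log_norm_sub_const_eq_log_radius_add_posLog hr.ne', truncKernel]
  congr 1
  rcases le_total ‖z - x‖ r with h | h
  · rw [max_eq_right h, posLog_eq_zero_iff _ |>.2, add_zero]
    rw [abs_of_nonneg (by positivity), inv_mul_le_iff₀ hr]
    simpa using h
  · rw [max_eq_left h, posLog_eq_log, ← log_mul hr.ne', mul_inv_cancel_left₀ hr.ne']
    · have := hr.trans_le h
      positivity
    · rw [abs_of_nonneg (by positivity), le_inv_mul_iff₀ hr]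
      simpa using h

/-- A finite measure has a continuous potential `h`. -/
structure HasContPotential (ν : Measure ℂ) (h : ℂ → ℝ) : Prop where
  carried : CompactlyCarried ν
  continuous : Continuous h
  tendsto : ∀ x, Tendsto (fun n => truncPotential ν (dyadic n) x) atTop (𝓝 (h x))

/-- The logarithm is singular at one point only, which is null for the circle measure, so the
potential is a limit of truncated ones and equals the circle mean of the kernel. -/
theorem hasContPotential_circleMeasure (z : ℂ) {r : ℝ} (hr : 0 < r) :
    HasContPotential (circleMeasure z r) (truncKernel r z) := by
  have hσ := compactlyCarried_circleMeasure z hr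
  refine ⟨hσ, continuous_truncKernel_right hr z, fun x => ?_⟩
  rw [← integral_log_circleMeasure z x hr]
  refine integral_tendsto_of_tendsto_of_monotone
    (fun n => integrable_truncKernel hσ (dyadic_pos n) x) (integrable_log_circleMeasure z x r)
    (ae_of_all _ fun w => monotone_truncKernel x w) ?_
  filter_upwards [ae_ne_circleMeasure z x hr] with w hw
  rw [norm_sub_rev]
  exact tendsto_truncKernel_of_ne hw.symm

namespace HasContPotential

variable {μ ν : Measure ℂ} {h : ℂ → ℝ}

theorem truncPotential_le (hν : HasContPotential ν h) (n : ℕ) (x : ℂ) :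
    truncPotential ν (dyadic n) x ≤ h x :=
  (monotone_truncPotential hν.carried x).ge_of_tendsto (hν.tendsto x) n

theorem potential_eq (hν : HasContPotential ν h) (x : ℂ) : potential ν x = (h x : EReal) :=
  tendsto_nhds_unique (tendsto_truncPotential hν.carried x)
    ((continuous_coe_real_ereal.tendsto _).comp (hν.tendsto x))

theorem truncEnergy_le (hν : HasContPotential ν h) (hμ : CompactlyCarried μ) (n : ℕ) :
    truncEnergy (dyadic n) μ ν ≤ ∫ x, h x ∂μ :=
  integral_mono (hμ.integrable (continuous_truncPotential hν.carried (dyadic_pos n)))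
    (hμ.integrable hν.continuous) fun x => hν.truncPotential_le n x

theorem tendsto_truncEnergy (hν : HasContPotential ν h) (hμ : CompactlyCarried μ) :
    Tendsto (fun n => truncEnergy (dyadic n) μ ν) atTop (𝓝 (∫ x, h x ∂μ)) :=
  integral_tendsto_of_tendsto_of_monotone
    (fun n => hμ.integrable (continuous_truncPotential hν.carried (dyadic_pos n)))
    (hμ.integrable hν.continuous)
    (ae_of_all _ fun x => monotone_truncPotential hν.carried x)
    (ae_of_all _ fun x => hν.tendsto x)

/-- The potential of `μ` is integrable for measures with continuous potential. -/
theorem potential_integrable (hν : HasContPotential ν h) (hμ : CompactlyCarried μ) :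
    (∀ᵐ x ∂ν, potential μ x = ((potential μ x).toReal : EReal)) ∧
      Integrable (fun x => (potential μ x).toReal) ν ∧
      ∫ x, (potential μ x).toReal ∂ν = ∫ x, h x ∂μ := by
  -- Symmetry at each truncation level, followed by monotone convergence, replaces Fubini for the
  -- singular kernel.
  have hc : ∀ n, truncEnergy (dyadic n) ν μ = truncEnergy (dyadic n) μ ν := fun n =>
    truncEnergy_comm hν.carried hμ (dyadic_pos n)
  obtain ⟨h1, h2, h3⟩ := LogPotential.potential_integrable hν.carried hμ
    (C := ∫ x, h x ∂μ) fun n => (hc n).trans_le (hν.truncEnergy_le hμ n)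
  refine ⟨h1, h2, tendsto_nhds_unique h3 ?_⟩
  simpa only [hc] using hν.tendsto_truncEnergy hμ

end HasContPotential

/-! ### Potentials and the Lelong class -/

section Lelong

variable {μ : Measure ℂ}

theorem potential_integrable_circleMeasure (hμ : CompactlyCarried μ) (z : ℂ) {r : ℝ}
    (hr : 0 < r) :
    (∀ᵐ x ∂(circleMeasure z r), potential μ x = ((potential μ x).toReal : EReal)) ∧
      Integrable (fun x => (potential μ x).toReal) (circleMeasure z r) ∧
      ∫ x, (potential μ x).toReal ∂(circleMeasure z r) = truncPotential μ r z :=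
  (hasContPotential_circleMeasure z hr).potential_integrable hμ

theorem truncPotential_le_potential_of_pos (hμ : CompactlyCarried μ) {r : ℝ} (hr : 0 < r) (z : ℂ) :
    (truncPotential μ r z : EReal) ≤ potential μ z := by
  obtain ⟨n, hn⟩ := (tendsto_dyadic.eventually (gt_mem_nhds hr)).exists
  exact (EReal.coe_le_coe_iff.2 (truncPotential_anti hμ (dyadic_pos n) hn.le z)).trans
    (truncPotential_le_potential hμ n z)

theorem const_sub_potential_eq_iInf (hμ : CompactlyCarried μ) (F : ℝ) (z : ℂ) :
    (F : EReal) - potential μ z = ⨅ n, ((F - truncPotential μ (dyadic n) z : ℝ) : EReal) :=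
  tendsto_nhds_unique (tendsto_const_sub_coe (tendsto_truncPotential hμ z) F)
    (tendsto_atTop_iInf fun _ _ h => EReal.coe_le_coe_iff.2
      (sub_le_sub_left (monotone_truncPotential hμ z h) _))

theorem upperSemicontinuous_const_sub_potential (hμ : CompactlyCarried μ) (F : ℝ) :
    UpperSemicontinuous fun z => (F : EReal) - potential μ z := by
  simp only [const_sub_potential_eq_iInf hμ]
  refine upperSemicontinuous_iInf fun n => Continuous.upperSemicontinuous ?_
  exact continuous_coe_real_ereal.comp
    (continuous_const.sub (continuous_truncPotential hμ (dyadic_pos n)))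

theorem lowerSemicontinuous_potential (hμ : CompactlyCarried μ) :
    LowerSemicontinuous (potential μ) := by
  have h : potential μ = fun z => ⨆ n, (truncPotential μ (dyadic n) z : EReal) := by
    ext z
    exact tendsto_nhds_unique (tendsto_truncPotential hμ z)
      (tendsto_atTop_iSup fun _ _ h => EReal.coe_le_coe_iff.2 (monotone_truncPotential hμ z h))
  rw [h]
  refine lowerSemicontinuous_iSup fun n => Continuous.lowerSemicontinuous ?_
  exact continuous_coe_real_ereal.comp (continuous_truncPotential hμ (dyadic_pos n))

theorem measurable_potential (hμ : CompactlyCarried μ) : Measurable (potential μ) :=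
  (lowerSemicontinuous_potential hμ).measurable

theorem const_sub_potential_le (hμ : CompactlyCarried μ) (F : ℝ) {r : ℝ} (hr : 0 < r) (z : ℂ) :
    (F : EReal) - potential μ z ≤ ((F - truncPotential μ r z : ℝ) : EReal) := by
  rw [EReal.coe_sub]
  exact EReal.sub_le_sub le_rfl (truncPotential_le_potential_of_pos hμ hr z)

-- The circle integral is a limit of truncated mutual energies of `μ` and the circle measure. By
-- symmetry these converge to the integral over `μ` of the potential of the circle, that is, to the
-- truncated potential of radius `r`.
open Real in
theorem eintegral_circleMap_const_sub_potential (hμ : CompactlyCarried μ) (F : ℝ) (z : ℂ) {r : ℝ}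
    (hr : 0 < r) :
    eintegral (volume.restrict (Set.Ioc 0 (2 * π)))
      (fun θ => (F : EReal) - potential μ (circleMap z r θ)) =
      ((2 * π * (F - truncPotential μ r z) : ℝ) : EReal) := by
  have hσ := compactlyCarried_circleMeasure z hr
  set f : ℕ → ℝ → ℝ := fun n θ => truncPotential μ (dyadic n) (circleMap z r θ) - F with hf
  have hcont : ∀ n, Continuous (f n) := fun n =>
    ((continuous_truncPotential hμ (dyadic_pos n)).comp (continuous_circleMap z r)).sub
      continuous_const
  have hint : ∀ n, Integrable (f n) (volume.restrict (Set.Ioc 0 (2 * π))) := fun n =>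
    (hcont n).integrableOn_Ioc
  have hlim : ∀ θ, Tendsto (fun n => (f n θ : EReal)) atTop
      (𝓝 (potential μ (circleMap z r θ) - F)) := fun θ =>
    tendsto_coe_sub_const (tendsto_truncPotential hμ _) F
  have hmono : ∀ θ, Monotone fun n => f n θ := fun θ m n h =>
    sub_le_sub_right (monotone_truncPotential hμ _ h) _
  have h1 : eintegral (volume.restrict (Set.Ioc 0 (2 * π)))
      (fun θ => (F : EReal) - potential μ (circleMap z r θ)) =
      -eintegral (volume.restrict (Set.Ioc 0 (2 * π)))
        (fun θ => potential μ (circleMap z r θ) - F) := by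
    rw [← eintegral_neg_of_bddBelow hint fun θ => ge_of_tendsto' (hlim θ) fun n =>
      EReal.coe_le_coe_iff.2 (hmono θ (Nat.zero_le n))]
    congr 1
    ext θ
    rw [EReal.neg_sub (Or.inr (EReal.coe_ne_bot _)) (Or.inr (EReal.coe_ne_top _)), add_comm,
      ← sub_eq_add_neg]
  have h2 := tendsto_eintegral_of_monotone hint hmono hlim
  have h3 : ∀ n, ∫ θ, f n θ ∂(volume.restrict (Set.Ioc 0 (2 * π))) =
      2 * π * (truncEnergy (dyadic n) (circleMeasure z r) μ - F) := fun n => by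
    rw [truncEnergy, integral_circleMeasure (continuous_truncPotential hμ (dyadic_pos n)).measurable,
      circleAverage, intervalIntegral.integral_of_le (by positivity), hf]
    dsimp only
    rw [integral_sub]
    · simp only [integral_const, smul_eq_mul, MeasurableSet.univ, measureReal_restrict_apply,
        Set.univ_inter, volume_real_Ioc, sub_zero]
      rw [max_eq_left (by positivity)]
      field_simp
    · exact ((continuous_truncPotential hμ (dyadic_pos n)).comp
        (continuous_circleMap z r)).integrableOn_Ioc
    · exact integrable_const _
  have h4 : Tendsto (fun n => truncEnergy (dyadic n) (circleMeasure z r) μ) atTop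
      (𝓝 (truncPotential μ r z)) := by
    simp only [truncEnergy_comm hσ hμ (dyadic_pos _)]
    exact (hasContPotential_circleMeasure z hr).tendsto_truncEnergy hμ
  have h5 := tendsto_nhds_unique h2 ((continuous_coe_real_ereal.tendsto _).comp
    (by simpa only [h3] using (h4.sub_const F).const_mul (2 * π)))
  rw [h1, h5, ← EReal.coe_neg]
  congr 1
  ring

-- Since the circle mean is computed by truncation, the submean inequality only says that truncation
-- lowers the potential. A point with finite value exists because the potential is integrable on the
-- unit circle.
open Real in
theorem isSubharmonic_const_sub_potential (hμ : CompactlyCarried μ) (F : ℝ) :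
    IsSubharmonic fun z => (F : EReal) - potential μ z where
  usc := upperSemicontinuous_const_sub_potential hμ F
  lt_top z := (const_sub_potential_le hμ F one_pos z).trans_lt (EReal.coe_lt_top _)
  ne_bot := by
    have := (isProbOn_circleMeasure 0 one_pos).isProb
    obtain ⟨x, hx⟩ := (potential_integrable_circleMeasure hμ 0 one_pos).1.exists
    refine ⟨x, ?_⟩
    rw [hx, ← EReal.coe_sub]
    exact EReal.coe_ne_bot _
  le_mean z r hr := by
    rw [eintegral_circleMap_const_sub_potential hμ F z hr, ← EReal.coe_mul,
      inv_mul_cancel_left₀ (by positivity)]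
    exact const_sub_potential_le hμ F hr z

theorem isLelong_const_sub_potential {K : Set ℂ} (hK : IsCompact K) (hμ : IsProbOn K μ) (F : ℝ) :
    IsLelong fun z => (F : EReal) - potential μ z := by
  have hc := hμ.compactlyCarried hK
  have := hμ.isProb
  refine ⟨isSubharmonic_const_sub_potential hc F, ?_⟩
  obtain ⟨R, hR1, hR⟩ := hc.exists_ball
  -- For `‖z‖ ≥ R` the measure is carried by points at distance at most `2 * ‖z‖` from `z`.
  refine ⟨F + Real.log 2, ?_⟩
  have hev : ∀ᶠ z in cocompact ℂ, R ≤ ‖z‖ := (tendsto_norm_cocompact_atTop).eventually_ge_atTop R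
  filter_upwards [hev] with z hz
  refine (const_sub_potential_le hc F one_pos z).trans (EReal.coe_le_coe_iff.2 ?_)
  have h1 : -Real.log (2 * ‖z‖) ≤ truncPotential μ 1 z := by
    have : ∫ _, -Real.log (2 * ‖z‖) ∂μ = -Real.log (2 * ‖z‖) := by simp
    rw [← this]
    refine integral_mono_ae (integrable_const _) (integrable_truncKernel hc one_pos z) ?_
    filter_upwards [hR] with w hw
    refine truncKernel_ge one_pos ?_ (by linarith)
    refine (norm_sub_le z w).trans ?_
    have : ‖w‖ ≤ R := by simpa using hw
    linarith
  rw [Real.log_mul two_ne_zero (by linarith)] at h1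
  linarith

open Real in
theorem isLelong_const (c : ℝ) : IsLelong fun _ => (c : EReal) where
  subharmonic :=
    { usc := upperSemicontinuous_const
      lt_top := fun _ => EReal.coe_lt_top c
      ne_bot := ⟨0, EReal.coe_ne_bot c⟩
      le_mean := fun z r hr => by
        rw [eintegral_coe (integrable_const c), ← EReal.coe_mul]
        refine EReal.coe_le_coe_iff.2 (le_of_eq ?_)
        simp only [integral_const, smul_eq_mul, MeasurableSet.univ, measureReal_restrict_apply,
          Set.univ_inter, volume_real_Ioc, sub_zero]
        rw [max_eq_left (by positivity), inv_mul_cancel_left₀ (by positivity)] }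
  growth := by
    refine ⟨c, ?_⟩
    filter_upwards [(tendsto_norm_cocompact_atTop (E := ℂ)).eventually_ge_atTop 1] with z hz
    exact EReal.coe_le_coe_iff.2 (by linarith [log_nonneg hz])

/-- The properties of the functions of the Lelong class which are used in the domination
principle. -/
structure IsSubLelong (u : ℂ → EReal) : Prop where
  usc : UpperSemicontinuous u
  lt_top : ∀ z, u z < ⊤
  growth : ∃ C : ℝ, ∀ᶠ z in cocompact ℂ, u z ≤ ((Real.log ‖z‖ + C : ℝ) : EReal)
  le_circleAverage : ∀ (z : ℂ) (r : ℝ) (h : ℂ → ℝ), 0 < r → Continuous h →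
    (∀ x ∈ Metric.sphere z r, u x ≤ (h x : EReal)) → u z ≤ ((Real.circleAverage h z r : ℝ) : EReal)

open Real in
theorem IsLelong.isSubLelong {u : ℂ → EReal} (hu : IsLelong u) : IsSubLelong u := by
  refine ⟨hu.subharmonic.usc, hu.subharmonic.lt_top, hu.growth, fun z r h hr hh hle => ?_⟩
  refine (hu.subharmonic.le_mean z r hr).trans ?_
  have hint : Integrable (fun θ => h (circleMap z r θ))
      (volume.restrict (Set.Ioc 0 (2 * π))) :=
    (hh.comp (continuous_circleMap z r)).integrableOn_Ioc
  have h1 := eintegral_mono (ν := volume.restrict (Set.Ioc 0 (2 * π)))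
    (f := fun θ => u (circleMap z r θ)) (g := fun θ => (h (circleMap z r θ) : EReal))
    fun θ => hle _ (circleMap_mem_sphere z hr.le θ)
  rw [eintegral_coe hint] at h1
  refine (mul_le_mul_of_nonneg_left h1 (EReal.coe_nonneg.2 (by positivity))).trans ?_
  rw [← EReal.coe_mul, circleAverage, intervalIntegral.integral_of_le (by positivity), smul_eq_mul]

-- A decreasing limit might be identically -∞ a priori, which is why `IsSubLelong` does not exclude
-- it. Testing submeans against continuous majorants on circles survives the limit by Dini's
-- argument: the increasing open sets `u n < h + ε` cover the compact circle, so a single `n`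
-- suffices.
open Real in
theorem IsSubLelong.iInf {u : ℕ → ℂ → EReal} (hu : ∀ n, IsSubLelong (u n))
    (hanti : Antitone u) : IsSubLelong fun z => ⨅ n, u n z := by
  refine ⟨upperSemicontinuous_iInf fun n => (hu n).usc,
    fun z => (iInf_le _ 0).trans_lt ((hu 0).lt_top z), ?_, fun z r h hr hh hle => ?_⟩
  · obtain ⟨C, hC⟩ := (hu 0).growth
    exact ⟨C, hC.mono fun z hz => (iInf_le _ 0).trans hz⟩
  · refine EReal.le_of_forall_lt_iff_le.1 fun c hc => ?_
    have hc' : circleAverage h z r < c := EReal.coe_lt_coe_iff.1 hc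
    set ε := c - circleAverage h z r with hε
    have hε0 : 0 < ε := sub_pos.2 hc'
    obtain ⟨n, hn⟩ : ∃ n, ∀ x ∈ Metric.sphere z r, u n x ≤ ((h x + ε : ℝ) : EReal) := by
      have hopen : ∀ n, IsOpen {x | u n x < ((h x + ε : ℝ) : EReal)} := fun n => by
        rw [isOpen_iff_mem_nhds]
        intro x hx
        obtain ⟨c, hc1, hc2⟩ := EReal.lt_iff_exists_real_btwn.1 hx
        have hcont : ContinuousAt (fun y => h y + ε) x := by fun_prop
        filter_upwards [(hu n).usc x _ hc1,
          hcont.eventually (lt_mem_nhds (EReal.coe_lt_coe_iff.1 hc2))] with y hy1 hy2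
        exact hy1.trans (EReal.coe_lt_coe_iff.2 hy2)
      have hcover : Metric.sphere z r ⊆ ⋃ n, {x | u n x < ((h x + ε : ℝ) : EReal)} := fun x hx => by
        have h1 : (⨅ n, u n x) < ((h x + ε : ℝ) : EReal) :=
          (hle x hx).trans_lt (EReal.coe_lt_coe_iff.2 (by linarith))
        obtain ⟨n, hn⟩ := iInf_lt_iff.1 h1
        exact Set.mem_iUnion.2 ⟨n, hn⟩
      obtain ⟨n, hn⟩ := (isCompact_sphere z r).elim_directed_cover _ hopen hcover
        (directed_of_isDirected_le fun m n hmn x hx => (hanti hmn x).trans_lt hx)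
      exact ⟨n, fun x hx => (hn hx).le⟩
    refine (iInf_le _ n).trans (((hu n).le_circleAverage z r _ hr (hh.add continuous_const) hn).trans
      (EReal.coe_le_coe_iff.2 (le_of_eq ?_)))
    rw [circleAverage_add (hh.continuousOn.circleIntegrable hr.le)
      (circleIntegrable_const _ z r), circleAverage_const]
    ring

end Lelong

/-! ### Restrictions with continuous potential -/

/-- The increment of the kernel between two truncation radii decreases with the distance. Doubling
all lengths at `x` leaves the increment unchanged and shifts the dyadic index by one, which absorbs
the factor 2. -/
theorem truncKernel_sub_le_of_norm_le {x x' w : ℂ} (h : ‖x' - w‖ ≤ 2 * ‖x - w‖) {m n : ℕ}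
    (hnm : n ≤ m) :
    truncKernel (dyadic (m + 1)) x w - truncKernel (dyadic (n + 1)) x w ≤
      truncKernel (dyadic m) x' w - truncKernel (dyadic n) x' w := by
  have key : ∀ k, truncKernel (dyadic (k + 1)) x w =
      Real.log 2 - Real.log (max (2 * ‖x - w‖) (dyadic k)) := fun k => by
    rw [truncKernel, ← dyadic_succ k, ← mul_max_of_nonneg _ _ zero_le_two,
      Real.log_mul two_ne_zero (lt_max_of_lt_right (dyadic_pos (k + 1))).ne']
    ring
  rw [key, key, truncKernel, truncKernel]
  set c := 2 * ‖x - w‖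
  set b := ‖x' - w‖
  have hm := dyadic_pos m
  have hn := dyadic_pos n
  have hd := dyadic_anti hnm
  have h1 : max c (dyadic n) * max b (dyadic m) ≤ max b (dyadic n) * max c (dyadic m) := by
    rcases le_total c (dyadic n) with hc | hc
    · rw [max_eq_right hc, max_eq_right (h.trans hc)]
      exact mul_le_mul_of_nonneg_left (max_le_max h le_rfl) hn.le
    · rw [max_eq_left hc, max_eq_left (hd.trans hc), mul_comm]
      exact mul_le_mul_of_nonneg_right (max_le_max le_rfl hd) (hn.le.trans hc)
  have h2 := Real.log_le_log (mul_pos (lt_max_of_lt_right hn) (lt_max_of_lt_right hm)) h1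
  rw [Real.log_mul (lt_max_of_lt_right hn).ne' (lt_max_of_lt_right hm).ne',
    Real.log_mul (lt_max_of_lt_right hn).ne' (lt_max_of_lt_right hm).ne'] at h2
  linarith

theorem truncPotential_sub_eq {μ : Measure ℂ} (hμ : CompactlyCarried μ) (m n : ℕ) (x : ℂ) :
    truncPotential μ (dyadic m) x - truncPotential μ (dyadic n) x =
      ∫ w, (truncKernel (dyadic m) x w - truncKernel (dyadic n) x w) ∂μ :=
  (integral_sub (integrable_truncKernel hμ (dyadic_pos m) x)
    (integrable_truncKernel hμ (dyadic_pos n) x)).symm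

/-- Increments of the kernel are nonnegative, unlike the kernel itself, so they are monotone in the
measure. -/
theorem truncPotential_sub_mono {μ ν : Measure ℂ} (hμ : CompactlyCarried μ) (hle : ν ≤ μ) {m n : ℕ}
    (hnm : n ≤ m) (x : ℂ) :
    truncPotential ν (dyadic m) x - truncPotential ν (dyadic n) x ≤
      truncPotential μ (dyadic m) x - truncPotential μ (dyadic n) x := by
  rw [truncPotential_sub_eq hμ, truncPotential_sub_eq (hμ.of_le hle)]
  refine integral_mono_measure hle
    (ae_of_all _ fun w => sub_nonneg.2 (monotone_truncKernel x w hnm)) ?_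
  exact (integrable_truncKernel hμ (dyadic_pos m) x).sub
    (integrable_truncKernel hμ (dyadic_pos n) x)

/-- The continuity principle: uniform convergence of the truncations on a carrier spreads to the
whole plane, by comparing each point with a nearest point of the carrier. -/
theorem exists_hasContPotential_of_uniform {ν : Measure ℂ} (hν : CompactlyCarried ν) {C : Set ℂ}
    (hC : IsCompact C) (hνC : ν Cᶜ = 0)
    (hunif : ∀ ε > 0, ∃ N, ∀ n ≥ N, ∀ m ≥ n, ∀ x ∈ C,
      truncPotential ν (dyadic m) x - truncPotential ν (dyadic n) x < ε) :
    ∃ h, HasContPotential ν h := by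
  have hunif' : ∀ ε > 0, ∃ N, ∀ n ≥ N, ∀ m ≥ n, ∀ x,
      truncPotential ν (dyadic m) x - truncPotential ν (dyadic n) x < ε := by
    intro ε hε
    rcases C.eq_empty_or_nonempty with hE | hne
    · have : ν = 0 := by simpa [hE] using hνC
      exact ⟨0, fun n _ m _ x => by simpa [this, truncPotential] using hε⟩
    · obtain ⟨N, hN⟩ := hunif ε hε
      refine ⟨N + 1, fun n hn m hm x => ?_⟩
      obtain ⟨n, rfl⟩ : ∃ n', n = n' + 1 := ⟨n - 1, by omega⟩
      obtain ⟨m, rfl⟩ : ∃ m', m = m' + 1 := ⟨m - 1, by omega⟩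
      obtain ⟨x', hx', hdist⟩ := hC.exists_infDist_eq_dist hne x
      refine lt_of_le_of_lt ?_ (hN n (by omega) m (by omega) x' hx')
      rw [truncPotential_sub_eq hν, truncPotential_sub_eq hν]
      refine integral_mono_ae ((integrable_truncKernel hν (dyadic_pos _) x).sub
        (integrable_truncKernel hν (dyadic_pos _) x))
        ((integrable_truncKernel hν (dyadic_pos _) x').sub
        (integrable_truncKernel hν (dyadic_pos _) x')) ?_
      have hae : ∀ᵐ w ∂ν, w ∈ C := hνC
      filter_upwards [hae] with w hw
      refine truncKernel_sub_le_of_norm_le ?_ (by omega)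
      -- As `x'` is nearest to `x` in `C`, the triangle inequality bounds the distance from `x'` to
      -- `w` by twice that from `x` to `w`.
      have h1 : dist x x' ≤ dist x w := hdist ▸ Metric.infDist_le_dist_of_mem hw
      have h2 := dist_triangle_left x' w x
      rw [← dist_eq_norm, ← dist_eq_norm]
      linarith
  have habs : ∀ ε > 0, ∃ N, ∀ m ≥ N, ∀ n ≥ N, ∀ x,
      dist (truncPotential ν (dyadic m) x) (truncPotential ν (dyadic n) x) < ε := by
    intro ε hε
    obtain ⟨N, hN⟩ := hunif' ε hε
    refine ⟨N, fun m hm n hn x => ?_⟩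
    rw [Real.dist_eq]
    rcases le_total n m with h | h
    · rw [abs_of_nonneg (sub_nonneg.2 (monotone_truncPotential hν x h))]
      exact hN n hn m h x
    · rw [abs_sub_comm, abs_of_nonneg (sub_nonneg.2 (monotone_truncPotential hν x h))]
      exact hN m hm n h x
  have hlim : ∀ x, ∃ y, Tendsto (fun n => truncPotential ν (dyadic n) x) atTop (𝓝 y) := fun x =>
    cauchySeq_tendsto_of_complete (Metric.cauchySeq_iff.2 fun ε hε =>
      (habs ε hε).imp fun N hN m hm n hn => hN m hm n hn x)
  choose h hh using hlim
  refine ⟨h, hν, ?_, hh⟩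
  have hu : TendstoUniformly (fun n x => truncPotential ν (dyadic n) x) h atTop := by
    rw [← tendstoUniformlyOn_univ]
    refine UniformCauchySeqOn.tendstoUniformlyOn_of_tendsto ?_ fun x _ => hh x
    exact Metric.uniformCauchySeqOn_iff.2 fun ε hε =>
      (habs ε hε).imp fun N hN m hm n hn x _ => hN m hm n hn x
  exact hu.continuous (Frequently.of_forall fun n => continuous_truncPotential hν (dyadic_pos n))

/-- A measure with almost everywhere finite potential has large restrictions with continuous
potential. -/
theorem exists_hasContPotential_restrict {μ : Measure ℂ} (hμ : CompactlyCarried μ)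
    (hfin : ∀ᵐ x ∂μ, potential μ x = ((potential μ x).toReal : EReal)) {G : Set ℂ}
    (hG : MeasurableSet G) {ε : ℝ} (hε : 0 < ε) :
    ∃ C ⊆ G, IsCompact C ∧ μ (G \ C) ≤ ENNReal.ofReal ε ∧
      ∃ h, HasContPotential (μ.restrict C) h := by
  have := hμ.finite
  have hae : ∀ᵐ x ∂μ, x ∈ G → Tendsto (fun n => truncPotential μ (dyadic n) x) atTop
      (𝓝 (potential μ x).toReal) := by
    filter_upwards [hfin] with x hx _
    have := tendsto_truncPotential hμ x
    rw [hx] at this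
    exact EReal.tendsto_coe.1 this
  -- Egorov's theorem loses mass `ε / 2`, and inner regularity by compact sets another `ε / 2`.
  obtain ⟨t, htG, htm, hμt, hunif⟩ := tendstoUniformlyOn_of_ae_tendsto
    (fun n => (continuous_truncPotential hμ (dyadic_pos n)).stronglyMeasurable)
    (measurable_potential hμ).ereal_toReal.stronglyMeasurable hG (measure_ne_top μ G) hae
    (half_pos hε)
  obtain ⟨C, hCsub, hC, hμC⟩ := (hG.diff htm).exists_isCompact_sdiff_lt (measure_ne_top μ _)
    (ENNReal.ofReal_pos.2 (half_pos hε)).ne'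
  refine ⟨C, hCsub.trans Set.sdiff_subset, hC, ?_, ?_⟩
  · have : G \ C ⊆ t ∪ ((G \ t) \ C) := fun x hx => by
      by_cases h : x ∈ t
      · exact Or.inl h
      · exact Or.inr ⟨⟨hx.1, h⟩, hx.2⟩
    refine (measure_mono this).trans ((measure_union_le _ _).trans
      ((add_le_add hμt hμC.le).trans (le_of_eq ?_)))
    rw [← ENNReal.ofReal_add (half_pos hε).le (half_pos hε).le, add_halves]
  · refine exists_hasContPotential_of_uniform (hμ.restrict C) hC (by simp [hC.measurableSet]) ?_
    intro δ hδ
    obtain ⟨N, hN⟩ := eventually_atTop.1 (Metric.tendstoUniformlyOn_iff.1 hunif (δ / 2) (half_pos hδ))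
    refine ⟨N, fun n hn m hm x hx => ?_⟩
    refine (truncPotential_sub_mono hμ Measure.restrict_le_self hm x).trans_lt ?_
    have h1 := hN n hn x (hCsub hx)
    have h2 := hN m (hn.trans hm) x (hCsub hx)
    rw [Real.dist_eq] at h1 h2
    have := abs_lt.1 h1
    have := abs_lt.1 h2
    linarith

/-! ### The maximum principle -/

/-- On the circle the squared norm agrees with an affine function, whose mean is its value at the
centre. The gain `r ^ 2` supplies the strictness in the maximum principle. -/
theorem circleAverage_norm_sq (z : ℂ) (r : ℝ) :
    Real.circleAverage (fun x => ‖x‖ ^ 2) z r = ‖z‖ ^ 2 + r ^ 2 := by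
  have h1 : Real.circleAverage (fun x : ℂ => inner ℝ z x) z r = inner ℝ z z := by
    have hd : Real.circleAverage (fun x : ℂ => x) z r = z :=
      DiffContOnCl.circleAverage (f := fun x => x) differentiable_id.diffContOnCl
    have := ContinuousLinearMap.circleAverage_comp_comm (f := fun x : ℂ => x) (c := z) (R := r)
      (innerSL ℝ z) (continuous_id.continuousOn.circleIntegrable' )
    rw [hd] at this
    simpa [Function.comp_def] using this
  have h2 : Real.circleAverage (fun x => ‖x‖ ^ 2) z r =
      Real.circleAverage (fun x : ℂ => 2 * inner ℝ z x + (r ^ 2 - ‖z‖ ^ 2)) z r := by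
    refine Real.circleAverage_congr_sphere fun x hx => ?_
    have hx' : ‖x - z‖ = |r| := by simpa using hx
    have := norm_sub_sq_real x z
    rw [hx', sq_abs, real_inner_comm] at this
    linarith
  rw [h2, Real.circleAverage_fun_add, Real.circleAverage_const]
  · have := Real.circleAverage_fun_smul (a := (2 : ℝ)) (f := fun x : ℂ => inner ℝ z x) (c := z) (R := r)
    simp only [smul_eq_mul] at this
    rw [this, h1, real_inner_self_eq_norm_sq]
    ring
  · exact (Continuous.continuousOn (by fun_prop)).circleIntegrable'
  · exact circleIntegrable_const _ _ _

/-- Harmonicity off the carrier: truncation at radii up to `r` does not change the kernel between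
`z` and `C`, and the truncated potential is the circle mean. -/
theorem HasContPotential.circleAverage_eq {ν : Measure ℂ} {h : ℂ → ℝ} (hν : HasContPotential ν h)
    {C : Set ℂ} (hνC : ν Cᶜ = 0) {z : ℂ} {r : ℝ} (hr : 0 < r)
    (hdisj : ∀ w ∈ C, r ≤ ‖z - w‖) : Real.circleAverage h z r = h z := by
  have h1 : Real.circleAverage h z r = truncPotential ν r z := by
    rw [← (potential_integrable_circleMeasure hν.carried z hr).2.2,
      ← integral_circleMeasure hν.continuous.measurable]
    simp [hν.potential_eq]
  have h2 : ∀ᶠ n in atTop, truncPotential ν (dyadic n) z = truncPotential ν r z := by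
    filter_upwards [tendsto_dyadic.eventually (gt_mem_nhds hr)] with n hn
    have hae : ∀ᵐ w ∂ν, w ∈ C := hνC
    refine integral_congr_ae (hae.mono fun w hw => ?_)
    rw [truncKernel_of_le (hdisj w hw), truncKernel_of_le (hn.le.trans (hdisj w hw))]
  rw [h1]
  exact tendsto_nhds_unique (tendsto_const_nhds.congr' (h2.mono fun _ h => h.symm)) (hν.tendsto z)

/-- The potential falls like the total mass times `-log ‖z‖`; a mass larger than `s` outweighs the
growth of `s * u` for `u` in the Lelong class. -/
theorem HasContPotential.le_of_norm_ge {ν : Measure ℂ} {h : ℂ → ℝ} (hν : HasContPotential ν h)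
    {R : ℝ} (hR1 : 1 ≤ R) (hR : ∀ᵐ x ∂ν, x ∈ Metric.closedBall (0 : ℂ) R) {z : ℂ}
    (hz : 2 * R ≤ ‖z‖) : h z ≤ ν.real Set.univ * (Real.log 2 - Real.log ‖z‖) := by
  have := hν.carried.finite
  refine le_of_tendsto' (hν.tendsto z) fun n => ?_
  have h1 : ∫ _, (Real.log 2 - Real.log ‖z‖) ∂ν = ν.real Set.univ * (Real.log 2 - Real.log ‖z‖) := by
    simp
  rw [← h1]
  refine integral_mono_ae (integrable_truncKernel hν.carried (dyadic_pos n) z) (integrable_const _) ?_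
  filter_upwards [hR] with w hw
  have hw' : ‖w‖ ≤ R := by simpa using hw
  have h2 : ‖z‖ / 2 ≤ ‖z - w‖ := by
    have := norm_sub_norm_le z w
    linarith
  rw [← neg_sub, ← Real.log_div (by linarith) two_ne_zero]
  exact neg_le_neg (Real.log_le_log (by linarith) (h2.trans (le_max_left _ _)))

/-- The function `s * u + h` is at most `M` on `C` and near infinity, where `s` being less than the
mass is used, and it is subharmonic off `C`. A small multiple of `‖x‖ ^ 2` makes it strictly
subharmonic, so a maximum over a large disc cannot sit inside the disc off `C`. -/
theorem IsSubLelong.maximum_principle {u : ℂ → EReal} (hu : IsSubLelong u) {ν : Measure ℂ}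
    {h : ℂ → ℝ} (hν : HasContPotential ν h) {C : Set ℂ} (hC : IsClosed C) (hνC : ν Cᶜ = 0)
    {s M : ℝ} (hs : 0 < s) (hsν : s < ν.real Set.univ)
    (hM : ∀ x ∈ C, u x ≤ (((M - h x) / s : ℝ) : EReal)) (z : ℂ) :
    u z ≤ (((M - h z) / s : ℝ) : EReal) := by
  by_contra! hcon
  obtain ⟨c, hc1, hc2⟩ := EReal.lt_iff_exists_real_btwn.1 hcon
  have hc1' : (M - h z) / s < c := EReal.coe_lt_coe_iff.1 hc1
  set m := s * c + h z with hm
  have hmM : M < m := by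
    rw [div_lt_iff₀ hs] at hc1'
    linarith
  obtain ⟨R₀, hR₀1, hR₀⟩ := hν.carried.exists_ball
  obtain ⟨A, hA⟩ := hu.growth
  -- the bound near infinity
  have hinf : ∀ᶠ x in cocompact ℂ, u x ≤ (((M - h x) / s : ℝ) : EReal) := by
    set t := ν.real Set.univ
    have hlog : Tendsto (fun x : ℂ => Real.log ‖x‖) (cocompact ℂ) atTop :=
      Real.tendsto_log_atTop.comp tendsto_norm_cocompact_atTop
    filter_upwards [hA, (tendsto_norm_cocompact_atTop (E := ℂ)).eventually_ge_atTop (2 * R₀),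
      hlog.eventually_ge_atTop ((s * A + t * Real.log 2 - M) / (t - s))] with x h1 h2 h3
    refine h1.trans (EReal.coe_le_coe_iff.2 ?_)
    have h4 := hν.le_of_norm_ge hR₀1 hR₀ h2
    rw [le_div_iff₀ hs]
    rw [div_le_iff₀ (sub_pos.2 hsν)] at h3
    nlinarith
  obtain ⟨R₁, hR₁⟩ : ∃ R : ℝ, ∀ x : ℂ, R ≤ ‖x‖ → u x ≤ (((M - h x) / s : ℝ) : EReal) := by
    obtain ⟨K, hK, hK'⟩ := hasBasis_cocompact.eventually_iff.1 hinf
    obtain ⟨R, hR⟩ := hK.isBounded.subset_ball 0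
    exact ⟨R, fun x hx => hK' fun hxK => absurd (hR hxK) (by simpa using hx)⟩
  set R := max R₁ (‖z‖ + 1) with hR
  have hRz : ‖z‖ < R := lt_max_of_lt_right (lt_add_one _)
  have hR0 : 0 ≤ R := (norm_nonneg z).trans hRz.le
  -- The perturbation stays below the gap `m - M` on the disc, so it cannot lift points of `C` or of
  -- the boundary above the level `m`.
  set η := (m - M) / (R ^ 2 + 1) with hη
  have hη0 : 0 < η := div_pos (sub_pos.2 hmM) (by positivity)
  have hηR : η * R ^ 2 < m - M := by
    rw [hη, div_mul_eq_mul_div, div_lt_iff₀ (by positivity)]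
    nlinarith
  set b : ℂ → ℝ := fun x => (h x + η * ‖x‖ ^ 2) / s with hb
  have hbcont : Continuous b := by
    have := hν.continuous
    fun_prop
  have husc : UpperSemicontinuousOn (fun x => u x + (b x : EReal)) (Metric.closedBall 0 R) := by
    refine UpperSemicontinuous.upperSemicontinuousOn ?_ _
    refine UpperSemicontinuous.add' hu.usc
      (continuous_coe_real_ereal.comp hbcont).upperSemicontinuous fun x => ?_
    exact EReal.continuousAt_add (Or.inr (EReal.coe_ne_bot _)) (Or.inr (EReal.coe_ne_top _))
  obtain ⟨z₀, hz₀, hmax⟩ := husc.exists_isMaxOn ⟨0, by simpa using hR0⟩ (isCompact_closedBall 0 R)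
  have hz₀R : ‖z₀‖ ≤ R := by simpa using hz₀
  have hbig : ((m / s : ℝ) : EReal) < u z₀ + (b z₀ : EReal) := by
    refine lt_of_lt_of_le ?_ (hmax (show z ∈ Metric.closedBall 0 R by simpa using hRz.le))
    refine lt_of_le_of_lt ?_ (EReal.add_lt_add_of_lt_of_le hc2 le_rfl (EReal.coe_ne_bot (b z)) (EReal.coe_ne_top (b z)))
    rw [← EReal.coe_add, EReal.coe_le_coe_iff, hb, div_le_iff₀ hs]
    field_simp
    nlinarith [mul_nonneg hη0.le (sq_nonneg ‖z‖)]
  have hsmall : ∀ x : ℂ, ‖x‖ ≤ R → u x ≤ (((M - h x) / s : ℝ) : EReal) →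
      u x + (b x : EReal) ≤ ((m / s : ℝ) : EReal) := by
    intro x hx hux
    refine (add_le_add_left hux _).trans ?_
    rw [← EReal.coe_add, EReal.coe_le_coe_iff, hb, ← add_div]
    refine div_le_div_of_nonneg_right ?_ hs.le
    have : η * ‖x‖ ^ 2 ≤ η * R ^ 2 := by gcongr
    linarith
  have hz₀C : z₀ ∉ C := fun hz => absurd (hsmall z₀ hz₀R (hM z₀ hz)) hbig.not_ge
  have hz₀R' : ‖z₀‖ < R := by
    refine lt_of_le_of_ne hz₀R fun heq => absurd (hsmall z₀ hz₀R (hR₁ z₀ ?_)) hbig.not_ge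
    rw [heq]
    exact le_max_left _ _
  obtain ⟨r, hr, hball⟩ : ∃ r > 0, Metric.closedBall z₀ r ⊆ Metric.ball 0 R ∩ Cᶜ :=
    Metric.nhds_basis_closedBall.mem_iff.1 ((Metric.isOpen_ball.inter hC.isOpen_compl).mem_nhds
      ⟨by simpa using hz₀R', hz₀C⟩)
  have hu₀ : u z₀ = ((u z₀).toReal : EReal) := by
    refine (EReal.coe_toReal (hu.lt_top z₀).ne fun hbot => ?_).symm
    rw [hbot, EReal.bot_add] at hbig
    exact absurd hbig not_lt_bot
  set T := (u z₀).toReal + b z₀ with hT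
  have hcirc := hu.le_circleAverage z₀ r (fun x => T - b x) hr (continuous_const.sub hbcont)
    fun x hx => by
      have hxR : x ∈ Metric.closedBall (0 : ℂ) R :=
        Metric.ball_subset_closedBall (hball (Metric.sphere_subset_closedBall hx)).1
      have h1 : u x + (b x : EReal) ≤ u z₀ + (b z₀ : EReal) := hmax hxR
      rw [hu₀, ← EReal.coe_add] at h1
      rw [EReal.coe_sub]
      exact (EReal.le_sub_iff_add_le (Or.inl (EReal.coe_ne_bot _)) (Or.inl (EReal.coe_ne_top _))).2 h1
  have havg : Real.circleAverage (fun x => T - b x) z₀ r = T - (h z₀ + η * (‖z₀‖ ^ 2 + r ^ 2)) / s := by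
    have hci : ∀ {f : ℂ → ℝ}, Continuous f → CircleIntegrable f z₀ r := fun hf =>
      hf.continuousOn.circleIntegrable'
    have e1 : Real.circleAverage (fun x => T - b x) z₀ r = T - Real.circleAverage b z₀ r := by
      rw [Real.circleAverage_fun_sub (circleIntegrable_const _ _ _) (hci hbcont),
        Real.circleAverage_const]
    have e2 : Real.circleAverage b z₀ r =
        s⁻¹ * Real.circleAverage (fun x => h x + η * ‖x‖ ^ 2) z₀ r := by
      rw [← smul_eq_mul, ← Real.circleAverage_fun_smul]
      simp only [hb, smul_eq_mul, div_eq_inv_mul]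
    have e3 : Real.circleAverage (fun x : ℂ => η * ‖x‖ ^ 2) z₀ r = η * (‖z₀‖ ^ 2 + r ^ 2) := by
      rw [← circleAverage_norm_sq, ← smul_eq_mul, ← Real.circleAverage_fun_smul]
      simp only [smul_eq_mul]
    rw [e1, e2, Real.circleAverage_fun_add (hci hν.continuous) (hci (by fun_prop)), e3,
      hν.circleAverage_eq hνC hr fun w hw => ?_, div_eq_inv_mul]
    by_contra! hlt
    have hwb : w ∈ Metric.closedBall z₀ r := by
      rw [Metric.mem_closedBall, dist_eq_norm, norm_sub_rev]
      exact hlt.le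
    exact (hball hwb).2 hw
  rw [hu₀, EReal.coe_le_coe_iff, havg, hT, hb] at hcirc
  -- The submean inequality at the maximum point would force this strictly positive gain to be at
  -- most 0.
  have h5 : 0 < η * r ^ 2 / s := by positivity
  have h6 : (h z₀ + η * (‖z₀‖ ^ 2 + r ^ 2)) / s = (h z₀ + η * ‖z₀‖ ^ 2) / s + η * r ^ 2 / s := by
    rw [← add_div]; ring
  dsimp only at hcirc
  linarith

/-! ### The domination principle -/

/-- Chebyshev's inequality on the tail: `N * μ {p > N}` is at most the integral of `p` over that
set, which tends to 0. The factor `N` is needed where a potential is only known to be at most `N`.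
-/
theorem tendsto_mul_measureReal_compl_le {α : Type*} [MeasurableSpace α] {μ : Measure α}
    [IsFiniteMeasure μ] {p : α → ℝ} (hp : Integrable p μ) (hpm : Measurable p) :
    Tendsto (fun N : ℕ => (N : ℝ) * μ.real {x | (N : ℝ) < p x}) atTop (𝓝 0) ∧
      Tendsto (fun N : ℕ => μ.real {x | (N : ℝ) < p x}) atTop (𝓝 0) := by
  have hms : ∀ N : ℕ, MeasurableSet {x | (N : ℝ) < p x} := fun N =>
    measurableSet_lt measurable_const hpm
  have h0 : Tendsto (fun N : ℕ => μ {x | (N : ℝ) < p x}) atTop (𝓝 0) := by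
    have := tendsto_measure_iInter_atTop (μ := μ) (s := fun N : ℕ => {x | (N : ℝ) < p x})
      (fun N => (hms N).nullMeasurableSet)
      (fun m n h x (hx : (n : ℝ) < p x) =>
        show (m : ℝ) < p x from lt_of_le_of_lt (Nat.cast_le.2 h) hx) ⟨0, measure_ne_top _ _⟩
    have hempty : ⋂ N : ℕ, {x | (N : ℝ) < p x} = ∅ := by
      ext x
      simp only [Set.mem_iInter, Set.mem_ofPred_eq, Set.mem_empty_iff_false, iff_false, not_forall,
        not_lt]
      exact exists_nat_ge (p x)
    rwa [hempty, measure_empty] at this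
  refine ⟨?_, (ENNReal.tendsto_toReal ENNReal.zero_ne_top).comp h0⟩
  have h1 := hp.tendsto_setIntegral_nhds_zero h0
  refine squeeze_zero (fun N => by positivity) (fun N => ?_) h1
  have h2 : ∫ _ in {x | (N : ℝ) < p x}, (N : ℝ) ∂μ = (N : ℝ) * μ.real {x | (N : ℝ) < p x} := by
    simp [mul_comm]
  rw [← h2]
  exact setIntegral_mono_on (integrable_const _).integrableOn hp.integrableOn (hms N)
    fun x hx => le_of_lt hx

/-- The kernel is at least `-log (2 * R)` on the disc, so discarding mass raises the potential by at
most that mass times `log (2 * R)`. -/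
theorem truncPotential_restrict_le {μ : Measure ℂ} (hμ : CompactlyCarried μ) {R : ℝ} (hR1 : 1 ≤ R)
    (hR : ∀ᵐ x ∂μ, x ∈ Metric.closedBall (0 : ℂ) R) {C : Set ℂ} (hC : MeasurableSet C)
    {x : ℂ} (hx : ‖x‖ ≤ R) (n : ℕ) :
    truncPotential (μ.restrict C) (dyadic n) x ≤
      truncPotential μ (dyadic n) x + μ.real Cᶜ * Real.log (2 * R) := by
  have := hμ.finite
  have hsplit : truncPotential μ (dyadic n) x = truncPotential (μ.restrict C) (dyadic n) x +
      ∫ w in Cᶜ, truncKernel (dyadic n) x w ∂μ :=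
    (integral_add_compl hC (integrable_truncKernel hμ (dyadic_pos n) x)).symm
  have hlow : -(μ.real Cᶜ * Real.log (2 * R)) ≤ ∫ w in Cᶜ, truncKernel (dyadic n) x w ∂μ := by
    have h2 : ∫ _ in Cᶜ, -Real.log (2 * R) ∂μ = -(μ.real Cᶜ * Real.log (2 * R)) := by
      simp
    rw [← h2]
    refine integral_mono_ae (integrable_const _)
      (integrable_truncKernel (hμ.restrict Cᶜ) (dyadic_pos n) x) ?_
    filter_upwards [ae_restrict_of_ae hR] with w hw
    refine truncKernel_ge (dyadic_pos n) ?_ (by linarith [dyadic_le_one n])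
    have hw' : ‖w‖ ≤ R := by simpa using hw
    linarith [norm_sub_le x w]
  linarith

/-- The maximum principle wants a continuous potential and a pointwise bound. Both hold after
restricting `μ` to suitable compact sets `C N` on which the potential is at most `N`. The lost mass
`e N` costs terms of order `e N` and `N * e N`, which vanish in the limit. -/
theorem IsSubLelong.domination {u : ℂ → EReal} (hu : IsSubLelong u) {B : Set ℂ} (hB : IsCompact B)
    {μ : Measure ℂ} (hμ : IsProbOn B μ) {A : ℝ} (hA : ∀ n, truncEnergy (dyadic n) μ μ ≤ A) {F : ℝ}
    (hle : ∀ᵐ x ∂μ, u x ≤ (F : EReal) - potential μ x) (z : ℂ) :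
    u z ≤ (F : EReal) - potential μ z := by
  have hc := hμ.compactlyCarried hB
  have := hμ.isProb
  rw [const_sub_potential_eq_iInf hc]
  refine le_iInf fun k => ?_
  obtain ⟨hfin, hint, -⟩ := potential_integrable hc hc hA
  obtain ⟨R, hR1, hR⟩ := hc.exists_ball
  set p : ℂ → ℝ := fun x => (potential μ x).toReal with hp
  have hpm : Measurable p := (measurable_potential hc).ereal_toReal
  set L := Real.log (2 * R) with hL
  have hL0 : 0 ≤ L := Real.log_nonneg (by linarith)
  set G : ℕ → Set ℂ := fun N =>
    {x | x ∈ Metric.closedBall (0 : ℂ) R ∧ potential μ x ≤ ((N : ℝ) : EReal) ∧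
      u x ≤ (F : EReal) - potential μ x} with hG
  have hGm : ∀ N, MeasurableSet (G N) := fun N => by
    refine Metric.isClosed_closedBall.measurableSet.inter
      ((measurableSet_le (measurable_potential hc) measurable_const).inter
        (measurableSet_le hu.usc.measurable ?_))
    exact (upperSemicontinuous_const_sub_potential hc F).measurable
  -- This tolerance tends to 0 even after multiplication by `N`.
  have hδ : ∀ N : ℕ, (0 : ℝ) < 1 / ((N : ℝ) + 1) ^ 2 := fun N => by positivity
  choose C hCG hC hGC h hh using fun N =>
    exists_hasContPotential_restrict hc hfin (hGm N) (hδ N)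
  have hCm : ∀ N, MeasurableSet (C N) := fun N => (hC N).measurableSet
  -- the mass outside `C N`
  have hmass : ∀ N, μ.real (C N)ᶜ ≤ μ.real {x | (N : ℝ) < p x} + 1 / ((N : ℝ) + 1) ^ 2 := by
    intro N
    have hsub : μ (C N)ᶜ ≤ μ ({x | (N : ℝ) < p x} ∪ (G N \ C N)) := by
      refine measure_mono_ae ?_
      filter_upwards [hfin, hR, hle] with x h1 h2 h3 hx
      by_cases hN : (N : ℝ) < p x
      · exact Or.inl hN
      · refine Or.inr ⟨⟨h2, ?_, h3⟩, hx⟩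
        rw [h1]
        exact EReal.coe_le_coe_iff.2 (not_lt.1 hN)
    have h4 : μ.real (G N \ C N) ≤ 1 / ((N : ℝ) + 1) ^ 2 :=
      ENNReal.toReal_le_of_le_ofReal (hδ N).le (hGC N)
    calc μ.real (C N)ᶜ ≤ μ.real ({x | (N : ℝ) < p x} ∪ (G N \ C N)) :=
          ENNReal.toReal_mono (measure_ne_top _ _) hsub
      _ ≤ _ := (measureReal_union_le _ _).trans (by gcongr)
  -- The second summand makes `1 - e N` strictly smaller than the mass of the restriction, as the
  -- maximum principle requires.
  set e : ℕ → ℝ := fun N => μ.real (C N)ᶜ + 1 / ((N : ℝ) + 1) ^ 2 with he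
  have he0 : ∀ N, 0 < e N := fun N => add_pos_of_nonneg_of_pos measureReal_nonneg (hδ N)
  obtain ⟨hlim1, hlim2⟩ := tendsto_mul_measureReal_compl_le hint hpm
  have hinv : Tendsto (fun N : ℕ => 1 / ((N : ℝ) + 1)) atTop (𝓝 0) :=
    tendsto_one_div_add_atTop_nhds_zero_nat
  have hinv2 : Tendsto (fun N : ℕ => 1 / ((N : ℝ) + 1) ^ 2) atTop (𝓝 0) := by
    simpa [div_pow] using hinv.pow 2
  have helim : Tendsto e atTop (𝓝 0) := by
    refine squeeze_zero (fun N => (he0 N).le) (fun N => ?_)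
      (by simpa using (hlim2.add (hinv2.const_mul 2)) :
        Tendsto (fun N : ℕ => μ.real {x | (N : ℝ) < p x} + 2 * (1 / ((N : ℝ) + 1) ^ 2)) atTop (𝓝 0))
    linarith [hmass N]
  have hNelim : Tendsto (fun N : ℕ => (N : ℝ) * e N) atTop (𝓝 0) := by
    refine squeeze_zero (fun N => mul_nonneg (Nat.cast_nonneg _) (he0 N).le) (fun N => ?_)
      (by simpa using (hlim1.add (hinv.const_mul 2)) :
        Tendsto (fun N : ℕ => (N : ℝ) * μ.real {x | (N : ℝ) < p x} + 2 * (1 / ((N : ℝ) + 1)))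
          atTop (𝓝 0))
    have h1 : e N ≤ μ.real {x | (N : ℝ) < p x} + 2 * (1 / ((N : ℝ) + 1) ^ 2) := by
      linarith [hmass N]
    have h2 : (N : ℝ) * (1 / ((N : ℝ) + 1) ^ 2) ≤ 1 / ((N : ℝ) + 1) := by
      rw [mul_one_div, div_le_div_iff₀ (by positivity) (by positivity)]
      nlinarith [Nat.cast_nonneg (α := ℝ) N]
    nlinarith [mul_le_mul_of_nonneg_left h1 (Nat.cast_nonneg (α := ℝ) N)]
  -- the maximum principle for the restriction to `C N`
  set M : ℕ → ℝ := fun N => (1 - e N) * F + e N * L + e N * (N + e N * L) with hM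
  have hmaxp : ∀ᶠ N in atTop, u z ≤
      (((M N - truncPotential (μ.restrict (C N)) (dyadic k) z) / (1 - e N) : ℝ) : EReal) := by
    filter_upwards [helim.eventually (gt_mem_nhds one_pos)] with N hN
    have hs : 0 < 1 - e N := by linarith
    have hres : (μ.restrict (C N)).real Set.univ = 1 - μ.real (C N)ᶜ := by
      rw [measureReal_restrict_apply MeasurableSet.univ, Set.univ_inter,
        probReal_compl_eq_one_sub (hCm N)]
      ring
    refine (hu.maximum_principle (M := M N) (hh N) (hC N).isClosed (by simp [hCm N]) hs ?_ ?_ z).trans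
      (EReal.coe_le_coe_iff.2 ?_)
    · rw [hres]
      linarith [hδ N]
    · intro x hx
      obtain ⟨hxR, hxN, hxu⟩ := hCG N hx
      have hxp : potential μ x = (p x : EReal) := by
        refine (EReal.coe_toReal (fun htop => ?_) (potential_ne_bot hc x)).symm
        rw [htop] at hxN
        exact absurd hxN (not_le.2 (EReal.coe_lt_top _))
      rw [hxp] at hxN hxu
      have hxN' : p x ≤ N := EReal.coe_le_coe_iff.1 hxN
      have hhx : h N x ≤ p x + μ.real (C N)ᶜ * L := by
        refine le_of_tendsto' ((hh N).tendsto x) fun n => ?_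
        refine (truncPotential_restrict_le hc hR1 hR (hCm N) (by simpa using hxR) n).trans ?_
        have : (truncPotential μ (dyadic n) x : EReal) ≤ p x :=
          hxp ▸ truncPotential_le_potential hc n x
        linarith [EReal.coe_le_coe_iff.1 this]
      have hcL : μ.real (C N)ᶜ * L ≤ e N * L :=
        mul_le_mul_of_nonneg_right (by linarith [hδ N]) hL0
      rw [← EReal.coe_sub] at hxu
      refine hxu.trans (EReal.coe_le_coe_iff.2 ?_)
      rw [le_div_iff₀ hs, hM]
      -- Split `h N x` with weights `e N` and `1 - e N`: the first part is bounded through `p x ≤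
      -- N`, the second is compared with `p x`. This explains the terms of `M`.
      have h1 : e N * h N x ≤ e N * (N + e N * L) :=
        mul_le_mul_of_nonneg_left (by linarith) (he0 N).le
      have h2 : (1 - e N) * (h N x - e N * L) ≤ (1 - e N) * p x :=
        mul_le_mul_of_nonneg_left (by linarith) hs.le
      have h3 : 0 ≤ e N * (e N * L) := by have := he0 N; positivity
      nlinarith
    · refine div_le_div_of_nonneg_right ?_ hs.le
      linarith [(hh N).truncPotential_le k z]
  have htp : Tendsto (fun N => truncPotential (μ.restrict (C N)) (dyadic k) z) atTop
      (𝓝 (truncPotential μ (dyadic k) z)) := by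
    have hk := integrable_truncKernel hc (dyadic_pos k) z
    have hμC : Tendsto (fun N => μ (C N)ᶜ) atTop (𝓝 0) := by
      have h1 : Tendsto (fun N => μ.real (C N)ᶜ) atTop (𝓝 0) :=
        squeeze_zero (fun _ => measureReal_nonneg) (fun N => by linarith [hδ N]) helim
      rwa [← ENNReal.tendsto_toReal_iff (fun _ => measure_ne_top _ _) ENNReal.zero_ne_top]
    have h1 := (tendsto_const_nhds (x := truncPotential μ (dyadic k) z)).sub
      (hk.tendsto_setIntegral_nhds_zero hμC)
    rw [sub_zero] at h1
    refine h1.congr fun N => ?_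
    have : truncPotential μ (dyadic k) z = truncPotential (μ.restrict (C N)) (dyadic k) z +
        ∫ w in (C N)ᶜ, truncKernel (dyadic k) z w ∂μ := (integral_add_compl (hCm N) hk).symm
    linarith
  have hMlim : Tendsto M atTop (𝓝 F) := by
    have h1 : Tendsto (fun N => F - e N * F + e N * L + (N * e N + e N * e N * L)) atTop
        (𝓝 (F - 0 * F + 0 * L + (0 + 0 * 0 * L))) :=
      (((helim.mul_const F).const_sub F).add (helim.mul_const L)).add
        (hNelim.add ((helim.mul helim).mul_const L))
    simp only [zero_mul, sub_zero, add_zero] at h1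
    refine h1.congr fun N => ?_
    simp only [hM]
    ring
  have hfinal : Tendsto (fun N => (M N - truncPotential (μ.restrict (C N)) (dyadic k) z) / (1 - e N))
      atTop (𝓝 (F - truncPotential μ (dyadic k) z)) := by
    have := (hMlim.sub htp).div (helim.const_sub 1) (by norm_num)
    simp only [sub_zero, div_one] at this
    exact this
  exact ge_of_tendsto ((continuous_coe_real_ereal.tendsto _).comp hfinal) hmaxp

/-! ### Weak compactness -/

theorem IsProbOn.exists_subtype {B : Set ℂ} (hB : MeasurableSet B) {μ : Measure ℂ}
    (hμ : IsProbOn B μ) : ∃ m : ProbabilityMeasure B, (m : Measure B).map Subtype.val = μ := by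
  have := hμ.isProb
  have hmap : (μ.comap (Subtype.val : B → ℂ)).map Subtype.val = μ := by
    rw [(MeasurableEmbedding.subtype_coe hB).map_comap, Subtype.range_coe]
    exact Measure.restrict_eq_self_of_ae_mem hμ.ae_mem
  have hp : IsProbabilityMeasure (μ.comap (Subtype.val : B → ℂ)) := by
    refine ⟨?_⟩
    have h1 : (μ.comap (Subtype.val : B → ℂ)).map Subtype.val Set.univ = 1 := by
      rw [hmap]; exact measure_univ
    rwa [Measure.map_apply measurable_subtype_coe MeasurableSet.univ, Set.preimage_univ] at h1
  exact ⟨⟨_, hp⟩, hmap⟩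

theorem isProbOn_map_subtype {B : Set ℂ} (hB : MeasurableSet B) (m : ProbabilityMeasure B) :
    IsProbOn B ((m : Measure B).map Subtype.val) := by
  refine ⟨Measure.isProbabilityMeasure_map measurable_subtype_coe.aemeasurable, ?_⟩
  rw [Measure.map_apply measurable_subtype_coe hB.compl]
  simp

/-- Weak convergence, tested on continuous functions of one and of two variables. -/
structure TendstoWeakly (μ : ℕ → Measure ℂ) (ν : Measure ℂ) : Prop where
  integral : ∀ f : ℂ → ℝ, Continuous f →
    Tendsto (fun n => ∫ x, f x ∂(μ n)) atTop (𝓝 (∫ x, f x ∂ν))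
  integral_prod : ∀ f : ℂ × ℂ → ℝ, Continuous f →
    Tendsto (fun n => ∫ x, f x ∂((μ n).prod (μ n))) atTop (𝓝 (∫ x, f x ∂(ν.prod ν)))

/-- Probability measures on the compact set `B` are weakly sequentially compact. Forming products is
weakly continuous, which gives the two-variable tests needed for energies. -/
theorem exists_tendstoWeakly {B : Set ℂ} (hB : IsCompact B) (μ : ℕ → Measure ℂ)
    (hμ : ∀ n, IsProbOn B (μ n)) :
    ∃ ν, IsProbOn B ν ∧ ∃ φ : ℕ → ℕ, StrictMono φ ∧ TendstoWeakly (fun n => μ (φ n)) ν := by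
  have : CompactSpace B := isCompact_iff_compactSpace.1 hB
  choose m hm using fun n => (hμ n).exists_subtype hB.measurableSet
  obtain ⟨l, φ, hφ, hl⟩ := CompactSpace.tendsto_subseq m
  have hv : Continuous (Subtype.val : B → ℂ) := continuous_subtype_val
  refine ⟨(l : Measure B).map Subtype.val, isProbOn_map_subtype hB.measurableSet l, φ, hφ, ?_, ?_⟩
  · intro f hf
    have h1 := ProbabilityMeasure.tendsto_iff_forall_integral_tendsto.1 hl
      (BoundedContinuousFunction.mkOfCompact ⟨_, hf.comp hv⟩)
    simp only [BoundedContinuousFunction.mkOfCompact_apply, ContinuousMap.coe_mk,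
      Function.comp_apply] at h1
    simp only [← hm]
    simp only [integral_map hv.aemeasurable hf.aestronglyMeasurable]
    exact h1
  · intro f hf
    have hl2 : Tendsto (fun n => (m (φ n)).prod (m (φ n))) atTop (𝓝 (l.prod l)) :=
      (ProbabilityMeasure.continuous_prod.tendsto (l, l)).comp (hl.prodMk_nhds hl)
    have hv2 : Continuous (Prod.map Subtype.val Subtype.val : B × B → ℂ × ℂ) := hv.prodMap hv
    have h1 := ProbabilityMeasure.tendsto_iff_forall_integral_tendsto.1 hl2
      (BoundedContinuousFunction.mkOfCompact ⟨_, hf.comp hv2⟩)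
    simp only [BoundedContinuousFunction.mkOfCompact_apply, ContinuousMap.coe_mk,
      Function.comp_apply, ProbabilityMeasure.toMeasure_prod] at h1
    simp only [← hm]
    simp only [Measure.map_prod_map _ _ hv.measurable hv.measurable,
      integral_map hv2.aemeasurable hf.aestronglyMeasurable]
    exact h1

theorem TendstoWeakly.truncPotential {μ : ℕ → Measure ℂ} {ν : Measure ℂ} (h : TendstoWeakly μ ν)
    {r : ℝ} (hr : 0 < r) (z : ℂ) :
    Tendsto (fun n => truncPotential (μ n) r z) atTop (𝓝 (truncPotential ν r z)) :=
  h.integral _ (continuous_truncKernel_right hr z)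

/-! ### Energies -/

theorem tendsto_truncEnergy_of_le {μ ν : Measure ℂ} (hμ : CompactlyCarried μ)
    (hν : CompactlyCarried ν) {A : ℝ} (hA : ∀ n, truncEnergy (dyadic n) μ ν ≤ A) :
    ∃ e ≤ A, Tendsto (fun n => truncEnergy (dyadic n) μ ν) atTop (𝓝 e) :=
  ⟨_, ciSup_le hA, tendsto_atTop_ciSup (monotone_truncEnergy hμ hν) ⟨A, by rintro _ ⟨n, rfl⟩; exact hA n⟩⟩

theorem le_truncEnergy {μ : Measure ℂ} {R : ℝ} (hR : 1 ≤ R)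
    (hμ : IsProbOn (Metric.closedBall 0 R) μ) (n : ℕ) :
    -Real.log (2 * R) ≤ truncEnergy (dyadic n) μ μ := by
  have hc := hμ.compactlyCarried (isCompact_closedBall 0 R)
  have := hμ.isProb
  have hconst : ∀ c : ℝ, ∫ _, c ∂μ = c := fun c => by simp
  rw [← hconst (-Real.log (2 * R))]
  refine integral_mono_ae (integrable_const _)
    (hc.integrable (continuous_truncPotential hc (dyadic_pos n))) ?_
  filter_upwards [hμ.ae_mem] with x hx
  rw [← hconst (-Real.log (2 * R))]
  refine integral_mono_ae (integrable_const _) (integrable_truncKernel hc (dyadic_pos n) x) ?_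
  filter_upwards [hμ.ae_mem] with w hw
  have hx' : ‖x‖ ≤ R := by simpa using hx
  have hw' : ‖w‖ ≤ R := by simpa using hw
  exact truncKernel_ge (dyadic_pos n) (by linarith [norm_sub_le x w])
    (by linarith [dyadic_le_one n])

/-- The convex combination `(1 - t) μ + t ν`. -/
def mix (t : ℝ) (μ ν : Measure ℂ) : Measure ℂ := ENNReal.ofReal (1 - t) • μ + ENNReal.ofReal t • ν

section Mix

variable {μ ν : Measure ℂ} {t : ℝ}

theorem integral_mix (ht0 : 0 ≤ t) (ht1 : t ≤ 1) {f : ℂ → ℝ} (hμ : Integrable f μ)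
    (hν : Integrable f ν) :
    ∫ x, f x ∂(mix t μ ν) = (1 - t) * ∫ x, f x ∂μ + t * ∫ x, f x ∂ν := by
  rw [mix, integral_add_measure (hμ.smul_measure ENNReal.ofReal_ne_top)
    (hν.smul_measure ENNReal.ofReal_ne_top), integral_smul_measure, integral_smul_measure,
    ENNReal.toReal_ofReal ht0, ENNReal.toReal_ofReal (sub_nonneg.2 ht1), smul_eq_mul, smul_eq_mul]

theorem isProbOn_mix {K : Set ℂ} (hμ : IsProbOn K μ) (hν : IsProbOn K ν) (ht0 : 0 ≤ t)
    (ht1 : t ≤ 1) : IsProbOn K (mix t μ ν) := by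
  have := hμ.isProb
  have := hν.isProb
  refine ⟨⟨?_⟩, ?_⟩
  · simp only [mix, Measure.coe_add, Measure.coe_smul, Pi.add_apply, Pi.smul_apply, measure_univ,
      smul_eq_mul, mul_one]
    rw [← ENNReal.ofReal_add (sub_nonneg.2 ht1) ht0, sub_add_cancel, ENNReal.ofReal_one]
  · simp [mix, hμ.compl_eq_zero, hν.compl_eq_zero]

theorem truncEnergy_mix (hμ : CompactlyCarried μ) (hν : CompactlyCarried ν) (ht0 : 0 ≤ t)
    (ht1 : t ≤ 1) {r : ℝ} (hr : 0 < r) :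
    truncEnergy r (mix t μ ν) (mix t μ ν) = (1 - t) ^ 2 * truncEnergy r μ μ +
      2 * t * (1 - t) * truncEnergy r μ ν + t ^ 2 * truncEnergy r ν ν := by
  have h1 : truncPotential (mix t μ ν) r = fun z =>
      (1 - t) * truncPotential μ r z + t * truncPotential ν r z := by
    ext z
    exact integral_mix ht0 ht1 (integrable_truncKernel hμ hr z) (integrable_truncKernel hν hr z)
  have cμ := continuous_truncPotential hμ hr
  have cν := continuous_truncPotential hν hr
  have h2 : ∀ {η : Measure ℂ}, CompactlyCarried η →
      ∫ z, ((1 - t) * truncPotential μ r z + t * truncPotential ν r z) ∂η =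
        (1 - t) * truncEnergy r η μ + t * truncEnergy r η ν := fun hη => by
    rw [integral_add ((hη.integrable cμ).const_mul _) ((hη.integrable cν).const_mul _),
      integral_const_mul, integral_const_mul]
    rfl
  have h3 := truncEnergy_comm hν hμ hr
  rw [truncEnergy, h1, integral_mix ht0 ht1 (hμ.integrable (by fun_prop))
    (hν.integrable (by fun_prop)), h2 hμ, h2 hν, h3]
  ring

end Mix

/-! ### Minimizers of the weighted energy -/

/-- `μ` has finite energy `e` and minimizes the weighted energy among the probability measures
on `K`. -/
structure IsMinimizer (K : Set ℂ) (Q : ℂ → ℝ) (μ : Measure ℂ) (e : ℝ) : Prop where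
  isProbOn : IsProbOn K μ
  tendsto : Tendsto (fun n => truncEnergy (dyadic n) μ μ) atTop (𝓝 e)
  le : ∀ ν, IsProbOn K ν → ∀ e', Tendsto (fun n => truncEnergy (dyadic n) ν ν) atTop (𝓝 e') →
    e + 2 * ∫ x, Q x ∂μ ≤ e' + 2 * ∫ x, Q x ∂ν

theorem IsProbOn.integral_le_of_le {K : Set ℂ} (hK : IsCompact K) {μ : Measure ℂ}
    (hμ : IsProbOn K μ) {f : ℂ → ℝ} (hf : Continuous f) {c : ℝ} (h : ∀ x ∈ K, f x ≤ c) :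
    ∫ x, f x ∂μ ≤ c := by
  have := hμ.isProb
  have hconst : ∫ _, c ∂μ = c := by simp
  rw [← hconst]
  exact integral_mono_ae ((hμ.compactlyCarried hK).integrable hf) (integrable_const _)
    (hμ.ae_mem.mono h)

theorem IsProbOn.le_integral_of_le {K : Set ℂ} (hK : IsCompact K) {μ : Measure ℂ}
    (hμ : IsProbOn K μ) {f : ℂ → ℝ} (hf : Continuous f) {c : ℝ} (h : ∀ x ∈ K, c ≤ f x) :
    c ≤ ∫ x, f x ∂μ := by
  have := hμ.integral_le_of_le hK hf.neg (c := -c) fun x hx => neg_le_neg (h x hx)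
  rw [Pi.neg_def, integral_neg] at this
  linarith

/-- The direct method: truncated energies are weakly continuous and increase to the energy, which is
therefore lower semicontinuous along a minimizing sequence. -/
theorem exists_isMinimizer {K : Set ℂ} (hK : IsCompact K) {Q : ℂ → ℝ} (hQ : Continuous Q)
    {μ₀ : Measure ℂ} (hμ₀ : IsProbOn K μ₀) {A : ℝ} (hA : ∀ n, truncEnergy (dyadic n) μ₀ μ₀ ≤ A) :
    ∃ μ e, IsMinimizer K Q μ e := by
  obtain ⟨e₀, -, he₀⟩ := tendsto_truncEnergy_of_le (hμ₀.compactlyCarried hK)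
    (hμ₀.compactlyCarried hK) hA
  obtain ⟨R₀, hR₀⟩ := hK.isBounded.subset_closedBall 0
  set R := max R₀ 1
  have hR1 : 1 ≤ R := le_max_right _ _
  have hKR : K ⊆ Metric.closedBall 0 R :=
    hR₀.trans (Metric.closedBall_subset_closedBall (le_max_left _ _))
  obtain ⟨q, hq⟩ := hK.exists_bound_of_continuousOn hQ.continuousOn
  set S : Set ℝ := {x | ∃ ν e, IsProbOn K ν ∧
    Tendsto (fun n => truncEnergy (dyadic n) ν ν) atTop (𝓝 e) ∧ x = e + 2 * ∫ x, Q x ∂ν} with hS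
  have hne : S.Nonempty := ⟨_, μ₀, e₀, hμ₀, he₀, rfl⟩
  have hbdd : BddBelow S := by
    refine ⟨-Real.log (2 * R) + 2 * -q, ?_⟩
    rintro _ ⟨ν, e, hν, he, rfl⟩
    have h1 := ge_of_tendsto' he fun n => le_truncEnergy hR1 (hν.mono hKR) n
    have h2 := hν.le_integral_of_le hK hQ fun x hx => (abs_le.1 (hq x hx)).1
    linarith
  obtain ⟨x, -, hx, hxS⟩ := exists_seq_tendsto_sInf hne hbdd
  choose ν e hν he hxe using hxS
  obtain ⟨μ, hμ, φ, hφ, hlim⟩ := exists_tendstoWeakly hK ν hν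
  have hc := hμ.compactlyCarried hK
  have hQlim := hlim.integral Q hQ
  have hle : ∀ n, truncEnergy (dyadic n) μ μ ≤ sInf S - 2 * ∫ x, Q x ∂μ := fun n => by
    rw [truncEnergy_eq_prod hc hc (dyadic_pos n)]
    refine le_of_tendsto_of_tendsto' (hlim.integral_prod _ (continuous_truncKernel (dyadic_pos n)))
      ((hx.comp hφ.tendsto_atTop).sub (hQlim.const_mul 2)) fun k => ?_
    have hck := (hν (φ k)).compactlyCarried hK
    rw [← truncEnergy_eq_prod hck hck (dyadic_pos n), Function.comp_apply, hxe, add_sub_cancel_right]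
    exact (monotone_truncEnergy hck hck).ge_of_tendsto (he (φ k)) n
  obtain ⟨e', he'le, he'⟩ := tendsto_truncEnergy_of_le hc hc hle
  refine ⟨μ, e', hμ, he', fun η hη e'' he'' => ?_⟩
  have := csInf_le hbdd (show e'' + 2 * ∫ x, Q x ∂η ∈ S from ⟨η, e'', hη, he'', rfl⟩)
  linarith

theorem integral_add_sub_const {α : Type*} [MeasurableSpace α] {μ : Measure α} [IsFiniteMeasure μ]
    {f g : α → ℝ} (hf : Integrable f μ) (hg : Integrable g μ) (c : ℝ) :
    ∫ x, (f x + g x - c) ∂μ = ∫ x, f x ∂μ + ∫ x, g x ∂μ - μ.real Set.univ * c := by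
  have h1 : ∫ x, (f x + g x - c) ∂μ = ∫ x, (f x + g x) ∂μ - ∫ _, c ∂μ :=
    integral_sub (hf.add hg) (integrable_const c)
  rw [h1, integral_add hf hg, integral_const, smul_eq_mul]

theorem nonneg_of_forall_small {a b : ℝ} (h : ∀ t : ℝ, 0 < t → t < 1 → 0 ≤ t * a + t ^ 2 * b) :
    0 ≤ a := by
  by_contra! ha
  have hb : 0 < |b| + 1 + -a := by linarith [abs_nonneg b]
  -- With this `t`, `a + t * |b|` equals `-t * (1 - a)`, which is negative.
  have ht : 0 < -a / (|b| + 1 + -a) := div_pos (by linarith) hb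
  have ht1 : -a / (|b| + 1 + -a) < 1 := by
    rw [div_lt_one hb]; linarith [abs_nonneg b]
  have h1 := h _ ht ht1
  set t := -a / (|b| + 1 + -a) with htdef
  have h2 : t * (|b| + 1 + -a) = -a := div_mul_cancel₀ _ hb.ne'
  have h3 : 0 ≤ a + t * b := by
    have : 0 ≤ t * (a + t * b) := by linarith
    exact nonneg_of_mul_nonneg_right this ht
  have h4 : t * b ≤ t * |b| := mul_le_mul_of_nonneg_left (le_abs_self b) ht.le
  nlinarith

namespace IsMinimizer

variable {K : Set ℂ} {Q : ℂ → ℝ} {μ : Measure ℂ} {e : ℝ}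

theorem truncEnergy_le (h : IsMinimizer K Q μ e) (hK : IsCompact K) (n : ℕ) :
    truncEnergy (dyadic n) μ μ ≤ e :=
  have hc := h.isProbOn.compactlyCarried hK
  (monotone_truncEnergy hc hc).ge_of_tendsto h.tendsto n

/-- The first variation: the weighted energy of `mix t μ ν` is quadratic in `t` and smallest at `t =
0`, so its linear coefficient is nonnegative. -/
theorem variation (h : IsMinimizer K Q μ e) (hK : IsCompact K) (hQ : Continuous Q) {ν : Measure ℂ}
    (hν : IsProbOn K ν) {A m : ℝ} (hA : ∀ n, truncEnergy (dyadic n) ν ν ≤ A)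
    (hm : Tendsto (fun n => truncEnergy (dyadic n) μ ν) atTop (𝓝 m)) :
    e + ∫ x, Q x ∂μ ≤ m + ∫ x, Q x ∂ν := by
  have hcμ := h.isProbOn.compactlyCarried hK
  have hcν := hν.compactlyCarried hK
  obtain ⟨e', -, he'⟩ := tendsto_truncEnergy_of_le hcν hcν hA
  have key : 0 ≤ 2 * (m - e) + 2 * (∫ x, Q x ∂ν - ∫ x, Q x ∂μ) := by
    refine nonneg_of_forall_small (b := e - 2 * m + e') fun t ht0 ht1 => ?_
    have hlim : Tendsto (fun n => truncEnergy (dyadic n) (mix t μ ν) (mix t μ ν)) atTop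
        (𝓝 ((1 - t) ^ 2 * e + 2 * t * (1 - t) * m + t ^ 2 * e')) := by
      simp only [truncEnergy_mix hcμ hcν ht0.le ht1.le (dyadic_pos _)]
      exact ((h.tendsto.const_mul _).add (hm.const_mul _)).add (he'.const_mul _)
    have h1 := h.le _ (isProbOn_mix h.isProbOn hν ht0.le ht1.le) _ hlim
    rw [integral_mix ht0.le ht1.le (hcμ.integrable hQ) (hcν.integrable hQ)] at h1
    nlinarith
  linarith

/-- A circle has finite energy, so it is an admissible competitor. This gives information at every
centre of small circles inside the set, not just almost everywhere. -/
theorem le_circle (h : IsMinimizer K Q μ e) (hK : IsCompact K) (hQ : Continuous Q) {z : ℂ} {r : ℝ}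
    (hr : 0 < r) (hz : Metric.sphere z r ⊆ K) :
    e + ∫ x, Q x ∂μ ≤ truncPotential μ r z + Real.circleAverage Q z r := by
  have hσ := hasContPotential_circleMeasure z hr
  have hcμ := h.isProbOn.compactlyCarried hK
  rw [← integral_circleMeasure hQ.measurable]
  exact h.variation hK hQ ((isProbOn_circleMeasure z hr).mono hz)
    (fun n => hσ.truncEnergy_le hσ.carried n) (hσ.tendsto_truncEnergy hcμ)

/-- The first variation in the direction of the normalized restriction of `μ` to `S`. Its energy is
finite because restricting raises truncated potentials by at most a constant. -/
theorem setIntegral_nonneg (h : IsMinimizer K Q μ e) (hK : IsCompact K) (hQ : Continuous Q)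
    {S : Set ℂ} (hS : MeasurableSet S) :
    0 ≤ ∫ x in S, ((potential μ x).toReal + Q x - (e + ∫ x, Q x ∂μ)) ∂μ := by
  have hc := h.isProbOn.compactlyCarried hK
  have := h.isProbOn.isProb
  obtain ⟨hfin, hint, -⟩ := potential_integrable hc hc (h.truncEnergy_le hK)
  set F := e + ∫ x, Q x ∂μ with hF
  rcases (measureReal_nonneg (μ := μ) (s := S)).eq_or_lt with h0 | h0
  · have : μ.restrict S = 0 := Measure.restrict_eq_zero.2 <| by
      simpa [Measure.real, ENNReal.toReal_eq_zero_iff] using h0.symm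
    simp [this]
  set a := μ.real S with ha
  set ν : Measure ℂ := ENNReal.ofReal a⁻¹ • μ.restrict S with hν
  have hcS := hc.restrict S
  have hνK : IsProbOn K ν := by
    refine ⟨⟨?_⟩, ?_⟩
    · rw [hν, Measure.smul_apply, Measure.restrict_apply_univ, smul_eq_mul, ENNReal.ofReal_inv_of_pos h0,
        ha, ofReal_measureReal, ENNReal.inv_mul_cancel]
      · intro h1
        simp [ha, Measure.real, h1] at h0
      · exact measure_ne_top _ _
    · have : μ.restrict S Kᶜ = 0 := le_antisymm
        ((Measure.restrict_le_self _).trans h.isProbOn.compl_eq_zero.le) bot_le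
      simp [hν, this]
  have hcν := hνK.compactlyCarried hK
  have hintν : ∀ f : ℂ → ℝ, ∫ x, f x ∂ν = a⁻¹ * ∫ x in S, f x ∂μ := fun f => by
    rw [hν, integral_smul_measure, ENNReal.toReal_ofReal (inv_nonneg.2 h0.le), smul_eq_mul]
  -- the mutual energy
  have hSint : ∀ n, truncEnergy (dyadic n) (μ.restrict S) μ ≤ ∫ x in S, (potential μ x).toReal ∂μ := by
    intro n
    refine integral_mono_ae (hcS.integrable (continuous_truncPotential hc (dyadic_pos n)))
      hint.restrict ?_
    filter_upwards [ae_restrict_of_ae hfin] with x hx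
    have := truncPotential_le_potential hc n x
    rw [hx] at this
    exact EReal.coe_le_coe_iff.1 this
  have hSlim := (potential_integrable hcS hc hSint).2.2
  have hm : Tendsto (fun n => truncEnergy (dyadic n) μ ν) atTop
      (𝓝 (a⁻¹ * ∫ x in S, (potential μ x).toReal ∂μ)) := by
    refine (hSlim.const_mul a⁻¹).congr fun n => ?_
    rw [truncEnergy_comm hc hcν (dyadic_pos n), truncEnergy, truncEnergy, hintν]
  -- the energy of the restriction is finite
  obtain ⟨R, hR1, hR⟩ := hc.exists_ball
  have hA : ∀ n, truncEnergy (dyadic n) ν ν ≤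
      a⁻¹ * (a⁻¹ * (∫ x in S, (potential μ x).toReal ∂μ + a * (μ.real Sᶜ * Real.log (2 * R)))) := by
    intro n
    have hpot : truncPotential ν (dyadic n) = fun x => a⁻¹ * truncPotential (μ.restrict S) (dyadic n) x :=
      funext fun x => hintν _
    rw [truncEnergy, hintν, hpot, integral_const_mul]
    have h1 : ∫ x in S, truncPotential (μ.restrict S) (dyadic n) x ∂μ ≤
        ∫ x in S, (truncPotential μ (dyadic n) x + μ.real Sᶜ * Real.log (2 * R)) ∂μ := by
      refine integral_mono_ae (hcS.integrable (continuous_truncPotential hcS (dyadic_pos n)))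
        (hcS.integrable ((continuous_truncPotential hc (dyadic_pos n)).add continuous_const)) ?_
      filter_upwards [ae_restrict_of_ae hR] with x hx
      exact truncPotential_restrict_le hc hR1 hR hS (by simpa using hx) n
    rw [integral_add (hcS.integrable (continuous_truncPotential hc (dyadic_pos n)))
      (integrable_const _), setIntegral_const, smul_eq_mul] at h1
    have h2 := hSint n
    rw [truncEnergy] at h2
    have h3 : 0 ≤ a⁻¹ := inv_nonneg.2 h0.le
    exact mul_le_mul_of_nonneg_left (mul_le_mul_of_nonneg_left (by linarith) h3) h3
  have hvar := h.variation hK hQ hνK hA hm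
  rw [hintν, ← mul_add, ← hF] at hvar
  have hsplit : ∫ x in S, ((potential μ x).toReal + Q x - F) ∂μ =
      ∫ x in S, (potential μ x).toReal ∂μ + ∫ x in S, Q x ∂μ - a * F := by
    rw [integral_add_sub_const hint.restrict (hcS.integrable hQ), measureReal_restrict_apply_univ]
  rw [hsplit, sub_nonneg]
  rwa [← div_eq_inv_mul, le_div_iff₀ h0, mul_comm] at hvar

/-- With `F = e + ∫ Q dμ`, the function `p_μ + Q - F` is nonnegative almost everywhere and has total
integral 0, so it vanishes almost everywhere. -/
theorem ae_le (h : IsMinimizer K Q μ e) (hK : IsCompact K) (hQ : Continuous Q) :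
    ∀ᵐ x ∂μ, (Q x : EReal) ≤ ((e + ∫ x, Q x ∂μ : ℝ) : EReal) - potential μ x := by
  have hc := h.isProbOn.compactlyCarried hK
  have := h.isProbOn.isProb
  obtain ⟨hfin, hint, hlim⟩ := potential_integrable hc hc (h.truncEnergy_le hK)
  set F := e + ∫ x, Q x ∂μ with hF
  have hg : Integrable (fun x => (potential μ x).toReal + Q x - F) μ :=
    (hint.add (hc.integrable hQ)).sub (integrable_const F)
  have hnonneg : 0 ≤ᵐ[μ] fun x => (potential μ x).toReal + Q x - F :=
    ae_nonneg_of_forall_setIntegral_nonneg hg fun S hS _ => h.setIntegral_nonneg hK hQ hS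
  have hzero : ∫ x, ((potential μ x).toReal + Q x - F) ∂μ = 0 := by
    have he : ∫ x, (potential μ x).toReal ∂μ = e := tendsto_nhds_unique hlim h.tendsto
    rw [integral_add_sub_const hint (hc.integrable hQ), he, probReal_univ, one_mul, hF, sub_self]
  filter_upwards [(integral_eq_zero_iff_of_nonneg_ae hnonneg hg).1 hzero, hfin] with x hx hx'
  rw [hx', ← EReal.coe_sub, EReal.coe_le_coe_iff]
  have : (potential μ x).toReal + Q x - F = 0 := hx
  linarith

end IsMinimizer

/-! ### The weighted extremal function -/

theorem le_extremal {K : Set ℂ} {Q : ℂ → ℝ} {u : ℂ → EReal} (hu : IsLelong u)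
    (hle : ∀ x ∈ K, u x ≤ (Q x : EReal)) (z : ℂ) : u z ≤ extremal K Q z :=
  le_sSup ⟨u, hu, hle, rfl⟩

theorem extremal_le_extremalStar (K : Set ℂ) (Q : ℂ → ℝ) (z : ℂ) :
    extremal K Q z ≤ extremalStar K Q z :=
  le_limsup_of_frequently_le
    (frequently_iff.2 fun hU => ⟨z, mem_of_mem_nhds hU, le_rfl⟩)

theorem extremal_mono {K : Set ℂ} {Q Q' : ℂ → ℝ} (h : ∀ x ∈ K, Q x ≤ Q' x) (z : ℂ) :
    extremal K Q z ≤ extremal K Q' z :=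
  sSup_le fun _ ⟨_, hu, hle, ht⟩ => ht ▸ le_extremal hu
    (fun x hx => (hle x hx).trans (EReal.coe_le_coe_iff.2 (h x hx))) z

theorem extremalStar_mono {K : Set ℂ} {Q Q' : ℂ → ℝ} (h : ∀ x ∈ K, Q x ≤ Q' x) (z : ℂ) :
    extremalStar K Q z ≤ extremalStar K Q' z :=
  limsup_le_limsup (Eventually.of_forall (extremal_mono h))

theorem extremal_le_of_mem {K : Set ℂ} {Q : ℂ → ℝ} {z : ℂ} (hz : z ∈ K) :
    extremal K Q z ≤ (Q z : EReal) :=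
  sSup_le fun _ ⟨_, _, hle, ht⟩ => ht ▸ hle z hz

theorem TendstoWeakly.subseq {μ : ℕ → Measure ℂ} {ν : Measure ℂ} (h : TendstoWeakly μ ν)
    {φ : ℕ → ℕ} (hφ : StrictMono φ) : TendstoWeakly (fun n => μ (φ n)) ν :=
  ⟨fun f hf => (h.integral f hf).comp hφ.tendsto_atTop,
    fun f hf => (h.integral_prod f hf).comp hφ.tendsto_atTop⟩

/-- A function squeezed between the functions `F n - p_{μ n}` and the corresponding function of
the weak limit equals the latter almost everywhere for measures with continuous potential. -/
theorem TendstoWeakly.ae_eq {B : Set ℂ} (hB : IsCompact B) {μ : ℕ → Measure ℂ} {μ' : Measure ℂ}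
    (hμ : ∀ n, IsProbOn B (μ n)) (hμ' : IsProbOn B μ') (hw : TendstoWeakly μ μ') {F : ℕ → ℝ}
    {F' : ℝ} (hF : Tendsto F atTop (𝓝 F')) {V : ℂ → EReal}
    (hlow : ∀ n z, (F n : EReal) - potential (μ n) z ≤ V z)
    (hup : ∀ z, V z ≤ (F' : EReal) - potential μ' z) {ν : Measure ℂ} {h : ℂ → ℝ}
    (hν : HasContPotential ν h) :
    ∀ᵐ x ∂ν, V x = (F' : EReal) - potential μ' x := by
  have := hν.carried.finite
  have hc := fun n => (hμ n).compactlyCarried hB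
  have hc' := hμ'.compactlyCarried hB
  obtain ⟨hr', hi', he'⟩ := hν.potential_integrable hc'
  choose hr hi he using fun n => hν.potential_integrable (hc n)
  have hr := ae_all_iff.2 hr
  set a : ℕ → ℂ → ℝ := fun n x =>
    ((potential (μ n) x).toReal - F n) - ((potential μ' x).toReal - F') with ha
  have hai : ∀ n, Integrable (a n) ν := fun n =>
    ((hi n).sub (integrable_const _)).sub (hi'.sub (integrable_const _))
  have haint : ∀ n, ∫ x, a n x ∂ν =
      (∫ x, h x ∂(μ n) - ν.real Set.univ * F n) - (∫ x, h x ∂μ' - ν.real Set.univ * F') := fun n => by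
    have e1 : ∫ x, a n x ∂ν = ∫ x, ((potential (μ n) x).toReal - F n) ∂ν -
      ∫ x, ((potential μ' x).toReal - F') ∂ν :=
      integral_sub ((hi n).sub (integrable_const _)) (hi'.sub (integrable_const _))
    rw [e1, integral_sub (hi n) (integrable_const _), integral_sub hi' (integrable_const _), he, he',
      integral_const, integral_const, smul_eq_mul, smul_eq_mul]
  have halim : Tendsto (fun n => ∫ x, a n x ∂ν) atTop (𝓝 0) := by
    simp only [haint]
    have := ((hw.integral h hν.continuous).sub (hF.const_mul (ν.real Set.univ))).sub_const
      (∫ x, h x ∂μ' - ν.real Set.univ * F')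
    simpa using this
  have hnn : ∀ᵐ x ∂ν, ∀ n, 0 ≤ a n x := by
    filter_upwards [hr', hr] with x h1 h2 n
    have h3 := (hlow n x).trans (hup x)
    rw [h1, h2 n, ← EReal.coe_sub, ← EReal.coe_sub, EReal.coe_le_coe_iff] at h3
    simp only [ha]
    linarith
  -- The gaps `a n` are nonnegative with integrals tending to 0, so their infimum vanishes almost
  -- everywhere; this suffices because every lower function is below `V`.
  have hlint : ∫⁻ x, ⨅ n, ENNReal.ofReal (a n x) ∂ν = 0 := by
    refine le_antisymm (ge_of_tendsto' (f := fun n => ENNReal.ofReal (∫ x, a n x ∂ν)) (x := atTop)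
      (by simpa using ENNReal.tendsto_ofReal halim) fun n => ?_) bot_le
    rw [ofReal_integral_eq_lintegral_ofReal (hai n) (hnn.mono fun x hx => hx n)]
    exact lintegral_mono fun x => iInf_le _ n
  have hmeas : AEMeasurable (fun x => ⨅ n, ENNReal.ofReal (a n x)) ν :=
    AEMeasurable.iInf fun n => (hai n).aemeasurable.ennreal_ofReal
  filter_upwards [(lintegral_eq_zero_iff' hmeas).1 hlint, hr', hr] with x h0 h1 h2
  refine le_antisymm (hup x) (EReal.ge_of_forall_gt_iff_ge.1 fun c hc => ?_)
  rw [h1, ← EReal.coe_sub, EReal.coe_lt_coe_iff] at hc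
  have h0' : (⨅ n, ENNReal.ofReal (a n x)) < ENNReal.ofReal (F' - (potential μ' x).toReal - c) := by
    rw [show (⨅ n, ENNReal.ofReal (a n x)) = 0 from h0]
    exact ENNReal.ofReal_pos.2 (by linarith)
  obtain ⟨n, hn⟩ := iInf_lt_iff.1 h0'
  have hn' := (ENNReal.ofReal_lt_ofReal_iff (by linarith)).1 hn
  refine le_trans ?_ (hlow n x)
  rw [h2 n, ← EReal.coe_sub, EReal.coe_le_coe_iff]
  simp only [ha] at hn'
  linarith

/-- If `F - p_μ` is almost everywhere equal to `V ≤ F - p_μ` on each circle, then it is the upper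
semicontinuous regularization of `V`. -/
theorem limsup_eq_const_sub_potential {μ : Measure ℂ} (hμ : CompactlyCarried μ) {F : ℝ}
    {V : ℂ → EReal} (hup : ∀ z, V z ≤ (F : EReal) - potential μ z)
    (hae : ∀ z r, 0 < r → ∀ᵐ x ∂(circleMeasure z r), V x = (F : EReal) - potential μ x) (z : ℂ) :
    limsup V (𝓝 z) = (F : EReal) - potential μ z := by
  refine le_antisymm ((limsup_le_limsup (Eventually.of_forall hup)).trans
    (UpperSemicontinuousAt.limsup_le (upperSemicontinuous_const_sub_potential hμ F z))) ?_
  by_contra! hlt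
  obtain ⟨c, hc1, hc2⟩ := EReal.lt_iff_exists_real_btwn.1 hlt
  have hev := eventually_lt_of_limsup_lt hc1
  obtain ⟨r, hr, hball⟩ := Metric.nhds_basis_closedBall.mem_iff.1 hev
  have hσ := isProbOn_circleMeasure z hr
  have := hσ.isProb
  obtain ⟨hfin, hint, heq⟩ := potential_integrable_circleMeasure hμ z hr
  -- If `V < c` on a disc, then the mean of `F - p_μ` over its boundary circle is at most `c`, while
  -- that mean is at least the value at `z`.
  have h1 : F - truncPotential μ r z ≤ c := by
    rw [← heq]
    have e1 : ∫ x, (F - (potential μ x).toReal) ∂(circleMeasure z r) =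
        F - ∫ x, (potential μ x).toReal ∂(circleMeasure z r) := by
      rw [integral_sub (integrable_const _) hint]
      simp
    have e2 : ∫ _, c ∂(circleMeasure z r) = c := by simp
    rw [← e1, ← e2]
    refine integral_mono_ae ((integrable_const _).sub hint) (integrable_const _) ?_
    filter_upwards [hfin, hae z r hr, hσ.ae_mem] with x hx1 hx2 hx3
    have h3 : V x < c := hball (Metric.sphere_subset_closedBall hx3)
    rw [hx2, hx1, ← EReal.coe_sub, EReal.coe_lt_coe_iff] at h3
    exact h3.le
  exact absurd (hc2.trans_le (const_sub_potential_le hμ F hr z))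
    (not_lt.2 (EReal.coe_le_coe_iff.2 h1))

theorem tendsto_circleAverage_dyadic {Q : ℂ → ℝ} (hQ : Continuous Q) (z : ℂ) :
    Tendsto (fun n => Real.circleAverage Q z (dyadic n)) atTop (𝓝 (Q z)) := by
  have h1 : Tendsto (Real.circleAverage Q z) (𝓝 0) (𝓝 (Q z)) := by
    have := (Real.Continuous.circleAverage (c := z) hQ).tendsto 0
    rwa [Real.circleAverage_zero] at this
  exact h1.comp tendsto_dyadic

/-- The functions `F - p_μ` for the minimizer on a neighbourhood of `K` are admissible for `K`. -/
theorem IsMinimizer.const_sub_potential_le {K L : Set ℂ} (hL : IsCompact L) {Q : ℂ → ℝ}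
    (hQ : Continuous Q) {μ : Measure ℂ} {e : ℝ} (h : IsMinimizer L Q μ e) {δ : ℝ} (hδ : 0 < δ)
    (hKL : Metric.cthickening δ K ⊆ L) {z : ℂ} (hz : z ∈ K) :
    ((e + ∫ x, Q x ∂μ : ℝ) : EReal) - potential μ z ≤ (Q z : EReal) := by
  have hc := h.isProbOn.compactlyCarried hL
  refine le_of_tendsto_of_tendsto (tendsto_const_sub_coe (tendsto_truncPotential hc z) _)
    ((continuous_coe_real_ereal.tendsto _).comp (tendsto_circleAverage_dyadic hQ z)) ?_
  filter_upwards [tendsto_dyadic.eventually (gt_mem_nhds hδ)] with n hn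
  refine EReal.coe_le_coe_iff.2 ?_
  have := h.le_circle hL hQ (dyadic_pos n) (z := z) (Metric.sphere_subset_closedBall.trans
    ((Metric.closedBall_subset_closedBall hn.le).trans
      ((Metric.closedBall_subset_cthickening hz δ).trans hKL)))
  linarith

/-- By semicontinuity `u < Q + ε` is an open condition holding on the compact `K`, hence on a
neighbourhood. It transfers competitors from `K` to the sets carrying the minimizers. -/
theorem eventually_le_on_cthickening {K : Set ℂ} (hK : IsCompact K) {Q : ℂ → ℝ}
    (hQ : Continuous Q) {u : ℂ → EReal} (hu : UpperSemicontinuous u)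
    (hle : ∀ x ∈ K, u x ≤ (Q x : EReal)) {ε : ℝ} (hε : 0 < ε) {δ : ℕ → ℝ}
    (hδ : Tendsto δ atTop (𝓝 0)) :
    ∀ᶠ n in atTop, ∀ x ∈ Metric.cthickening (δ n) K, u x ≤ ((Q x + ε : ℝ) : EReal) := by
  have hopen : IsOpen {x | u x < ((Q x + ε : ℝ) : EReal)} := by
    rw [isOpen_iff_mem_nhds]
    intro x hx
    obtain ⟨c, hc1, hc2⟩ := EReal.lt_iff_exists_real_btwn.1 hx
    have hcont : ContinuousAt (fun y => Q y + ε) x := by fun_prop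
    filter_upwards [hu x _ hc1,
      hcont.eventually (lt_mem_nhds (EReal.coe_lt_coe_iff.1 hc2))] with y hy1 hy2
    exact hy1.trans (EReal.coe_lt_coe_iff.2 hy2)
  have hsub : K ⊆ {x | u x < ((Q x + ε : ℝ) : EReal)} := fun x hx =>
    (hle x hx).trans_lt (EReal.coe_lt_coe_iff.2 (by linarith))
  obtain ⟨d, hd, hdsub⟩ := hK.exists_cthickening_subset_open hopen hsub
  filter_upwards [hδ.eventually (gt_mem_nhds hd)] with n hn x hx
  exact (hdsub (Metric.cthickening_mono hn.le K hx)).le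

/-- The distance to `K` is a continuous test function whose integrals are at most `δ n`, so the
limit measure integrates it to 0. -/
theorem isProbOn_of_tendstoWeakly {K B : Set ℂ} (hK : IsCompact K) (hne : K.Nonempty)
    {μ : ℕ → Measure ℂ} {μ' : Measure ℂ} {δ : ℕ → ℝ} (hδ0 : ∀ n, 0 ≤ δ n)
    (hδ : Tendsto δ atTop (𝓝 0)) (hμ : ∀ n, IsProbOn (Metric.cthickening (δ n) K) (μ n))
    (hB : IsCompact B) (hμ' : IsProbOn B μ') (hw : TendstoWeakly μ μ') : IsProbOn K μ' := by
  have hcont : Continuous fun x => Metric.infDist x K := Metric.continuous_infDist_pt K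
  have hzero : ∫ x, Metric.infDist x K ∂μ' = 0 := by
    refine tendsto_nhds_unique (hw.integral _ hcont) (squeeze_zero
      (fun n => integral_nonneg fun x => Metric.infDist_nonneg) (fun n => ?_) hδ)
    exact (hμ n).integral_le_of_le hK.cthickening hcont fun x hx =>
      ENNReal.toReal_le_of_le_ofReal (hδ0 n) (Metric.mem_cthickening_iff.1 hx)
  have hae := (integral_eq_zero_iff_of_nonneg (fun x => Metric.infDist_nonneg)
    ((hμ'.compactlyCarried hB).integrable hcont)).1 hzero
  refine ⟨hμ'.isProb, ?_⟩
  have : ∀ᵐ x ∂μ', x ∈ K := by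
    filter_upwards [hae] with x hx
    exact (hK.isClosed.mem_iff_infDist_zero hne).2 hx
  exact this

/-- The bounds do not depend on the minimizer, so the constants attached to the shrinking
neighbourhoods have a convergent subsequence. -/
theorem IsMinimizer.abs_le {K : Set ℂ} (hK : IsCompact K) {Q : ℂ → ℝ} (hQ : Continuous Q)
    {μ μ₀ : Measure ℂ} {e e₀ R q : ℝ} (h : IsMinimizer K Q μ e) (hR : 1 ≤ R)
    (hKR : K ⊆ Metric.closedBall 0 R) (hq : ∀ x ∈ K, |Q x| ≤ q) (hμ₀ : IsProbOn K μ₀)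
    (he₀ : Tendsto (fun n => truncEnergy (dyadic n) μ₀ μ₀) atTop (𝓝 e₀)) :
    e + ∫ x, Q x ∂μ ∈ Set.Icc (-Real.log (2 * R) - q) (e₀ + 3 * q) := by
  have h1 := h.le μ₀ hμ₀ e₀ he₀
  have h2 := ge_of_tendsto' h.tendsto fun n => le_truncEnergy hR (h.isProbOn.mono hKR) n
  have h3 := h.isProbOn.le_integral_of_le hK hQ fun x hx => (_root_.abs_le.1 (hq x hx)).1
  have h4 := hμ₀.integral_le_of_le hK hQ fun x hx => (_root_.abs_le.1 (hq x hx)).2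
  exact ⟨by linarith, by linarith⟩

/-- The weighted Green function is `F - p_μ` for a probability measure `μ` on `K`. -/
theorem exists_extremalStar_eq {K : Set ℂ} (hK : IsCompact K) {Q : ℂ → ℝ} (hQ : Continuous Q)
    {μ₀ : Measure ℂ} (hμ₀ : IsProbOn K μ₀) {A : ℝ}
    (hA : ∀ n, truncEnergy (dyadic n) μ₀ μ₀ ≤ A) :
    ∃ (μ : Measure ℂ) (F : ℝ), IsProbOn K μ ∧
      (∀ z, extremalStar K Q z = (F : EReal) - potential μ z) ∧
      ∀ᵐ x ∂μ₀, extremalStar K Q x ≤ (Q x : EReal) := by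
  have hc₀ := hμ₀.compactlyCarried hK
  have := hμ₀.isProb
  obtain ⟨e₀, -, he₀⟩ := tendsto_truncEnergy_of_le hc₀ hc₀ hA
  -- Minimizing on neighbourhoods of `K` makes room for the small circles around points of `K` that
  -- `le_circle` needs.
  set δ : ℕ → ℝ := fun n => 1 / ((n : ℝ) + 1) with hδ
  have hδpos : ∀ n, 0 < δ n := fun n => Nat.one_div_pos_of_nat
  have hδlim : Tendsto δ atTop (𝓝 0) := tendsto_one_div_add_atTop_nhds_zero_nat
  set L : ℕ → Set ℂ := fun n => Metric.cthickening (δ n) K with hLdef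
  have hL : ∀ n, IsCompact (L n) := fun n => hK.cthickening
  have hKL : ∀ n, K ⊆ L n := fun n => Metric.self_subset_cthickening K
  set B := Metric.cthickening 1 K with hBdef
  have hB : IsCompact B := hK.cthickening
  have hLB : ∀ n, L n ⊆ B := fun n => Metric.cthickening_mono
    (by rw [hδ]; exact div_le_one_of_le₀ (by linarith [Nat.cast_nonneg (α := ℝ) n]) (by positivity)) K
  choose μ e hmin using fun n => exists_isMinimizer (hL n) hQ (hμ₀.mono (hKL n)) hA
  set F : ℕ → ℝ := fun n => e n + ∫ x, Q x ∂(μ n) with hF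
  -- extraction of a limit
  obtain ⟨R₀, hR₀⟩ := hB.isBounded.subset_closedBall 0
  have hBR : B ⊆ Metric.closedBall 0 (max R₀ 1) :=
    hR₀.trans (Metric.closedBall_subset_closedBall (le_max_left _ _))
  obtain ⟨q, hq⟩ := hB.exists_bound_of_continuousOn hQ.continuousOn
  have hFb : ∀ n, F n ∈ Set.Icc (-Real.log (2 * max R₀ 1) - q) (e₀ + 3 * q) := fun n =>
    (hmin n).abs_le (hL n) hQ (le_max_right _ _) ((hLB n).trans hBR) (fun x hx => hq x (hLB n hx))
      (hμ₀.mono (hKL n)) he₀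
  obtain ⟨μ', hμ'B, φ, hφ, hweak⟩ := exists_tendstoWeakly hB μ
    fun n => (hmin n).isProbOn.mono (hLB n)
  obtain ⟨F', -, ψ, hψ, hFlim⟩ := isCompact_Icc.tendsto_subseq fun n => hFb (φ n)
  set χ : ℕ → ℕ := fun n => φ (ψ n) with hχ
  have hχm : Tendsto χ atTop atTop := hφ.tendsto_atTop.comp hψ.tendsto_atTop
  have hw : TendstoWeakly (fun n => μ (χ n)) μ' := hweak.subseq hψ
  have hFl : Tendsto (fun n => F (χ n)) atTop (𝓝 F') := hFlim
  have hμ' : IsProbOn K μ' := isProbOn_of_tendstoWeakly hK hμ₀.nonempty (fun n => (hδpos (χ n)).le)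
    (hδlim.comp hχm) (fun n => (hmin (χ n)).isProbOn) hB hμ'B hw
  have hc' := hμ'.compactlyCarried hK
  -- the squeeze
  have hlow : ∀ n z, (F (χ n) : EReal) - potential (μ (χ n)) z ≤ extremal K Q z := fun n z =>
    le_extremal (isLelong_const_sub_potential (hL _) (hmin (χ n)).isProbOn _)
      (fun x hx => (hmin (χ n)).const_sub_potential_le (hL _) hQ (hδpos _) le_rfl hx) z
  -- A competitor is at most `Q + ε` on the neighbourhoods, hence dominated by `F n + ε - p`. At a
  -- fixed truncation level the bound passes to the weak limit, and then `ε` tends to 0.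
  have hup : ∀ z, extremal K Q z ≤ (F' : EReal) - potential μ' z := by
    intro z
    refine sSup_le ?_
    rintro _ ⟨u, hu, hle, rfl⟩
    rw [const_sub_potential_eq_iInf hc']
    refine le_iInf fun k => ?_
    have hε : ∀ ε : ℝ, 0 < ε → u z ≤ ((F' + ε - truncPotential μ' (dyadic k) z : ℝ) : EReal) := by
      intro ε hε
      refine ge_of_tendsto ((continuous_coe_real_ereal.tendsto _).comp
        ((hFl.add_const ε).sub (hw.truncPotential (dyadic_pos k) z))) ?_
      filter_upwards [eventually_le_on_cthickening hK hQ hu.subharmonic.usc hle hε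
        (hδlim.comp hχm)] with n hn
      have hcn := (hmin (χ n)).isProbOn.compactlyCarried (hL _)
      refine (hu.isSubLelong.domination (hL (χ n)) (hmin (χ n)).isProbOn
        ((hmin (χ n)).truncEnergy_le (hL _)) (F := F (χ n) + ε) ?_ z).trans
        (LogPotential.const_sub_potential_le hcn _ (dyadic_pos k) z)
      filter_upwards [(hmin (χ n)).ae_le (hL _) hQ, (hmin (χ n)).isProbOn.ae_mem] with x hx1 hx2
      refine (hn x hx2).trans ?_
      rw [EReal.coe_add, EReal.coe_add]
      refine (add_le_add_left hx1 _).trans (le_of_eq ?_)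
      rw [sub_eq_add_neg, sub_eq_add_neg, add_right_comm]
    refine ge_of_tendsto (f := fun ε : ℝ => ((F' + ε - truncPotential μ' (dyadic k) z : ℝ) : EReal))
      (x := 𝓝[>] 0) ?_ (eventually_mem_nhdsWithin.mono fun ε hε' => hε ε hε')
    refine (continuous_coe_real_ereal.tendsto _).comp (tendsto_nhdsWithin_of_tendsto_nhds ?_)
    have : Continuous fun ε : ℝ => F' + ε - truncPotential μ' (dyadic k) z := by fun_prop
    simpa using this.tendsto 0
  have hae : ∀ {ν : Measure ℂ} {h : ℂ → ℝ}, HasContPotential ν h →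
      ∀ᵐ x ∂ν, extremal K Q x = (F' : EReal) - potential μ' x := fun hν =>
    hw.ae_eq hB (fun n => (hmin (χ n)).isProbOn.mono (hLB _)) hμ'B hFl hlow hup hν
  have hstar : ∀ z, extremalStar K Q z = (F' : EReal) - potential μ' z :=
    limsup_eq_const_sub_potential hc' hup fun z r hr => hae (hasContPotential_circleMeasure z hr)
  refine ⟨μ', F', hμ', hstar, ?_⟩
  -- almost everywhere bound on `K`
  obtain ⟨hfin, -, -⟩ := potential_integrable hc₀ hc₀ hA
  rw [ae_iff]
  refine le_antisymm (ENNReal.le_of_forall_pos_le_add fun ε hε _ => ?_) bot_le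
  -- On `K` the unregularized supremum is at most `Q` by definition, and it agrees with its
  -- regularization almost everywhere on a piece with continuous potential that misses mass at most
  -- `ε`.
  obtain ⟨C, -, hC, hμC, h, hh⟩ := exists_hasContPotential_restrict hc₀ hfin MeasurableSet.univ
    (NNReal.coe_pos.2 hε)
  have h1 : ∀ᵐ x ∂μ₀, ¬ extremalStar K Q x ≤ (Q x : EReal) → x ∈ Set.univ \ C := by
    filter_upwards [(ae_restrict_iff' hC.measurableSet).1 (hae hh), hμ₀.ae_mem] with x hx hxK hbad
    refine ⟨trivial, fun hxC => hbad ?_⟩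
    rw [hstar, ← hx hxC]
    exact extremal_le_of_mem hxK
  rw [zero_add]
  refine (measure_mono_ae h1).trans (hμC.trans (le_of_eq ?_))
  exact ENNReal.ofReal_coe_nnreal

/-- Constants compete in the supremum. This bound makes the potential of the equilibrium measure
finite everywhere and bounded above. -/
theorem exists_le_extremalStar {K : Set ℂ} (hK : IsCompact K) {Q : ℂ → ℝ} (hQ : Continuous Q) :
    ∃ c : ℝ, ∀ z, (c : EReal) ≤ extremalStar K Q z := by
  obtain ⟨q, hq⟩ := hK.exists_bound_of_continuousOn hQ.continuousOn
  exact ⟨-q, fun z => (le_extremal (isLelong_const (-q)) (fun x hx =>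
    EReal.coe_le_coe_iff.2 (abs_le.1 (hq x hx)).1) z).trans (extremal_le_extremalStar K Q z)⟩

/-! ### The Laplacian on test functions -/

open Laplacian

theorem laplacian_eq_zero_of_notMem_tsupport {φ : ℂ → ℝ} {x : ℂ} (hx : x ∉ tsupport φ) :
    Δ φ x = 0 := by
  have h : φ =ᶠ[𝓝 x] fun _ => (0 : ℝ) := by
    filter_upwards [(isClosed_tsupport φ).isOpen_compl.mem_nhds hx] with y hy
    exact image_eq_zero_of_notMem_tsupport hy
  rw [(InnerProductSpace.laplacian_congr_nhds h).self_of_nhds]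
  simp

theorem continuous_laplacian {φ : ℂ → ℝ} (hφ : ContDiff ℝ ∞ φ) : Continuous (Δ φ) := by
  rw [InnerProductSpace.laplacian_eq_iteratedFDeriv_complexPlane]
  have h : Continuous (iteratedFDeriv ℝ 2 φ) := hφ.continuous_iteratedFDeriv (by norm_cast)
  exact (h.eval_const _).add (h.eval_const _)

/-- A bump function equal to 1 near the support of `φ` replaces `f` by a Schwartz function without
changing either integral. -/
theorem integral_mul_laplacian {f φ : ℂ → ℝ} (hf : ContDiff ℝ ∞ f) (hφ : ContDiff ℝ ∞ φ)
    (hc : HasCompactSupport φ) : ∫ z, f z * Δ φ z = ∫ z, Δ f z * φ z := by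
  obtain ⟨R, hR⟩ := hc.isBounded.subset_ball_lt 0 0
  let χ : ContDiffBump (0 : ℂ) := ⟨R, R + 1, hR.1, by linarith⟩
  set g : ℂ → ℝ := fun z => χ z * f z with hg
  have hgc : HasCompactSupport g := χ.hasCompactSupport.mul_right
  have hgs : ContDiff ℝ ∞ g := χ.contDiff.mul hf
  have hgf : ∀ z ∈ tsupport φ, g =ᶠ[𝓝 z] f := fun z hz => by
    filter_upwards [Metric.isOpen_ball.mem_nhds (hR.2 hz)] with y hy
    have : χ y = 1 := χ.one_of_mem_closedBall (Metric.ball_subset_closedBall hy)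
    simp [hg, this]
  have key := SchwartzMap.integral_mul_laplacian_right_eq_left (μ := (volume : Measure ℂ))
    (hgc.toSchwartzMap hgs) (hc.toSchwartzMap hφ)
  simp only [SchwartzMap.laplacian_apply] at key
  have e1 : ∫ z, g z * Δ φ z = ∫ z, Δ g z * φ z := key
  have e2 : ∫ z, f z * Δ φ z = ∫ z, g z * Δ φ z := by
    congr 1
    ext z
    by_cases hz : z ∈ tsupport φ
    · rw [(hgf z hz).self_of_nhds]
    · rw [laplacian_eq_zero_of_notMem_tsupport hz, mul_zero, mul_zero]
  have e3 : ∫ z, Δ g z * φ z = ∫ z, Δ f z * φ z := by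
    congr 1
    ext z
    by_cases hz : z ∈ tsupport φ
    · rw [(InnerProductSpace.laplacian_congr_nhds (hgf z hz)).self_of_nhds]
    · rw [image_eq_zero_of_notMem_tsupport hz, mul_zero, mul_zero]
  rw [e2, e1, e3]

/-- The smoothed logarithm `log (|z - w|² + ε) / 2`. -/
def smoothLog (ε : ℝ) (w z : ℂ) : ℝ := 1 / 2 * Real.log (‖z - w‖ ^ 2 + ε)

theorem contDiff_smoothLog {ε : ℝ} (hε : 0 < ε) (w : ℂ) : ContDiff ℝ ∞ (smoothLog ε w) := by
  refine contDiff_const.mul (ContDiff.log ?_ fun z => by positivity)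
  exact ((contDiff_id.sub contDiff_const).norm_sq ℝ).add contDiff_const

theorem hasFDerivAt_normSq_sub (w z : ℂ) :
    HasFDerivAt (fun z : ℂ => ‖z - w‖ ^ 2) (2 • innerSL ℝ (z - w)) z := by
  have h := (hasStrictFDerivAt_norm_sq (z - w)).hasFDerivAt.comp z
    ((hasFDerivAt_id (𝕜 := ℝ) z).sub_const w)
  simpa [Function.comp_def] using h

theorem fderiv_smoothLog {ε : ℝ} (hε : 0 < ε) (w : ℂ) :
    fderiv ℝ (smoothLog ε w) = fun z => (‖z - w‖ ^ 2 + ε)⁻¹ • innerSL ℝ (z - w) := by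
  ext1 z
  have hne : ‖z - w‖ ^ 2 + ε ≠ 0 := by positivity
  have h := ((((hasFDerivAt_normSq_sub w z).add_const ε).log hne).const_mul (1 / 2 : ℝ)).fderiv
  refine h.trans ?_
  ext v
  simp
  ring

theorem laplacian_smoothLog {ε : ℝ} (hε : 0 < ε) (w z : ℂ) :
    Δ (smoothLog ε w) z = 2 * ε / (‖z - w‖ ^ 2 + ε) ^ 2 := by
  have hne : ‖z - w‖ ^ 2 + ε ≠ 0 := by positivity
  have h1 : HasFDerivAt (fun z : ℂ => (‖z - w‖ ^ 2 + ε)⁻¹)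
      (-((‖z - w‖ ^ 2 + ε) ^ 2)⁻¹ • (2 • innerSL ℝ (z - w))) z :=
    (hasDerivAt_inv hne).comp_hasFDerivAt z ((hasFDerivAt_normSq_sub w z).add_const ε)
  let B : ℂ →L[ℝ] ℂ →L[ℝ] ℝ := innerSL ℝ
  have h2 : HasFDerivAt (fun z : ℂ => B (z - w)) B z :=
    B.hasFDerivAt.comp z ((hasFDerivAt_id (𝕜 := ℝ) z).sub_const w)
  have h3 : fderiv ℝ (fun z => (‖z - w‖ ^ 2 + ε)⁻¹ • innerSL ℝ (z - w)) z =
      (‖z - w‖ ^ 2 + ε)⁻¹ • B +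
        (-((‖z - w‖ ^ 2 + ε) ^ 2)⁻¹ • 2 • innerSL ℝ (z - w)).smulRight (innerSL ℝ (z - w)) :=
    (h1.smul h2).fderiv
  have hB : ∀ v v', B v v' = inner ℝ v v' := fun _ _ => rfl
  rw [InnerProductSpace.laplacian_eq_iteratedFDeriv_complexPlane]
  simp only [iteratedFDeriv_two_apply, fderiv_smoothLog hε w]
  rw [h3]
  have hn : ‖z - w‖ ^ 2 = (z - w).re ^ 2 + (z - w).im ^ 2 := by
    rw [← Complex.normSq_eq_norm_sq, Complex.normSq_apply]; ring
  simp [Complex.inner, hB]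
  rw [hn] at hne ⊢
  simp only [Complex.sub_re, Complex.sub_im] at hne ⊢
  field_simp
  ring

theorem integrable_poisson : Integrable fun z : ℂ => 2 / (1 + ‖z‖ ^ 2) ^ 2 := by
  have h := (integrable_rpow_neg_one_add_norm_sq (E := ℂ) (μ := volume) (r := 4)
    (by rw [Complex.finrank_real_complex]; norm_num)).const_mul 2
  refine h.congr (ae_of_all _ fun z => ?_)
  have : (1 + ‖z‖ ^ 2 : ℝ) ^ (-4 / 2 : ℝ) = ((1 + ‖z‖ ^ 2) ^ 2)⁻¹ := by
    rw [show (-4 / 2 : ℝ) = -(2 : ℕ) by norm_num, Real.rpow_neg (by positivity), Real.rpow_natCast]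
  dsimp only
  rw [this, div_eq_mul_inv]

/-- Polar coordinates, with antiderivative `-(1 + y ^ 2)⁻¹`. The value is the normalizing factor in
`IsDdc`. -/
theorem integral_poisson : ∫ z : ℂ, 2 / (1 + ‖z‖ ^ 2) ^ 2 = 2 * Real.pi := by
  have hball : (volume : Measure ℂ).real (Metric.ball 0 1) = Real.pi := by
    simp [Measure.real, Complex.volume_ball]
  have h := integral_fun_norm_addHaar (volume : Measure ℂ) (fun y : ℝ => 2 / (1 + y ^ 2) ^ 2)
  rw [h, Complex.finrank_real_complex, hball]
  have hd : ∀ x : ℝ, HasDerivAt (fun y : ℝ => -(1 + y ^ 2)⁻¹) (x * (2 / (1 + x ^ 2) ^ 2)) x := by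
    intro x
    have hne : (1 + x ^ 2 : ℝ) ≠ 0 := by positivity
    have h1 : HasDerivAt (fun y : ℝ => 1 + y ^ 2) (2 * x) x := by
      simpa using (hasDerivAt_pow 2 x).const_add 1
    have h2 : HasDerivAt (fun y : ℝ => -(1 + y ^ 2)⁻¹) (-(-(2 * x) / (1 + x ^ 2) ^ 2)) x :=
      (h1.inv hne).neg
    convert h2 using 1
    ring
  have hlim : Tendsto (fun y : ℝ => -(1 + y ^ 2)⁻¹) atTop (𝓝 0) := by
    rw [← neg_zero]
    refine (tendsto_inv_atTop_zero.comp ?_).neg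
    exact tendsto_atTop_add_const_left _ _ (tendsto_pow_atTop two_ne_zero)
  have hint := integrableOn_Ioi_deriv_of_nonneg' (fun x _ => hd x)
    (fun x (hx : x ∈ Set.Ioi (0 : ℝ)) => by have : 0 < x := hx; positivity) hlim
  have := integral_Ioi_of_hasDerivAt_of_tendsto (hd 0).continuousAt.continuousWithinAt
    (fun x _ => hd x) hint hlim
  simp only [Nat.reduceSub, pow_one, smul_eq_mul, nsmul_eq_mul]
  rw [this]
  simp

/-- Translation by `w` and scaling by `δ` turn the Laplacian into one fixed density, so these
Laplacians form an approximate identity at `w`. -/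
theorem integral_laplacian_smoothLog_mul {δ : ℝ} (hδ : 0 < δ) (φ : ℂ → ℝ) (w : ℂ) :
    ∫ z, Δ (smoothLog (δ ^ 2) w) z * φ z = ∫ z : ℂ, 2 / (1 + ‖z‖ ^ 2) ^ 2 * φ (w + δ • z) := by
  simp only [laplacian_smoothLog (pow_pos hδ 2)]
  have e1 : ∫ z, 2 * δ ^ 2 / (‖z - w‖ ^ 2 + δ ^ 2) ^ 2 * φ z =
      ∫ z, 2 * δ ^ 2 / (‖z‖ ^ 2 + δ ^ 2) ^ 2 * φ (w + z) := by
    have h := integral_sub_right_eq_self (μ := (volume : Measure ℂ))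
      (fun z => 2 * δ ^ 2 / (‖z‖ ^ 2 + δ ^ 2) ^ 2 * φ (w + z)) w
    simp only [add_sub_cancel] at h
    exact h
  have e2 := Measure.integral_comp_smul (volume : Measure ℂ)
    (fun z => 2 * δ ^ 2 / (‖z‖ ^ 2 + δ ^ 2) ^ 2 * φ (w + z)) δ
  rw [Complex.finrank_real_complex, abs_of_pos (by positivity), smul_eq_mul] at e2
  rw [e1, ← mul_inv_cancel_left₀ (pow_ne_zero 2 hδ.ne') (∫ z, _), ← e2, ← integral_const_mul]
  congr 1
  ext z
  rw [norm_smul, Real.norm_of_nonneg hδ.le]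
  have : (1 + ‖z‖ ^ 2) ≠ 0 := by positivity
  field_simp
  ring

theorem abs_integral_smoothLog_le {δ : ℝ} (hδ : 0 < δ) {φ : ℂ → ℝ} (hφ : ContDiff ℝ ∞ φ)
    (hc : HasCompactSupport φ) {C : ℝ} (hC : ∀ z, |φ z| ≤ C) (w : ℂ) :
    |∫ z, smoothLog (δ ^ 2) w z * Δ φ z| ≤ 2 * Real.pi * C := by
  rw [integral_mul_laplacian (contDiff_smoothLog (pow_pos hδ 2) w) hφ hc,
    integral_laplacian_smoothLog_mul hδ, ← integral_poisson, ← integral_mul_const]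
  rw [← Real.norm_eq_abs]
  refine norm_integral_le_of_norm_le (integrable_poisson.mul_const C) (ae_of_all _ fun z => ?_)
  rw [norm_mul, Real.norm_of_nonneg (by positivity)]
  exact mul_le_mul_of_nonneg_left (hC _) (by positivity)

theorem tendsto_integral_smoothLog {φ : ℂ → ℝ} (hφ : ContDiff ℝ ∞ φ) (hc : HasCompactSupport φ)
    (w : ℂ) : Tendsto (fun n => ∫ z, smoothLog (dyadic n ^ 2) w z * Δ φ z) atTop
      (𝓝 (2 * Real.pi * φ w)) := by
  obtain ⟨C, hC⟩ := hφ.continuous.bounded_above_of_compact_support hc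
  rw [← integral_poisson, ← integral_mul_const]
  simp only [integral_mul_laplacian (contDiff_smoothLog (pow_pos (dyadic_pos _) 2) w) hφ hc,
    integral_laplacian_smoothLog_mul (dyadic_pos _)]
  refine tendsto_integral_of_dominated_convergence (fun z => 2 / (1 + ‖z‖ ^ 2) ^ 2 * C)
    (fun n => ?_) (integrable_poisson.mul_const C) (fun n => ae_of_all _ fun z => ?_)
    (ae_of_all _ fun z => ?_)
  · refine integrable_poisson.aestronglyMeasurable.mul ?_
    have := hφ.continuous
    exact Continuous.aestronglyMeasurable (by fun_prop)
  · rw [norm_mul, Real.norm_of_nonneg (by positivity)]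
    exact mul_le_mul_of_nonneg_left (hC _) (by positivity)
  · refine Tendsto.const_mul _ ?_
    have h1 : Tendsto (fun n => w + dyadic n • z) atTop (𝓝 (w + (0 : ℝ) • z)) :=
      (tendsto_dyadic.smul_const z).const_add w
    rw [zero_smul, add_zero] at h1
    exact (hφ.continuous.tendsto w).comp h1

theorem continuous_smoothLog_prod {ε : ℝ} (hε : 0 < ε) :
    Continuous fun p : ℂ × ℂ => smoothLog ε p.2 p.1 := by
  refine continuous_const.mul (Continuous.log (by fun_prop) fun p => ?_)
  positivity

theorem smoothLog_mono {ε ε' : ℝ} (hε : 0 < ε) (h : ε ≤ ε') (w z : ℂ) :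
    smoothLog ε w z ≤ smoothLog ε' w z :=
  mul_le_mul_of_nonneg_left (Real.log_le_log (by positivity) (by linarith)) (by norm_num)

theorem monotone_neg_smoothLog (w z : ℂ) : Monotone fun n => -smoothLog (dyadic n ^ 2) w z :=
  fun _ n h => neg_le_neg (smoothLog_mono (pow_pos (dyadic_pos n) 2)
    (pow_le_pow_left₀ (dyadic_pos n).le (dyadic_anti h) 2) w z)

theorem tendsto_neg_smoothLog (w z : ℂ) :
    Tendsto (fun n => ((-smoothLog (dyadic n ^ 2) w z : ℝ) : EReal)) atTop
      (𝓝 (-ENNReal.log (edist z w))) := by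
  by_cases h : z = w
  · subst h
    refine (tendsto_truncKernel z z).congr fun n => ?_
    congr 1
    rw [truncKernel_of_ge (by simpa using (dyadic_pos n).le), smoothLog]
    simp
  · have h0 : 0 < ‖z - w‖ := norm_pos_iff.2 (sub_ne_zero.2 h)
    rw [edist_dist, ENNReal.log_ofReal, dist_eq_norm, if_neg h0.not_ge, ← EReal.coe_neg]
    refine (continuous_coe_real_ereal.tendsto _).comp ?_
    have h1 : Tendsto (fun n => ‖z - w‖ ^ 2 + dyadic n ^ 2) atTop (𝓝 (‖z - w‖ ^ 2 + 0 ^ 2)) :=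
      (tendsto_dyadic.pow 2).const_add _
    rw [zero_pow two_ne_zero, add_zero] at h1
    have h2 := ((h1.log (by positivity)).const_mul (1 / 2 : ℝ)).neg
    rw [Real.log_pow] at h2
    have e : Real.log ‖z - w‖ = 1 / 2 * ((2 : ℕ) * Real.log ‖z - w‖) := by push_cast; ring
    rw [e]
    exact h2

/-- A bounded-below function `F - p_μ` has distributional `dd^c` equal to `μ`. -/
theorem isDdc_const_sub_potential {K : Set ℂ} (hK : IsCompact K) {μ : Measure ℂ}
    (hμ : IsProbOn K μ) {F c : ℝ} (hlow : ∀ z, (c : EReal) ≤ (F : EReal) - potential μ z) :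
    IsDdc (fun z => (F : EReal) - potential μ z) μ := by
  have hc := hμ.compactlyCarried hK
  have := hμ.isProb
  set p : ℂ → ℝ := fun z => (potential μ z).toReal with hp
  have hreal : ∀ z, potential μ z = (p z : EReal) := fun z => by
    refine (EReal.coe_toReal (fun htop => ?_) (potential_ne_bot hc z)).symm
    have := hlow z
    rw [htop, sub_eq_add_neg, EReal.neg_top, EReal.add_bot] at this
    simp at this
  have hple : ∀ z, p z ≤ F - c := fun z => by
    have := hlow z
    rw [hreal, ← EReal.coe_sub, EReal.coe_le_coe_iff] at this
    linarith
  have hpm : Measurable p := (measurable_potential hc).ereal_toReal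
  have htoReal : ∀ z, ((F : EReal) - potential μ z).toReal = F - p z := fun z => by
    rw [hreal, ← EReal.coe_sub, EReal.toReal_coe]
  have hcont1 := continuous_truncPotential hc one_pos
  have hp1 : ∀ z, truncPotential μ 1 z ≤ p z := fun z => by
    have := truncPotential_le_potential_of_pos hc one_pos z
    rw [hreal] at this
    exact EReal.coe_le_coe_iff.1 this
  refine ⟨ae_of_all _ fun z => ?_, ?_, inferInstance, fun φ hφ hcφ => ?_⟩
  · rw [hreal, ← EReal.coe_sub]
    exact ⟨EReal.coe_ne_bot _, EReal.coe_ne_top _⟩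
  · simp only [htoReal]
    have hb : Continuous fun z => |c| + |F - truncPotential μ 1 z| := by fun_prop
    refine hb.locallyIntegrable.mono (measurable_const.sub hpm).aestronglyMeasurable
      (ae_of_all _ fun z => ?_)
    rw [Real.norm_eq_abs, Real.norm_of_nonneg (by positivity)]
    refine abs_le.2 ⟨?_, ?_⟩
    · linarith [hple z, neg_abs_le c, abs_nonneg (F - truncPotential μ 1 z)]
    · linarith [hp1 z, abs_nonneg c, le_abs_self (F - truncPotential μ 1 z)]
  · simp only [htoReal]
    have hΔ := continuous_laplacian hφ
    have hΔ0 : ∀ z ∉ tsupport φ, Δ φ z = 0 := fun z hz => laplacian_eq_zero_of_notMem_tsupport hz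
    have hT : IsCompact (tsupport φ) := hcφ
    set τ : Measure ℂ := volume.restrict (tsupport φ) with hτ
    have hτc : CompactlyCarried τ :=
      ⟨⟨by rw [hτ, Measure.restrict_apply_univ]; exact hT.measure_lt_top⟩, tsupport φ, hT,
        by rw [hτ, Measure.restrict_apply hT.measurableSet.compl]; simp⟩
    have hτint : ∀ f : ℂ → ℝ, ∫ z, f z * Δ φ z = ∫ z, f z * Δ φ z ∂τ := fun f =>
      (setIntegral_eq_integral_of_forall_compl_eq_zero fun z hz => by
        rw [hΔ0 z hz, mul_zero]).symm
    have hτf := hτc.finite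
    -- the regularized potentials
    set L : ℕ → ℂ → ℝ := fun n z => ∫ w, smoothLog (dyadic n ^ 2) w z ∂μ with hL
    have hsc : ∀ n z, Continuous fun w => smoothLog (dyadic n ^ 2) w z := fun n z =>
      (continuous_smoothLog_prod (pow_pos (dyadic_pos n) 2)).comp
        (by fun_prop : Continuous fun w : ℂ => (z, w))
    have hLlim' : ∀ z, Tendsto (fun n => ((-L n z : ℝ) : EReal)) atTop (𝓝 (potential μ z)) := by
      intro z
      have h1 := tendsto_eintegral_of_monotone (ν := μ)
        (f := fun n w => -smoothLog (dyadic n ^ 2) w z) (g := fun w => -ENNReal.log (edist z w))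
        (fun n => hc.integrable (hsc n z).neg) (fun w => monotone_neg_smoothLog w z)
        (fun w => tendsto_neg_smoothLog w z)
      simp only [integral_neg] at h1
      exact h1
    have hLlim : ∀ z, Tendsto (fun n => L n z) atTop (𝓝 (-p z)) := fun z => by
      have h1 := hLlim' z
      rw [hreal z] at h1
      simpa using (EReal.tendsto_coe.1 h1).neg
    have hLanti : ∀ z, Antitone fun n => L n z := fun z m n h =>
      integral_mono (hc.integrable (hsc n z)) (hc.integrable (hsc m z)) fun w =>
        neg_le_neg_iff.1 (monotone_neg_smoothLog w z h)
    have hLge : ∀ n z, -p z ≤ L n z := fun n z => (hLanti z).le_of_tendsto (hLlim z) n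
    -- On the support of `φ` the decreasing `L n` lie between `-p ≥ c - F` and `L 0 ≤ C₀`, which
    -- supplies the dominating function for `hLft`.
    obtain ⟨C₀, hC₀⟩ := (hT.prod hK).exists_bound_of_continuousOn
      (continuous_smoothLog_prod (pow_pos (dyadic_pos 0) 2)).continuousOn
    have hL0 : ∀ z ∈ tsupport φ, L 0 z ≤ C₀ := fun z hz =>
      hμ.integral_le_of_le hK (hsc 0 z) fun w hw => (abs_le.1 (hC₀ (z, w) ⟨hz, hw⟩)).2
    have hswap : ∀ n, ∫ z, L n z * Δ φ z =
        ∫ w, (∫ z, smoothLog (dyadic n ^ 2) w z * Δ φ z) ∂μ := by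
      intro n
      have hcp : Continuous fun p : ℂ × ℂ => smoothLog (dyadic n ^ 2) p.2 p.1 * Δ φ p.1 :=
        (continuous_smoothLog_prod (pow_pos (dyadic_pos n) 2)).mul (hΔ.comp continuous_fst)
      have h1 := integral_integral_swap (μ := τ) (ν := μ)
        (f := fun z w => smoothLog (dyadic n ^ 2) w z * Δ φ z) (hτc.integrable_prod hc hcp)
      rw [hτint]
      simp only [hτint, hL, ← integral_mul_const]
      exact h1
    have hR : Tendsto (fun n => ∫ z, L n z * Δ φ z) atTop (𝓝 (∫ w, 2 * Real.pi * φ w ∂μ)) := by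
      simp only [hswap]
      obtain ⟨C, hC⟩ := hφ.continuous.bounded_above_of_compact_support hcφ
      refine tendsto_integral_of_dominated_convergence (fun _ => 2 * Real.pi * C) (fun n => ?_)
        (integrable_const _) (fun n => ae_of_all _ fun w =>
          abs_integral_smoothLog_le (dyadic_pos n) hφ hcφ hC w)
        (ae_of_all _ fun w => tendsto_integral_smoothLog hφ hcφ w)
      have hcp : Continuous fun p : ℂ × ℂ => smoothLog (dyadic n ^ 2) p.1 p.2 * Δ φ p.2 :=
        ((continuous_smoothLog_prod (pow_pos (dyadic_pos n) 2)).comp continuous_swap).mul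
          (hΔ.comp continuous_snd)
      simp only [hτint]
      exact (hcp.stronglyMeasurable.integral_prod_right (ν := τ)).aestronglyMeasurable
    have hLft : Tendsto (fun n => ∫ z, L n z * Δ φ z) atTop (𝓝 (∫ z, -p z * Δ φ z)) := by
      simp only [hτint]
      refine tendsto_integral_of_dominated_convergence
        (fun z => (|F - c| + |C₀|) * |Δ φ z|) (fun n => ?_) (hτc.integrable (by fun_prop))
        (fun n => ?_) (ae_of_all _ fun z => (hLlim z).mul_const _)
      · have hcp := (continuous_smoothLog_prod (pow_pos (dyadic_pos n) 2)).stronglyMeasurable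
        exact ((hcp.integral_prod_right (ν := μ)).mul hΔ.stronglyMeasurable).aestronglyMeasurable
      · filter_upwards [ae_restrict_mem hT.measurableSet] with z hz
        rw [norm_mul]
        refine mul_le_mul_of_nonneg_right (abs_le.2 ⟨?_, ?_⟩) (norm_nonneg _)
        · linarith [hLge n z, hple z, le_abs_self (F - c), abs_nonneg C₀]
        · linarith [hLanti z (Nat.zero_le n), hL0 z hz, le_abs_self C₀, abs_nonneg (F - c)]
    have hconst : ∫ z, F * Δ φ z = 0 := by
      rw [integral_mul_laplacian contDiff_const hφ hcφ]
      simp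
    have hpint : Integrable (fun z => -p z * Δ φ z) τ := by
      refine Integrable.mono' (g := fun z => (|F - c| + |truncPotential μ 1 z|) * |Δ φ z|)
        (hτc.integrable (by fun_prop))
        (hpm.neg.mul hΔ.measurable).aestronglyMeasurable (ae_of_all _ fun z => ?_)
      rw [norm_mul]
      refine mul_le_mul_of_nonneg_right (abs_le.2 ⟨?_, ?_⟩) (norm_nonneg _)
      · linarith [hple z, le_abs_self (F - c), abs_nonneg (truncPotential μ 1 z)]
      · linarith [hp1 z, neg_abs_le (truncPotential μ 1 z), abs_nonneg (F - c)]
    have hfin := tendsto_nhds_unique hLft hR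
    rw [integral_const_mul] at hfin
    rw [← hfin]
    have hsum : ∫ z, (F - p z) * Δ φ z =
        (∫ z, F * Δ φ z) + ∫ z, -p z * Δ φ z := by
      rw [hτint (fun z => F - p z), hτint (fun _ => F), hτint fun z => -p z,
        ← integral_add (hτc.integrable (by fun_prop)) hpint]
      congr 1
      ext z
      ring
    rw [hsum, hconst, zero_add]

/-! ### Uniqueness of the measure -/

/-- If a smooth `f` with values in [0, 1] has support exactly the bounded open set `s`, then `1 - (1
- f) ^ n` are test functions converging to the indicator of `s`. Open sets form a generating
π-system. -/
theorem measure_eq_of_integral_eq {μ ν : Measure ℂ} [IsLocallyFiniteMeasure μ]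
    [IsLocallyFiniteMeasure ν]
    (h : ∀ φ : ℂ → ℝ, ContDiff ℝ ∞ φ → HasCompactSupport φ → ∫ z, φ z ∂μ = ∫ z, φ z ∂ν) :
    μ = ν := by
  have hfin : ∀ {η : Measure ℂ} [IsLocallyFiniteMeasure η] {s : Set ℂ}, Bornology.IsBounded s →
      η s < ⊤ := fun hs => hs.measure_lt_top
  have hbdd : ∀ s : Set ℂ, IsOpen s → Bornology.IsBounded s → μ s = ν s := by
    intro s hs hsb
    obtain ⟨f, hfs, hf, hfr⟩ := hs.exists_contDiff_support_eq (n := ⊤)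
    have hf01 : ∀ x, f x ∈ Set.Icc (0 : ℝ) 1 := fun x => hfr ⟨x, rfl⟩
    have hf0 : ∀ x ∉ s, f x = 0 := fun x hx => by
      rwa [← Function.notMem_support, hfs]
    set g : ℕ → ℂ → ℝ := fun n x => 1 - (1 - f x) ^ n with hg
    have hgs : ∀ n, ContDiff ℝ ∞ (g n) := fun n =>
      contDiff_const.sub ((contDiff_const.sub hf).pow n)
    have hg0 : ∀ n, ∀ x ∉ s, g n x = 0 := fun n x hx => by simp [hg, hf0 x hx]
    have hgc : ∀ n, HasCompactSupport (g n) := fun n =>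
      HasCompactSupport.intro hsb.isCompact_closure fun x hx => hg0 n x fun h => hx (subset_closure h)
    have hlim : ∀ {η : Measure ℂ} [IsLocallyFiniteMeasure η],
        Tendsto (fun n => ∫ x, g n x ∂η) atTop (𝓝 (η.real s)) := by
      intro η _
      rw [← integral_indicator_one hs.measurableSet]
      refine tendsto_integral_of_dominated_convergence (s.indicator 1)
        (fun n => (hgs n).continuous.aestronglyMeasurable) ?_
        (fun n => ae_of_all _ fun x => ?_) (ae_of_all _ fun x => ?_)
      · exact (integrable_indicator_iff hs.measurableSet).2
          (integrableOn_const (hfin hsb).ne)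
      · by_cases hx : x ∈ s
        · rw [Set.indicator_of_mem hx, Pi.one_apply]
          have h1 := (hf01 x).1
          have h2 := (hf01 x).2
          have h3 : 0 ≤ (1 - f x) ^ n := pow_nonneg (by linarith) n
          have h4 : (1 - f x) ^ n ≤ 1 := pow_le_one₀ (by linarith) (by linarith)
          exact abs_le.2 ⟨by simp only [hg]; linarith, by simp only [hg]; linarith⟩
        · simp [hg0 n x hx, hx]
      · by_cases hx : x ∈ s
        · rw [Set.indicator_of_mem hx, Pi.one_apply]
          have hpos : 0 < f x := lt_of_le_of_ne (hf01 x).1 fun h0 => by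
            rw [← hfs, Function.mem_support] at hx
            exact hx h0.symm
          have := (tendsto_pow_atTop_nhds_zero_of_lt_one (by linarith [(hf01 x).2])
            (by linarith : 1 - f x < 1)).const_sub 1
          simpa [hg] using this
        · simp [hg0 _ x hx, hx]
    have h1 : μ.real s = ν.real s := by
      refine tendsto_nhds_unique hlim ?_
      simp only [h _ (hgs _) (hgc _)]
      exact hlim
    exact (ENNReal.toReal_eq_toReal_iff' (hfin hsb).ne (hfin hsb).ne).1 h1
  have hopen : ∀ s : Set ℂ, IsOpen s → μ s = ν s := by
    intro s hs
    have hmono : Monotone fun n : ℕ => s ∩ Metric.ball 0 (n : ℝ) := fun m n h =>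
      Set.inter_subset_inter_right _ (Metric.ball_subset_ball (Nat.cast_le.2 h))
    have hU : ⋃ n : ℕ, s ∩ Metric.ball 0 (n : ℝ) = s := by
      rw [← Set.inter_iUnion, Metric.iUnion_ball_nat, Set.inter_univ]
    have hμs := tendsto_measure_iUnion_atTop (μ := μ) hmono
    have hνs := tendsto_measure_iUnion_atTop (μ := ν) hmono
    rw [hU] at hμs hνs
    refine tendsto_nhds_unique hμs (hνs.congr fun n => ?_)
    exact (hbdd _ (hs.inter Metric.isOpen_ball) (Metric.isBounded_ball.subset Set.inter_subset_right)).symm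
  refine Measure.ext_of_generateFrom_of_iUnion {s | IsOpen s} (fun n : ℕ => Metric.ball 0 (n : ℝ))
    (BorelSpace.measurable_eq (α := ℂ)) isPiSystem_isOpen (Metric.iUnion_ball_nat 0)
    (fun n => show IsOpen (Metric.ball (0 : ℂ) (n : ℝ)) from Metric.isOpen_ball) (fun n => (hfin Metric.isBounded_ball).ne) hopen

theorem IsDdc.unique {u : ℂ → EReal} {μ ν : Measure ℂ} (hμ : IsDdc u μ) (hν : IsDdc u ν) :
    μ = ν := by
  have := hμ.locallyFinite
  have := hν.locallyFinite
  refine measure_eq_of_integral_eq fun φ hφ hc => ?_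
  have h := (hμ.integral_eq φ hφ hc).symm.trans (hν.integral_eq φ hφ hc)
  exact mul_left_cancel₀ (by positivity) h

theorem IsDdc.ddc_eq {u : ℂ → EReal} {μ : Measure ℂ} (hμ : IsDdc u μ) : ddc u = μ := by
  have h : ∃ μ, IsDdc u μ := ⟨μ, hμ⟩
  rw [ddc, dif_pos h]
  exact h.choose_spec.unique hμ

/-! ### Decreasing sequences of weights -/

theorem extremalStar_congr {K : Set ℂ} {Q Q' : ℂ → ℝ} (h : ∀ x ∈ K, Q x = Q' x) :
    extremalStar K Q = extremalStar K Q' :=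
  funext fun z => le_antisymm (extremalStar_mono (fun x hx => (h x hx).le) z)
    (extremalStar_mono (fun x hx => (h x hx).ge) z)

theorem eintegral_potential_comm {μ ν : Measure ℂ} (hμ : CompactlyCarried μ)
    (hν : CompactlyCarried ν) : eintegral μ (potential ν) = eintegral ν (potential μ) :=
  tendsto_nhds_unique (tendsto_truncEnergy hμ hν) <| (tendsto_truncEnergy hν hμ).congr fun n => by
    rw [truncEnergy_comm hν hμ (dyadic_pos n)]

/-- The structure theorem for weights that are only continuous on `K`. -/
theorem exists_extremalStar_eq_of_continuousOn {K : Set ℂ} (hK : IsCompact K) {Q : ℂ → ℝ}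
    (hQ : ContinuousOn Q K) {μ₀ : Measure ℂ} (hμ₀ : IsProbOn K μ₀) {A : ℝ}
    (hA : ∀ n, truncEnergy (dyadic n) μ₀ μ₀ ≤ A) :
    ∃ (μ : Measure ℂ) (F c : ℝ), IsProbOn K μ ∧
      (∀ z, extremalStar K Q z = (F : EReal) - potential μ z) ∧
      (∀ z, (c : EReal) ≤ (F : EReal) - potential μ z) ∧
      ∀ᵐ x ∂μ₀, extremalStar K Q x ≤ (Q x : EReal) := by
  -- Tietze extension is harmless, since the extremal function sees the weight only on `K`.
  obtain ⟨g, hg⟩ := ContinuousMap.exists_restrict_eq hK.isClosed ⟨K.domRestrict Q, hQ.domRestrict⟩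
  have hgQ : ∀ x ∈ K, Q x = g x := fun x hx => (DFunLike.congr_fun hg ⟨x, hx⟩).symm
  obtain ⟨μ, F, hμ, heq, hle⟩ := exists_extremalStar_eq hK g.continuous hμ₀ hA
  obtain ⟨c, hc⟩ := exists_le_extremalStar hK g.continuous
  rw [extremalStar_congr hgQ]
  refine ⟨μ, F, c, hμ, heq, fun z => heq z ▸ hc z, ?_⟩
  filter_upwards [hle, hμ₀.ae_mem] with x hx hxK
  rwa [hgQ x hxK]

/-- If continuous weights decrease to `-p_μ` on `K`, the weighted Green functions decrease to `-p_μ`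
on the whole plane. -/
theorem tendsto_extremalStar {K : Set ℂ} (hK : IsCompact K) {μ : Measure ℂ} (hμ : IsProbOn K μ)
    {A : ℝ} (hA : ∀ n, truncEnergy (dyadic n) μ μ ≤ A) {Q : ℕ → ℂ → ℝ}
    (hQ : ∀ j, ContinuousOn (Q j) K) (hanti : ∀ z ∈ K, Antitone fun j => Q j z)
    (hlim : ∀ z ∈ K, Tendsto (fun j => (Q j z : EReal)) atTop (𝓝 (-potential μ z))) (z : ℂ) :
    Tendsto (fun j => extremalStar K (Q j) z) atTop (𝓝 (-potential μ z)) := by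
  have hmono : Antitone fun j => extremalStar K (Q j) := fun i j hij z =>
    extremalStar_mono (fun x hx => hanti x hx hij) z
  have hsub : ∀ j, IsSubLelong (extremalStar K (Q j)) := fun j => by
    obtain ⟨ν, F, -, hν, heq, -⟩ := exists_extremalStar_eq_of_continuousOn hK (hQ j) hμ hA
    rw [funext heq]
    exact (isLelong_const_sub_potential hK hν F).isSubLelong
  -- The limit `-p_μ` lies in the Lelong class and below each weight on `K`, so it competes in each
  -- supremum.
  have hge : ∀ j z, -potential μ z ≤ extremalStar K (Q j) z := fun j z => by
    have hL := isLelong_const_sub_potential hK hμ 0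
    simp only [EReal.coe_zero, zero_sub] at hL
    refine (le_extremal hL (fun x hx => ?_) z).trans (extremal_le_extremalStar K (Q j) z)
    have hm : Antitone fun j => (Q j x : EReal) := fun i j hij =>
      EReal.coe_le_coe_iff.2 (hanti x hx hij)
    exact hm.le_of_tendsto (hlim x hx) j
  -- The bounds by `Q j` fail only on a `μ`-null set, common to all `j`; domination for `μ` removes
  -- the exception.
  have hle : ∀ z, ⨅ j, extremalStar K (Q j) z ≤ -potential μ z := fun z => by
    have h := (IsSubLelong.iInf hsub hmono).domination hK hμ hA (F := 0) ?_ z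
    · simpa using h
    · have hae : ∀ᵐ x ∂μ, ∀ j, extremalStar K (Q j) x ≤ (Q j x : EReal) := ae_all_iff.2 fun j => by
        obtain ⟨-, -, -, -, -, -, h⟩ := exists_extremalStar_eq_of_continuousOn hK (hQ j) hμ hA
        exact h
      filter_upwards [hae, hμ.ae_mem] with x hx hxK
      rw [EReal.coe_zero, zero_sub]
      exact ge_of_tendsto' (hlim x hxK) fun j => (iInf_le _ j).trans (hx j)
  rw [(le_antisymm (le_iInf fun j => hge j z) (hle z) :
    -potential μ z = ⨅ j, extremalStar K (Q j) z)]
  exact tendsto_atTop_iInf fun i j hij => hmono hij z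

/-- If the potentials `P j` of probability measures `ν j` on `K` satisfy `P j - F j ↑ p_μ`, then
`F j → 0` and the energies converge. -/
theorem tendsto_of_monotone_potential {K : Set ℂ} (hK : IsCompact K) {μ : Measure ℂ}
    (hμ : IsProbOn K μ) {e : ℝ} (he : energy μ = e) {ν : ℕ → Measure ℂ}
    (hν : ∀ j, IsProbOn K (ν j)) {P : ℕ → ℂ → ℝ} (hP : ∀ j z, potential (ν j) z = (P j z : EReal))
    {F C : ℕ → ℝ} (hC : ∀ j z, P j z ≤ C j) (hmono : ∀ z, Monotone fun j => P j z - F j)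
    (hlim : ∀ z, Tendsto (fun j => ((P j z - F j : ℝ) : EReal)) atTop (𝓝 (potential μ z))) :
    (∀ j, Integrable (P j) (ν j)) ∧ Tendsto F atTop (𝓝 0) ∧
      Tendsto (fun j => ∫ z, P j z ∂ν j) atTop (𝓝 e) := by
  have hμc := hμ.compactlyCarried hK
  have hνc := fun j => (hν j).compactlyCarried hK
  have hμp := hμ.isProb
  have hνp := fun j => (hν j).isProb
  have hPint : ∀ {η : Measure ℂ}, CompactlyCarried η → IsProbabilityMeasure η →
      ∀ j, Integrable (P j) η := by
    intro η hη _ j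
    have h := (potential_integrable hη (hνc j) (C := C j) fun n => ?_).2.1
    · simpa only [hP, EReal.toReal_coe] using h
    · refine (integral_mono (hη.integrable (continuous_truncPotential (hνc j) (dyadic_pos n)))
        (integrable_const (C j)) fun z => ?_).trans_eq (by simp)
      have h := truncPotential_le_potential (hνc j) n z
      rw [hP, EReal.coe_le_coe_iff] at h
      exact h.trans (hC j z)
  have hmct : ∀ {η : Measure ℂ}, CompactlyCarried η → IsProbabilityMeasure η →
      Tendsto (fun j => (((∫ z, P j z ∂η) - F j : ℝ) : EReal)) atTop
        (𝓝 (eintegral η (potential μ))) := by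
    intro η hη hηp
    refine (tendsto_eintegral_of_monotone
      (fun j => (hPint hη hηp j).sub (integrable_const (F j))) hmono hlim).congr fun j => ?_
    rw [integral_sub' (hPint hη hηp j) (integrable_const _)]
    simp
  have hcoe : ∀ {η : Measure ℂ}, CompactlyCarried η → IsProbabilityMeasure η → ∀ j,
      eintegral η (potential (ν j)) = ((∫ z, P j z ∂η : ℝ) : EReal) := fun hη hηp j => by
    rw [← eintegral_coe (hPint hη hηp j)]
    exact congrArg _ (funext (hP j))
  -- On a circle of radius `R` around 0 enclosing `K`, the potential of every probability measure on
  -- `K` has mean `-log R`. Integrating the monotone limit over it leaves only `F`.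
  have hF : Tendsto F atTop (𝓝 0) := by
    obtain ⟨R, hR, hKR⟩ : ∃ R : ℝ, 0 < R ∧ K ⊆ Metric.closedBall 0 R := by
      obtain ⟨R, hR⟩ := hK.isBounded.subset_closedBall_lt 0 0
      exact ⟨R, hR.1, hR.2⟩
    have htrunc : ∀ {η : Measure ℂ}, IsProbOn K η → truncPotential η R 0 = -Real.log R := by
      intro η hη
      have := hη.isProb
      have h : ∫ w, truncKernel R 0 w ∂η = ∫ _, -Real.log R ∂η := by
        refine integral_congr_ae ?_
        filter_upwards [hη.ae_mem] with w hw
        exact truncKernel_of_ge (by simpa using hKR hw)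
      rw [truncPotential, h]
      simp
    have hσ := compactlyCarried_circleMeasure 0 hR
    have hσp := (isProbOn_circleMeasure 0 hR).isProb
    have h := hmct hσ hσp
    have hσμ := potential_integrable_circleMeasure hμc 0 hR
    have hval : eintegral (circleMeasure 0 R) (potential μ) = ((-Real.log R : ℝ) : EReal) := by
      rw [eintegral_congr_ae hσμ.1, eintegral_coe hσμ.2.1, hσμ.2.2, htrunc hμ]
    have hvalj : ∀ j, ∫ z, P j z ∂(circleMeasure 0 R) = -Real.log R := fun j => by
      have h := (potential_integrable_circleMeasure (hνc j) 0 hR).2.2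
      simpa only [hP, EReal.toReal_coe, htrunc (hν j)] using h
    simp only [hval, hvalj] at h
    simpa using (EReal.tendsto_coe.1 h).const_sub (-Real.log R)
  have hm : Tendsto (fun j => (∫ z, P j z ∂μ) - F j) atTop (𝓝 e) := by
    have h := hmct hμc hμp
    rw [show eintegral μ (potential μ) = e from he] at h
    exact EReal.tendsto_coe.1 h
  -- Monotone convergence gives the integral of p_μ against `ν k`, which symmetry turns into that of
  -- `P k` against `μ`.
  have hk : ∀ k, Tendsto (fun j => (∫ z, P j z ∂ν k) - F j) atTop (𝓝 (∫ z, P k z ∂μ)) := fun k => by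
    have h := hmct (hνc k) (hνp k)
    rw [eintegral_potential_comm (hνc k) hμc, hcoe hμc hμp] at h
    exact EReal.tendsto_coe.1 h
  have hcomm : ∀ j k, ∫ z, P j z ∂ν k = ∫ z, P k z ∂ν j := fun j k => by
    have h := eintegral_potential_comm (hνc k) (hνc j)
    rw [hcoe (hνc k) (hνp k), hcoe (hνc j) (hνp j)] at h
    exact EReal.coe_injective h
  have hint_mono : ∀ i, Monotone fun j => (∫ z, P j z ∂ν i) - F j := fun i k j hkj => by
    have h := integral_mono ((hPint (hνc i) (hνp i) k).sub (integrable_const (F k)))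
      ((hPint (hνc i) (hνp i) j).sub (integrable_const (F j))) fun z => hmono z hkj
    simp only [Pi.sub_apply] at h
    rw [integral_sub (hPint (hνc i) (hνp i) k) (integrable_const _),
      integral_sub (hPint (hνc i) (hνp i) j) (integrable_const _)] at h
    simpa using h
  refine ⟨fun j => hPint (hνc j) (hνp j) j, hF, tendsto_order.2 ⟨fun b hb => ?_, fun b hb => ?_⟩⟩
  -- Lower bound: fix `k` with `∫ P k dμ - F k` near `e`. For `j ≥ k` monotonicity bounds the energy
  -- of `ν j` below by `∫ P k dν j - F k + F j`, and symmetry makes the limit in `j` available. The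
  -- term `2 * F j` offsets both shifts by `F j`.
  · obtain ⟨k, hbk⟩ := (hm.eventually_const_lt hb).exists
    have h := (((hk k).add (hF.const_mul 2)).sub_const (F k)).eventually_const_lt
      (by simpa using hbk : b < (∫ z, P k z ∂μ) + 2 * 0 - F k)
    filter_upwards [h, eventually_ge_atTop k] with j hj hkj
    have h1 : (∫ z, P k z ∂ν j) - F k ≤ (∫ z, P j z ∂ν j) - F j := hint_mono j hkj
    have h2 := hcomm j k
    linarith
  -- Upper bound: an increasing sequence is below its limit, so the energy of `ν j` is at most `∫ P
  -- j dμ + F j`, which tends to `e`.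
  · have h := (hm.add (hF.const_mul 2)).eventually_lt_const (by simpa using hb : e + 2 * 0 < b)
    filter_upwards [h] with j hj
    have h1 : (∫ z, P j z ∂ν j) - F j ≤ ∫ z, P j z ∂μ := (hint_mono j).ge_of_tendsto (hk j) j
    linarith

theorem exists_energy_eq_coe {μ : Measure ℂ} (hμ : CompactlyCarried μ) (h : energy μ < ⊤) :
    ∃ e : ℝ, energy μ = e ∧ ∀ n, truncEnergy (dyadic n) μ μ ≤ e := by
  have hle : ∀ n, (truncEnergy (dyadic n) μ μ : EReal) ≤ energy μ := fun n => by
    have hm : Monotone fun n => (truncEnergy (dyadic n) μ μ : EReal) := fun i j hij =>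
      EReal.coe_le_coe_iff.2 (monotone_truncEnergy hμ hμ hij)
    exact hm.ge_of_tendsto (tendsto_truncEnergy hμ hμ) n
  have hbot : energy μ ≠ ⊥ := ((EReal.bot_lt_coe _).trans_le (hle 0)).ne'
  refine ⟨(energy μ).toReal, (EReal.coe_toReal h.ne hbot).symm, fun n => ?_⟩
  rw [← EReal.coe_le_coe_iff, EReal.coe_toReal h.ne hbot]
  exact hle n

end LogPotential

end

/-! ### The main theorem -/

theorem proposition6p1 (K : Set ℂ) (hK : IsCompact K)
    (μ : Measure ℂ) (hμ : LogPotential.IsProbOn K μ) (hI : LogPotential.energy μ < ⊤)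
    (Q : ℕ → ℂ → ℝ) (hQ : ∀ j, ContinuousOn (Q j) K)
    (hQ_anti : ∀ z ∈ K, Antitone fun j => Q j z)
    (hQ_lim : ∀ z ∈ K,
      Tendsto (fun j => (Q j z : EReal)) atTop (𝓝 (-LogPotential.potential μ z))) :
    (∀ j, LogPotential.IsDdc (LogPotential.extremalStar K (Q j))
        (LogPotential.equilibriumMeasure K (Q j)) ∧
      LogPotential.IsProbOn K (LogPotential.equilibriumMeasure K (Q j))) ∧
    ∃ F : ℕ → ℝ,
      (∀ j z, LogPotential.potential (LogPotential.equilibriumMeasure K (Q j)) z +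
        LogPotential.extremalStar K (Q j) z = (F j : EReal)) ∧
      Tendsto F atTop (𝓝 0) ∧
      Tendsto (fun j => LogPotential.energy (LogPotential.equilibriumMeasure K (Q j))) atTop
        (𝓝 (LogPotential.energy μ)) ∧
      Tendsto (fun j => LogPotential.eintegral (LogPotential.equilibriumMeasure K (Q j))
          (LogPotential.extremalStar K (Q j))) atTop
        (𝓝 (LogPotential.eintegral μ fun z => -LogPotential.potential μ z)) := by
  open LogPotential in
  have hμc := hμ.compactlyCarried hK
  obtain ⟨e, he, hA⟩ := exists_energy_eq_coe hμc hI
  choose ν F c hν heq hlow _ using fun j =>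
    exists_extremalStar_eq_of_continuousOn hK (hQ j) hμ hA
  have hddc : ∀ j, IsDdc (extremalStar K (Q j)) (ν j) := fun j => by
    rw [funext (heq j)]
    exact isDdc_const_sub_potential hK (hν j) (hlow j)
  have hequil : ∀ j, equilibriumMeasure K (Q j) = ν j := fun j => (hddc j).ddc_eq
  simp only [hequil]
  set P : ℕ → ℂ → ℝ := fun j z => (potential (ν j) z).toReal with hPdef
  have hP : ∀ j z, potential (ν j) z = (P j z : EReal) := fun j z => by
    refine (EReal.coe_toReal (fun htop => ?_)
      (potential_ne_bot ((hν j).compactlyCarried hK) z)).symm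
    have h := hlow j z
    rw [htop, sub_eq_add_neg, EReal.neg_top, EReal.add_bot] at h
    simp at h
  have hu : ∀ j z, extremalStar K (Q j) z = ((F j - P j z : ℝ) : EReal) := fun j z => by
    rw [heq, hP, EReal.coe_sub]
  -- The constant minorant of the Green function bounds the potential above, making it integrable
  -- for every probability measure on `K`.
  have hC : ∀ j z, P j z ≤ F j - c j := fun j z => by
    have h := hlow j z
    rw [hP, ← EReal.coe_sub, EReal.coe_le_coe_iff] at h
    linarith
  have hmono : ∀ z, Monotone fun j => P j z - F j := fun z i j hij => by
    have h := extremalStar_mono (fun x hx => hQ_anti x hx hij) z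
    simp only at h
    rw [hu, hu, EReal.coe_le_coe_iff] at h
    dsimp only
    linarith
  have hlim : ∀ z, Tendsto (fun j => ((P j z - F j : ℝ) : EReal)) atTop (𝓝 (potential μ z)) := by
    intro z
    have h := tendsto_extremalStar hK hμ hA hQ hQ_anti hQ_lim z
    simp only [hu] at h
    simpa using tendsto_const_sub_coe h 0
  obtain ⟨hint, hF, hE⟩ := tendsto_of_monotone_potential hK hμ he hν hP hC hmono hlim
  refine ⟨fun j => ⟨hddc j, hν j⟩, F, fun j z => ?_, hF, ?_, ?_⟩
  · rw [hu, hP, ← EReal.coe_add]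
    congr 1
    ring
  · rw [he]
    refine (EReal.tendsto_coe.2 hE).congr fun j => ?_
    rw [← eintegral_coe (hint j)]
    exact (congrArg _ (funext (hP j))).symm
  · have hneg : eintegral μ (fun z => -potential μ z) = ((-e : ℝ) : EReal) := by
      rw [eintegral_neg_of_bddBelow
        (fun n => hμc.integrable (continuous_truncPotential hμc (dyadic_pos n)))
        (truncPotential_le_potential hμc 0), EReal.coe_neg, ← he]
      rfl
    rw [hneg]
    have h := hF.sub hE
    rw [zero_sub] at h
    refine (EReal.tendsto_coe.2 h).congr fun j => ?_
    have := (hν j).isProb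
    have hi : Integrable (fun z => F j - P j z) (ν j) := (integrable_const _).sub (hint j)
    rw [funext (hu j), eintegral_coe hi, integral_sub (integrable_const _) (hint j)]
    simp
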